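/- **Setting.** Fix $\mu\in\mathbb R^d$ and let $n$ training points have true labels $y_i\in\{\pm1\}$, observed labels $\tilde y_i\in\{\pm1\}$ and inputs $x_i$ made of two patches of $\mathbb R^d$, one equal to $y_i\mu$ and the other to $\xi_i$ (in either order), where $\xi_1,\dots,\xi_n$ are i.i.d. $N(0,\sigma_\xi^2 I_d)$. The set is balanced and $\tau_+$, $\tau_-$ are the fractions of flipped labels in the two classes: the numbers of $i$ with $(y_i,\tilde y_i)=(1,1),(1,-1),(-1,-1),(-1,1)$ are $\frac{(1-\tau_+)n}2,\frac{\tau_+n}2,\frac{(1-\tau_-)n}2,\frac{\tau_-n}2$. Sample $i$ is clean if $\tilde y_i=y_i$ and noisy otherwise. The network is $$f(W,x)=F_{+1}(W,x)-F_{-1}(W,x),\qquad F_j(W,x)=\frac1m\sum_{r=1}^m\big(\sigma(\langle w_{j,r},x^{(1)}\rangle)+\sigma(\langle w_{j,r},x^{(2)}\rangle)\big),$$ with $\sigma(z)=\max\{0,z\}$, and $L_S(W)=\frac1n\sum_i\log(1+\exp(-\tilde y_if(W,x_i)))$. Let $W^{(0)}$ have independent rows $w^{(0)}_{j,r}\sim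 N(0,\sigma_0^2I_d)$ ($j=\pm1$, $r\in[m]$), independent of the $\xi_i$, and let $W^{(t)}$ be the iterates of gradient descent on $L_S$ with learning rate $\eta>0$ (with $\sigma'(0)=1$). The test error $L_D^{0-1}(W)$ is the probability, given $\xi_1,\dots,\xi_n$, that $y f(W,[y\mu,\xi_I+\zeta])<0$, where $y$ is uniform on $\{\pm1\}$, $I$ uniform on $[n]$ and $\zeta\sim N(0,\sigma_\xi^2I_d)$, all independent. The signal and noise coefficients $\gamma^{(t)}_{j,r},\rho^{(t)}_{j,r,i}$ are defined by $$w^{(t)}_{j,r}=w^{(0)}_{j,r}+j\,\gamma^{(t)}_{j,r}\frac{\mu}{\|\mu\|^2}+\sum_{i=1}^n\rho^{(t)}_{j,r,i}\frac{\xi_i}{\|\xi_i\|^2},\qquad \overline\rho^{(t)}_{j,r,i}=\rho^{(t)}_{j,r,i}\mathbf 1(\rho^{(t)}_{j,r,i}\ge0).$$ Put $\mathrm{SNR}=\|\mu\|/(\sigma_\xi\sqrt d)$ and, for $\kappa,\epsilon>0$ and $\epsilon_1=\min\{\epsilon,1\}$, $$T^*=\kappa\,\eta^{-1}\epsilon_1^{-1}nm\,\sigma_\xi^{-2}d^{-1}\log(2/\epsilon_1)^2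 .$$ **Theorem.** Let $0<c_1\le c_2$, $0<\tau_{lo}\le\tau_{hi}<\frac12$ and $\kappa_1>0$. There are constants $C,\kappa,\tau_0>0$, depending only on these five numbers, such that the following holds for all $\epsilon>0$, all $\delta\in(0,1)$ and all $n,m,d,\mu,\sigma_\xi>0,\sigma_0>0,\eta>0,\tau_\pm$ and labels as above with 1. $c_1\le n\,\mathrm{SNR}^2\le c_2$ and $\tau_+,\tau_-\in[\tau_{lo},\tau_{hi}]$; 2. $d\ge C\max\{n^2\log(nm/\delta)\log(T^*)^2,\ n\|\mu\|\sigma_\xi^{-1}\sqrt{\log(n/\delta)}\}$; 3. $m\ge C\log(n/\delta)$ and $n\ge C\log(m/\delta)$; 4. $\|\mu\|^2\ge C\sigma_\xi^2\log(n/\delta)$; 5. $\sigma_0\le C^{-1}\min\{\sqrt n\,\sigma_\xi^{-1}d^{-1},\ \|\mu\|^{-1}\log(m/\delta)^{-1/2}\}$; 6. $\eta\le C^{-1}\min\{\sigma_\xi^{-2}d^{-3/2}n^2m\sqrt{\log(n/\delta)},\ \sigma_\xi^{-2}d^{-1}n\}$. With probability at least $1-\delta$ over $W^{(0)}$ and $\xi_1,\dots,\xi_n$: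 for every integer $T_1\ge 0$ with $T_1\le\kappa_1\eta^{-1}nm\sigma_\xi^{-2}d^{-1}$ there is an integer $t^*\in[T_1,T^*]$ such that $L_S(W^{(t^*)})\le\epsilon$ and * every clean sample satisfies $\tilde y_if(W^{(t^*)},x_i)\ge0$; * the coefficients $\gamma^{(t^*)},\rho^{(t^*)}$ exist and are unique, and for some $\tau'\in[\tau_0,\frac{\tau_++\tau_-}2]$ there are $\tau'n$ noisy samples $i$ with $\frac1m\sum_{r}\overline\rho^{(t^*)}_{\tilde y_i,r,i}>\frac1m\sum_{r}\gamma^{(t^*)}_{-\tilde y_i,r}$ and $\tilde y_if(W^{(t^*)},x_i)\ge0$; * $L_D^{0-1}(W^{(t^*)})\ge\frac12\min\{\tau_+,\tau_-\}$ if $\tau_+\ne\tau_-$, and $L_D^{0-1}(W^{(t^*)})\ge\frac12(1-e^{-n})\min\{\tau_+,\tau_-\}$ in every case. -/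

import Mathlib

open MeasureTheory ProbabilityTheory

noncomputable section

namespace LabelNoise

/-- A single data patch, a vector of `ℝ^d` with the Euclidean norm. -/
abbrev Patch (d : ℕ) := EuclideanSpace ℝ (Fin d)

/-- A data point `x = [x⁽¹⁾, x⁽²⁾]`. -/
abbrev Input (d : ℕ) := Patch d × Patch d

/-- First-layer weights `w_{j,r}`, `j = ±1`, `r ∈ [m]`. Labels and the index `j` are elements of
`ℤˣ = {1, -1}`. -/
abbrev Weights (m d : ℕ) := ℤˣ → Fin m → Patch d

/-- A label as a real number. -/
def lab (y : ℤˣ) : ℝ := ((y : ℤ) : ℝ)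

/-! ### The network, the loss and gradient descent -/

def relu (z : ℝ) : ℝ := max 0 z

/-- The derivative of the ReLU, with the convention `σ'(0) = 1`. -/
def reluDeriv (z : ℝ) : ℝ := if 0 ≤ z then 1 else 0

/-- `F_j(W_j, x)`. -/
def branch {m d : ℕ} (W : Weights m d) (j : ℤˣ) (x : Input d) : ℝ :=
  (1 / (m : ℝ)) * ∑ r : Fin m, (relu (inner ℝ (W j r) x.1) + relu (inner ℝ (W j r) x.2))

/-- The network output `f(W, x) = F_{+1}(W_{+1}, x) - F_{-1}(W_{-1}, x)`. -/
def net {m d : ℕ} (W : Weights m d) (x : Input d) : ℝ :=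
  branch W 1 x - branch W (-1) x

/-- The logistic loss `ℓ(f, y) = log (1 + exp (-f y))`. -/
def logisticLoss (f y : ℝ) : ℝ := Real.log (1 + Real.exp (-(f * y)))

/-- `ℓ'(f, y) = -1 / (1 + exp (y f))`. -/
def lossDeriv (f y : ℝ) : ℝ := -(1 / (1 + Real.exp (y * f)))

/-- The empirical risk `L_S(W)`. -/
def trainLoss {n m d : ℕ} (x : Fin n → Input d) (yt : Fin n → ℤˣ) (W : Weights m d) : ℝ :=
  (1 / (n : ℝ)) * ∑ i : Fin n, logisticLoss (net W (x i)) (lab (yt i))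

/-- The gradient of `L_S` with respect to `w_{j,r}`, computed by the chain rule. -/
def gradLoss {n m d : ℕ} (x : Fin n → Input d) (yt : Fin n → ℤˣ) (W : Weights m d)
    (j : ℤˣ) (r : Fin m) : Patch d :=
  (1 / ((n : ℝ) * m)) • ∑ i : Fin n, (lossDeriv (net W (x i)) (lab (yt i)) * lab j * lab (yt i)) •
    (reluDeriv (inner ℝ (W j r) (x i).1) • (x i).1 + reluDeriv (inner ℝ (W j r) (x i).2) • (x i).2)

/-- One step of full-batch gradient descent with learning rate `η`. -/
def gdStep {n m d : ℕ} (η : ℝ) (x : Fin n → Input d) (yt : Fin n → ℤˣ) (W : Weights m d) :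
    Weights m d :=
  fun j r => W j r - η • gradLoss x yt W j r

/-- The iterate `W^{(t)}` of gradient descent started at `W₀`. -/
def gd {n m d : ℕ} (η : ℝ) (x : Fin n → Input d) (yt : Fin n → ℤˣ) (W₀ : Weights m d) (t : ℕ) :
    Weights m d :=
  (gdStep η x yt)^[t] W₀

/-! ### Data -/

/-- The training inputs: one patch is the signal `y_i μ`, the other one the noise `ξ_i`; `pos i`
tells which one comes first. -/
def trainInput {n d : ℕ} (μ : Patch d) (y : Fin n → ℤˣ) (pos : Fin n → Bool)
    (ξ : Fin n → Patch d) (i : Fin n) : Input d :=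
  if pos i then (lab (y i) • μ, ξ i) else (ξ i, lab (y i) • μ)

/-- The training set is balanced and the fractions of flipped labels in the classes `+1` and `-1`
are `τp` and `τm`. -/
structure LabelCounts {n : ℕ} (y yt : Fin n → ℤˣ) (τp τm : ℝ) : Prop where
  pos_clean : (({i | y i = 1 ∧ yt i = y i} : Finset (Fin n)).card : ℝ) = (1 - τp) * n / 2
  pos_noisy : (({i | y i = 1 ∧ yt i ≠ y i} : Finset (Fin n)).card : ℝ) = τp * n / 2
  neg_clean : (({i | y i = -1 ∧ yt i = y i} : Finset (Fin n)).card : ℝ) = (1 - τm) * n / 2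
  neg_noisy : (({i | y i = -1 ∧ yt i ≠ y i} : Finset (Fin n)).card : ℝ) = τm * n / 2

/-- The Gaussian distribution `N(0, σ² I_d)`. -/
def gaussianPatch (d : ℕ) (σ : ℝ) : Measure (Patch d) :=
  (stdGaussian (Patch d)).map (fun v => σ • v)

/-- The joint law of the initialization `W^{(0)}`, whose rows are i.i.d. `N(0, σ0² I_d)`, and of
the training noise patches `ξ_1, …, ξ_n`, which are i.i.d. `N(0, σξ² I_d)`. -/
def trainLaw (n m d : ℕ) (σ0 σξ : ℝ) : Measure (Weights m d × (Fin n → Patch d)) :=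
  (Measure.pi fun _ : ℤˣ => Measure.pi fun _ : Fin m => gaussianPatch d σ0).prod
    (Measure.pi fun _ : Fin n => gaussianPatch d σξ)

/-- The randomness of a test point: a Rademacher label `y`, a uniform index `i ∈ [n]` and a
Gaussian vector `ζ ~ N(0, σξ² I_d)`, independent. -/
def testLaw (n d : ℕ) (σξ : ℝ) : Measure (ℤˣ × Fin n × Patch d) :=
  (uniformOn Set.univ).prod ((uniformOn Set.univ).prod (gaussianPatch d σξ))

/-- The test 0-1 error `L_D^{0-1}(W)`: the probability of `y f(W, x) < 0` for
`x = [y μ, ξ_i + ζ]`. -/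
def testError {n m d : ℕ} (μ : Patch d) (σξ : ℝ) (ξ : Fin n → Patch d) (W : Weights m d) : ℝ :=
  (testLaw n d σξ).real
    {p | lab p.1 * net W (lab p.1 • μ, ξ p.2.1 + p.2.2) < 0}

/-! ### Signal-noise decomposition -/

/-- `γ` and `ρ` are the signal and noise coefficients of `W` relative to the initialization `W₀`:
`w_{j,r} = w_{j,r}^{(0)} + j γ_{j,r} ‖μ‖⁻² μ + ∑ i, ρ_{j,r,i} ‖ξ_i‖⁻² ξ_i`. -/
def IsDecomposition {n m d : ℕ} (μ : Patch d) (ξ : Fin n → Patch d) (W₀ W : Weights m d)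
    (γ : ℤˣ → Fin m → ℝ) (ρ : ℤˣ → Fin m → Fin n → ℝ) : Prop :=
  ∀ j r, W j r = W₀ j r + (lab j * γ j r * (‖μ‖ ^ 2)⁻¹) • μ +
    ∑ i : Fin n, (ρ j r i * (‖ξ i‖ ^ 2)⁻¹) • ξ i

/-- The decomposition, together with its uniqueness. -/
def IsUniqueDecomposition {n m d : ℕ} (μ : Patch d) (ξ : Fin n → Patch d) (W₀ W : Weights m d)
    (γ : ℤˣ → Fin m → ℝ) (ρ : ℤˣ → Fin m → Fin n → ℝ) : Prop :=
  IsDecomposition μ ξ W₀ W γ ρ ∧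
    ∀ γ' ρ', IsDecomposition μ ξ W₀ W γ' ρ' → γ' = γ ∧ ρ' = ρ

/-- The positive part `ρ̄ = ρ 𝟙(ρ ≥ 0)` of a noise coefficient. -/
def rhoBar (ρ : ℝ) : ℝ := if 0 ≤ ρ then ρ else 0

/-! ### Time scales and the standing condition -/

/-- The signal-to-noise ratio `‖μ‖ / (σξ √d)`. -/
def snr {d : ℕ} (μ : Patch d) (σξ : ℝ) : ℝ := ‖μ‖ / (σξ * √(d : ℝ))

/-- The time scale `η⁻¹ n m σξ⁻² d⁻¹` of the first stage. -/
def stageOneScale (n m d : ℕ) (σξ η : ℝ) : ℝ :=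
  η⁻¹ * n * m * (σξ ^ 2)⁻¹ * (d : ℝ)⁻¹

/-- The maximal number of iterations
`T* = κ η⁻¹ ε₁⁻¹ n m σξ⁻² d⁻¹ log(2/ε₁)²`, where `ε₁ = min ε 1`. -/
def maxIter (κ ε : ℝ) (n m d : ℕ) (σξ η : ℝ) : ℝ :=
  κ * ((min ε 1)⁻¹ * stageOneScale n m d σξ η) * Real.log (2 / min ε 1) ^ 2

/-- The standing condition. Here `C` is the large constant, `c₁, c₂` and `τlo, τhi` are the
constants in `n · SNR² = Θ(1)` and `τ₊, τ₋ = Θ(1)`, and `Tstar` is the maximal number of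
iterations. -/
structure Condition (C c₁ c₂ τlo τhi Tstar : ℝ) (n m d : ℕ) (μ : Patch d)
    (σξ σ0 η τp τm δ : ℝ) : Prop where
  σξ_pos : 0 < σξ
  σ0_pos : 0 < σ0
  η_pos : 0 < η
  δ_pos : 0 < δ
  δ_lt : δ < 1
  snr_mem : n * snr μ σξ ^ 2 ∈ Set.Icc c₁ c₂
  τp_mem : τp ∈ Set.Icc τlo τhi
  τm_mem : τm ∈ Set.Icc τlo τhi
  dim_large : C * max ((n : ℝ) ^ 2 * Real.log (n * m / δ) * Real.log Tstar ^ 2)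
    (n * ‖μ‖ * σξ⁻¹ * √(Real.log (n / δ))) ≤ d
  width_large : C * Real.log (n / δ) ≤ m
  sample_large : C * Real.log (m / δ) ≤ n
  signal_large : C * σξ ^ 2 * Real.log (n / δ) ≤ ‖μ‖ ^ 2
  init_small : σ0 ≤ C⁻¹ * min (√(n : ℝ) * σξ⁻¹ * (d : ℝ)⁻¹)
    (‖μ‖⁻¹ * (√(Real.log (m / δ)))⁻¹)
  step_small : η ≤ C⁻¹ * min
    ((σξ ^ 2)⁻¹ * (d : ℝ) ^ (-(3 / 2) : ℝ) * (n : ℝ) ^ 2 * m * √(Real.log (n / δ)))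
    ((σξ ^ 2)⁻¹ * (d : ℝ)⁻¹ * n)

/-! ### The outcome of the second stage -/

/-- The noisy samples whose averaged noise coefficient exceeds the averaged signal coefficient and
which are fitted to their wrong observed label. -/
def memorized {n m d : ℕ} (x : Fin n → Input d) (y yt : Fin n → ℤˣ) (W : Weights m d)
    (γ : ℤˣ → Fin m → ℝ) (ρ : ℤˣ → Fin m → Fin n → ℝ) : Set (Fin n) :=
  {i | yt i ≠ y i ∧
    (1 / (m : ℝ)) * ∑ r : Fin m, γ (-yt i) r < (1 / (m : ℝ)) * ∑ r : Fin m, rhoBar (ρ (yt i) r i) ∧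
    0 ≤ lab (yt i) * net W (x i)}

end LabelNoise

end

open MeasureTheory ProbabilityTheory

noncomputable section

namespace LabelNoise

/-! ### Labels -/

/-! With high probability the noise patches, `μ` and the initial weights are nearly orthogonal.
Then, up to a small error, `⟨w_{j,r}, ξ_i⟩` is `ρ_{j,r,i}` and `⟨w_{j,r}, jμ⟩` is `γ_{j,r}`.
Coefficients `ρ` of the observed label stay nonnegative and those of the other label nonpositive, so
the ReLU keeps the former and kills the latter. Hence the margin of sample `i` is `A_i + s_i
P_{y_i}` up to `1/2`: here `A_i` is the averaged `ρ`, `s_i = ±1` says whether `i` is clean or noisy,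
and `P_c` comes from the signal patch of class `c`. With `h = ησξ²d/(nm)`, the part `A_i` grows at a
rate between `h/8` and `2h` times the logistic weight of `i`, while `P_c` follows the signed average
of the weights in class `c` at a speed `O(h)`, because `n·SNR²` is bounded. This scalar system is
`MarginFlow`.

The system equalizes its margins by negative feedback: a larger margin has an exponentially smaller
weight and so grows more slowly. Barrier arguments compare two samples of the same kind (only `A`
differs), then clean with noisy samples of one class (the drift of `P` helps the smaller margins),
and finally the two classes, through sums over a clean and a noisy sample, where `P` cancels. So all
margins stay within a constant of each other (`MarginFlow.proxy_sub_le`) and grow like `log(ht)`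
(`MarginFlow.exists_level`).

The reduction needs coefficients bounded by `Λ ~ log T*` and initially active neurons that stay
active. Both follow from the flow at earlier times: logarithmic growth bounds the coefficients, and
comparable weights let the own noise patch dominate the cross terms. This bootstrap is
`Run.Regular.controlled`.

At `t* = ⌊T*⌋` every margin is at least `1` and every `exp(-margin)` is at most `ε`, so clean and
noisy samples are all fitted. For two noisy samples of different classes the signal contributions
add up to the two averaged `γ`, so at least one of the two is dominated by noise; hence all noisy
samples of some class are memorized (`noise_dominates_or`). The weights are so short that the fresh
test noise moves the output by less than `1` except with probability `e^{-n}`. A test point built on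
a noisy sample with its true label is therefore misclassified, which bounds the test error from
below (`card_le_testError`). -/

lemma lab_one : lab 1 = 1 := by simp [lab]

lemma lab_neg (s : ℤˣ) : lab (-s) = -lab s := by simp [lab]

lemma lab_mul (s u : ℤˣ) : lab (s * u) = lab s * lab u := by simp [lab]

lemma lab_mul_self (s : ℤˣ) : lab s * lab s = 1 := by
  rcases Int.units_eq_one_or s with rfl | rfl <;> simp [lab]

lemma abs_lab (s : ℤˣ) : |lab s| = 1 := by
  rcases Int.units_eq_one_or s with rfl | rfl <;> simp [lab]

/-! ### The logistic weight -/

/-- The absolute value of the derivative of the logistic loss at margin `z`. -/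
def logisticWeight (z : ℝ) : ℝ := 1 / (1 + Real.exp z)

lemma logisticWeight_pos (z : ℝ) : 0 < logisticWeight z := by
  unfold logisticWeight; positivity

lemma logisticWeight_le_one (z : ℝ) : logisticWeight z ≤ 1 := by
  unfold logisticWeight
  rw [div_le_one (by positivity)]
  linarith [Real.exp_pos z]

lemma logisticWeight_le_exp_neg (z : ℝ) : logisticWeight z ≤ Real.exp (-z) := by
  unfold logisticWeight
  rw [Real.exp_neg, ← one_div]
  exact one_div_le_one_div_of_le (Real.exp_pos z) (by linarith)

lemma half_le_logisticWeight {z : ℝ} (hz : z ≤ 0) : 1 / 2 ≤ logisticWeight z := by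
  unfold logisticWeight
  have := Real.exp_le_one_iff.2 hz
  exact one_div_le_one_div_of_le (by positivity) (by linarith)

lemma logisticWeight_anti {z w : ℝ} (h : z ≤ w) : logisticWeight w ≤ logisticWeight z := by
  unfold logisticWeight
  have := Real.exp_le_exp.2 h
  exact one_div_le_one_div_of_le (by positivity) (by linarith)

/-- Close margins have comparable weights. -/
lemma logisticWeight_le_exp_mul {z w b : ℝ} (hb : 0 ≤ b) (h : w - z ≤ b) :
    logisticWeight z ≤ Real.exp b * logisticWeight w := by
  unfold logisticWeight
  rw [mul_one_div, div_le_div_iff₀ (by positivity) (by positivity)]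
  have h1 : Real.exp w ≤ Real.exp b * Real.exp z := by
    rw [← Real.exp_add]; exact Real.exp_le_exp.2 (by linarith)
  have h2 : 1 ≤ Real.exp b := Real.one_le_exp hb
  nlinarith

/-- A much larger margin has a much smaller weight, unless the smaller margin is very negative. -/
lemma logisticWeight_le_of_gap {z w b D : ℝ} (hw : -b ≤ w) (h : D ≤ z - w) :
    logisticWeight z ≤ Real.exp (-D) * (1 + Real.exp b) * logisticWeight w := by
  have h1 : logisticWeight z ≤ Real.exp (-D) * Real.exp (-w) := by
    rw [← Real.exp_add]
    exact (logisticWeight_le_exp_neg z).trans (Real.exp_le_exp.2 (by linarith))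
  have h2 : Real.exp (-w) ≤ (1 + Real.exp b) * logisticWeight w := by
    unfold logisticWeight
    rw [mul_one_div, le_div_iff₀ (by positivity), mul_add, ← Real.exp_add]
    have : Real.exp (-w) ≤ Real.exp b := Real.exp_le_exp.2 (by linarith)
    simp; linarith
  calc _ ≤ _ := h1
    _ ≤ Real.exp (-D) * ((1 + Real.exp b) * logisticWeight w) := by gcongr
    _ = _ := by ring

/-- A sequence with small steps that cannot increase above `b` stays below `b + 1`. -/
lemma le_add_one_of_barrier {X : ℕ → ℝ} {b : ℝ} {T : ℕ} (h0 : X 0 ≤ b)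
    (hstep : ∀ t < T, X (t + 1) ≤ X t + 1) (hdec : ∀ t < T, b ≤ X t → X (t + 1) ≤ X t) :
    ∀ t ≤ T, X t ≤ b + 1 := by
  intro t
  induction t with
  | zero => intro _; linarith
  | succ t ih =>
    intro ht
    rcases le_total b (X t) with h | h
    · exact (hdec t ht h).trans (ih (by omega))
    · linarith [hstep t ht]

/-! ### Margin dynamics -/

/-- The signed average of the logistic weights over a class. -/
def drift {ι : Type*} [Fintype ι] (cls s : ι → ℤˣ) (M : ι → ℝ) (c : ℤˣ) : ℝ :=
  (∑ i with cls i = c, lab (s i) * logisticWeight (M i)) / Fintype.card ι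

/-- Sample `i` has class `cls i` and is clean or noisy according to `s i = 1` or `s i = -1`. Its
margin `M t i` is, up to a bounded error, the noise part `A t i` plus `s i` times the signal part
`P t (cls i)` of its class. The noise part grows at a rate proportional to the logistic weight, the
signal part moves in the direction of the drift of the class. -/
structure MarginFlow {ι : Type*} [Fintype ι] (cls s : ι → ℤˣ) (h α β K : ℝ) (T : ℕ)
    (A : ℕ → ι → ℝ) (P : ℕ → ℤˣ → ℝ) (M : ℕ → ι → ℝ) : Prop where
  A_zero : ∀ i, A 0 i = 0
  P_zero : ∀ c, P 0 c = 0
  A_lower : ∀ t < T, ∀ i, α * h * logisticWeight (M t i) ≤ A (t + 1) i - A t i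
  A_upper : ∀ t < T, ∀ i, A (t + 1) i - A t i ≤ β * h * logisticWeight (M t i)
  P_of_nonneg : ∀ t < T, ∀ c, 0 ≤ drift cls s (M t) c →
    0 ≤ P (t + 1) c - P t c ∧ P (t + 1) c - P t c ≤ 2 * h * K * drift cls s (M t) c
  P_of_nonpos : ∀ t < T, ∀ c, drift cls s (M t) c ≤ 0 →
    2 * h * K * drift cls s (M t) c ≤ P (t + 1) c - P t c ∧ P (t + 1) c - P t c ≤ 0
  approx : ∀ t < T, ∀ i, |M t i - (A t i + lab (s i) * P t (cls i))| ≤ 1 / 2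

/-- Each of the four kinds of samples makes up at least the fraction `p`. -/
def Populated {ι : Type*} [Fintype ι] (cls s : ι → ℤˣ) (p : ℝ) : Prop :=
  ∀ c σ : ℤˣ, p * Fintype.card ι ≤ ({i | cls i = c ∧ s i = σ} : Finset ι).card

/-! ### One-step bounds for the drift of a class. -/

section Drift

variable {ι : Type*} [Fintype ι] {cls s : ι → ℤˣ}

lemma lab_mul_drift (M : ι → ℝ) (c σ : ℤˣ) :
    lab σ * drift cls s M c = (∑ i with cls i = c ∧ s i = σ, logisticWeight (M i) -
      ∑ i with cls i = c ∧ s i = -σ, logisticWeight (M i)) / Fintype.card ι := by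
  unfold drift
  rw [mul_div_assoc', Finset.mul_sum]
  congr 1
  simp only [Finset.sum_filter, ← Finset.sum_sub_distrib]
  refine Finset.sum_congr rfl fun i _ => ?_
  rcases Int.units_eq_one_or (s i) with h | h <;> rcases Int.units_eq_one_or σ with rfl | rfl <;>
    by_cases hc : cls i = c <;> simp [h, hc, lab]

/-- Only samples of sign `-σ` pull the drift against `σ`, and there are at most `|ι|` of them. -/
lemma neg_le_lab_mul_drift [Nonempty ι] {M : ι → ℝ} {c σ : ℤˣ} {q : ℝ} (hq : 0 ≤ q)
    (h : ∀ k, cls k = c → s k = -σ → logisticWeight (M k) ≤ q) :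
    -q ≤ lab σ * drift cls s M c := by
  have hn : (0 : ℝ) < Fintype.card ι := by exact_mod_cast Fintype.card_pos
  rw [lab_mul_drift, le_div_iff₀ hn]
  have h1 : 0 ≤ ∑ i with cls i = c ∧ s i = σ, logisticWeight (M i) :=
    Finset.sum_nonneg fun i _ => (logisticWeight_pos _).le
  have h2 : ∑ i with cls i = c ∧ s i = -σ, logisticWeight (M i) ≤ Fintype.card ι * q := by
    calc _ ≤ ∑ i with cls i = c ∧ s i = -σ, q :=
          Finset.sum_le_sum fun i hi => by
            simp only [Finset.mem_filter] at hi; exact h i hi.2.1 hi.2.2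
      _ ≤ _ := by
        rw [Finset.sum_const, nsmul_eq_mul]
        gcongr
        exact Finset.card_le_univ _
  linarith

/-- Summing the hypothesis over all pairs gives `|S| ∑_O w ≤ |O| p ∑_S w`. Since `|S| ≥ p|ι|` and
`|O| ≤ |ι|`, the factor `p` makes up for the possible imbalance of the two groups. -/
lemma lab_mul_drift_nonneg [Nonempty ι] {p : ℝ} (hp : 0 < p) (hpop : Populated cls s p)
    {M : ι → ℝ} {c σ : ℤˣ}
    (h : ∀ i k, cls i = c → s i = σ → cls k = c → s k = -σ →
      logisticWeight (M k) ≤ p * logisticWeight (M i)) :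
    0 ≤ lab σ * drift cls s M c := by
  have hn : (0 : ℝ) < Fintype.card ι := by exact_mod_cast Fintype.card_pos
  rw [lab_mul_drift]
  refine div_nonneg ?_ hn.le
  set S : Finset ι := {i | cls i = c ∧ s i = σ}
  set O : Finset ι := {i | cls i = c ∧ s i = -σ}
  have hS : p * Fintype.card ι ≤ S.card := hpop c σ
  have hO : (O.card : ℝ) ≤ Fintype.card ι := by exact_mod_cast Finset.card_le_univ _
  have h0 : 0 ≤ ∑ i ∈ S, logisticWeight (M i) :=
    Finset.sum_nonneg fun i _ => (logisticWeight_pos _).le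
  have h1 : (S.card : ℝ) * ∑ k ∈ O, logisticWeight (M k) ≤
      O.card * (p * ∑ i ∈ S, logisticWeight (M i)) := by
    calc _ = ∑ k ∈ O, ∑ i ∈ S, logisticWeight (M k) := by
          simp [Finset.mul_sum]
      _ ≤ ∑ k ∈ O, ∑ i ∈ S, p * logisticWeight (M i) := by
          refine Finset.sum_le_sum fun k hk => Finset.sum_le_sum fun i hi => ?_
          simp only [S, O, Finset.mem_filter, Finset.mem_univ, true_and] at hk hi
          exact h i k hi.1 hi.2 hk.1 hk.2
      _ = _ := by simp [Finset.mul_sum]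
  have hpn : 0 < p * Fintype.card ι := by positivity
  have h2 : (p * Fintype.card ι) * ∑ k ∈ O, logisticWeight (M k) ≤
      (p * Fintype.card ι) * ∑ i ∈ S, logisticWeight (M i) := by
    calc _ ≤ (S.card : ℝ) * ∑ k ∈ O, logisticWeight (M k) := by
          gcongr
          exact Finset.sum_nonneg fun i _ => (logisticWeight_pos _).le
      _ ≤ _ := h1
      _ ≤ Fintype.card ι * (p * ∑ i ∈ S, logisticWeight (M i)) := by gcongr
      _ = _ := by ring
  linarith [le_of_mul_le_mul_left h2 hpn]

lemma Populated.exists {p : ℝ} (hpop : Populated cls s p) (hp : 0 < p) [Nonempty ι] (c σ : ℤˣ) :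
    ∃ i, cls i = c ∧ s i = σ := by
  have hn : (0 : ℝ) < Fintype.card ι := by exact_mod_cast Fintype.card_pos
  have h1 : (0 : ℝ) < ({i | cls i = c ∧ s i = σ} : Finset ι).card :=
    lt_of_lt_of_le (by positivity) (hpop c σ)
  obtain ⟨i, hi⟩ := Finset.card_pos.1 (by exact_mod_cast h1)
  exact ⟨i, by simpa using hi⟩

end Drift

/-- A gap beyond which the larger margin of two samples grows more slowly. -/
def feedbackGap (α β K p : ℝ) : ℝ :=
  Real.log ((1 + Real.exp (2 + 4 * K / α)) / min p (α / β)) + 1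

/-- The bound on the difference of two margins. -/
def marginGap (α β K p : ℝ) : ℝ := 13 * feedbackGap α β K p + 13

/-! ### Equalization of the margins and their logarithmic growth. -/

namespace MarginFlow

variable {ι : Type*} [Fintype ι] {cls s : ι → ℤˣ} {h α β K p : ℝ} {T : ℕ}
  {A : ℕ → ι → ℝ} {P : ℕ → ℤˣ → ℝ} {M : ℕ → ι → ℝ}

/-- A one-sided drift bound becomes a one-sided step bound. The case `q = 0` gives monotonicity, `q
= 1` the trivial bound on a step. -/
lemma lab_mul_step (F : MarginFlow cls s h α β K T A P M) (hh : 0 ≤ h) (hK : 0 ≤ K)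
    {t : ℕ} (ht : t < T) {c σ : ℤˣ} {q : ℝ} (hq : 0 ≤ q)
    (hd : -q ≤ lab σ * drift cls s (M t) c) :
    -(2 * h * K * q) ≤ lab σ * (P (t + 1) c - P t c) := by
  have hhK : 0 ≤ 2 * h * K := by positivity
  rcases le_total 0 (drift cls s (M t) c) with h0 | h0
  · obtain ⟨h1, h2⟩ := F.P_of_nonneg t ht c h0
    rcases Int.units_eq_one_or σ with rfl | rfl
    · rw [lab_one, one_mul]
      have := mul_nonneg hhK hq
      linarith
    · rw [lab_neg, lab_one] at hd ⊢
      have := mul_le_mul_of_nonneg_left hd hhK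
      linarith
  · obtain ⟨h1, h2⟩ := F.P_of_nonpos t ht c h0
    rcases Int.units_eq_one_or σ with rfl | rfl
    · rw [lab_one, one_mul] at hd ⊢
      have := mul_le_mul_of_nonneg_left hd hhK
      linarith
    · rw [lab_neg, lab_one]
      have := mul_nonneg hhK hq
      linarith

lemma A_mono (F : MarginFlow cls s h α β K T A P M) (hh : 0 ≤ h) (hα : 0 ≤ α) {t : ℕ}
    (ht : t < T) (i : ι) : A t i ≤ A (t + 1) i := by
  have := F.A_lower t ht i
  have : 0 ≤ α * h * logisticWeight (M t i) :=
    mul_nonneg (mul_nonneg hα hh) (logisticWeight_pos _).le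
  linarith

lemma A_nonneg (F : MarginFlow cls s h α β K T A P M) (hh : 0 ≤ h) (hα : 0 ≤ α) {t : ℕ}
    (ht : t ≤ T) (i : ι) : 0 ≤ A t i := by
  induction t with
  | zero => rw [F.A_zero]
  | succ t ih => exact (ih (by omega)).trans (F.A_mono hh hα ht i)

lemma A_step_le (F : MarginFlow cls s h α β K T A P M) (hh : 0 ≤ h) (hβ : 0 ≤ β) {t : ℕ}
    (ht : t < T) (i : ι) : A (t + 1) i - A t i ≤ β * h := by
  have h1 := F.A_upper t ht i
  have h2 : β * h * logisticWeight (M t i) ≤ β * h :=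
    mul_le_of_le_one_right (by positivity) (logisticWeight_le_one _)
  linarith

/-- The proxy of a margin. -/
def proxy (cls s : ι → ℤˣ) (A : ℕ → ι → ℝ) (P : ℕ → ℤˣ → ℝ) (t : ℕ) (i : ι) : ℝ :=
  A t i + lab (s i) * P t (cls i)

variable [Nonempty ι]

lemma abs_step_le (F : MarginFlow cls s h α β K T A P M) (hh : 0 ≤ h) (hK : 0 ≤ K)
    {t : ℕ} (ht : t < T) (c σ : ℤˣ) : |lab σ * (P (t + 1) c - P t c)| ≤ 2 * h * K := by
  have h1 : ∀ σ : ℤˣ, -(2 * h * K * 1) ≤ lab σ * (P (t + 1) c - P t c) := fun σ =>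
    F.lab_mul_step hh hK ht zero_le_one
      (neg_le_lab_mul_drift zero_le_one fun k _ _ => logisticWeight_le_one _)
  have h2 := h1 (-σ)
  rw [lab_neg] at h2
  rw [abs_le]
  constructor <;> linarith [h1 σ]

/-- Since `A ≥ 0`, a very negative proxy means that the signal part strongly disfavours `i`. Then it
favours the opposite samples of the class, whose weights become tiny, so the pull against `i` is
weaker than the growth of `A_i`, whose weight is at least `1/2`. -/
lemma proxy_lower (F : MarginFlow cls s h α β K T A P M) (hh : 0 ≤ h) (hα : 0 < α)
    (hK : 0 ≤ K) (hsmall : h * (β + 4 * K) ≤ 1 / 4) (hβ : 0 ≤ β) {t : ℕ} (ht : t ≤ T) (i : ι) :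
    -(1 / 2 + 4 * K / α) - 1 ≤ proxy cls s A P t i := by
  have hβh : 0 ≤ β * h := by positivity
  suffices -proxy cls s A P t i ≤ (1 / 2 + 4 * K / α) + 1 by linarith
  refine le_add_one_of_barrier (X := fun t => -proxy cls s A P t i) (T := T) ?_ ?_ ?_ t ht
  · simp only [proxy, F.A_zero, F.P_zero]
    have : 0 ≤ 4 * K / α := by positivity
    linarith
  · intro t ht
    have h1 := F.A_mono hh hα.le ht i
    have h2 := (abs_le.1 (F.abs_step_le hh hK ht (cls i) (s i))).1
    simp only [proxy]
    nlinarith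
  · intro t ht hb
    simp only [proxy] at hb ⊢
    have hA := F.A_nonneg hh hα.le ht.le i
    have hq : logisticWeight (M t i) ≥ 1 / 2 := by
      refine half_le_logisticWeight ?_
      have := (abs_le.1 (F.approx t ht i)).2
      have : 0 ≤ 4 * K / α := by positivity
      linarith
    have h1 : -(2 * h * K * Real.exp (-(4 * K / α))) ≤
        lab (s i) * (P (t + 1) (cls i) - P t (cls i)) := by
      refine F.lab_mul_step hh hK ht (Real.exp_pos _).le
        (neg_le_lab_mul_drift (Real.exp_pos _).le fun k hk hs => ?_)
      refine (logisticWeight_le_exp_neg _).trans (Real.exp_le_exp.2 ?_)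
      have h3 := (abs_le.1 (F.approx t ht k)).1
      have h4 := F.A_nonneg hh hα.le ht.le k
      rw [hk, hs, lab_neg] at h3
      linarith
    have h2 := F.A_lower t ht i
    have h3 : α * h * (1 / 2) ≤ α * h * logisticWeight (M t i) := by gcongr
    -- The barrier level `4K/α` is chosen so that `x ≤ e^x` at `x = 4K/α` yields exactly this.
    have h4 : 2 * K * Real.exp (-(4 * K / α)) ≤ α * (1 / 2) := by
      rw [Real.exp_neg, ← div_eq_mul_inv, div_le_iff₀ (Real.exp_pos _)]
      have h5 : 4 * K / α ≤ Real.exp (4 * K / α) := by linarith [Real.add_one_le_exp (4 * K / α)]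
      have h6 : α * (4 * K / α) = 4 * K := by field_simp
      nlinarith
    nlinarith

/-- Negative feedback: a margin that exceeds another one by `feedbackGap` has a smaller weight. -/
lemma weight_le_of_gap (F : MarginFlow cls s h α β K T A P M) (hh : 0 ≤ h) (hα : 0 < α)
    (hK : 0 ≤ K) (hsmall : h * (β + 4 * K) ≤ 1 / 4) (hβ : 0 < β) (hp : 0 < p) {t : ℕ}
    (ht : t < T) {i k : ι}
    (hgap : feedbackGap α β K p ≤ proxy cls s A P t i - proxy cls s A P t k) :
    logisticWeight (M t i) ≤ min p (α / β) * logisticWeight (M t k) := by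
  have h1 := F.proxy_lower hh hα hK hsmall hβ.le ht.le k
  have h2 := abs_le.1 (F.approx t ht i)
  have h3 := abs_le.1 (F.approx t ht k)
  have hq : 0 < min p (α / β) := lt_min hp (by positivity)
  -- Passing from proxies to margins costs `1/2` each: this raises the lower bound from `3/2 + 4K/α`
  -- to `2 + 4K/α` and takes `1` off the gap.
  have h4 := logisticWeight_le_of_gap (z := M t i) (w := M t k) (b := 2 + 4 * K / α)
    (D := feedbackGap α β K p - 1) (by simp only [proxy] at h1; linarith)
    (by simp only [proxy] at hgap; linarith)
  have h5 : Real.exp (-(feedbackGap α β K p - 1)) * (1 + Real.exp (2 + 4 * K / α)) =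
      min p (α / β) := by
    unfold feedbackGap
    rw [add_sub_cancel_right, Real.exp_neg, Real.exp_log (by positivity)]
    field_simp
  rwa [h5] at h4

lemma feedbackGap_nonneg (hp : 0 < p) (hα : 0 < α) (hβ : 0 < β) (hp1 : p ≤ 1) :
    0 ≤ feedbackGap α β K p := by
  unfold feedbackGap
  have hq : 0 < min p (α / β) := lt_min hp (by positivity)
  have : 0 ≤ Real.log ((1 + Real.exp (2 + 4 * K / α)) / min p (α / β)) := by
    refine Real.log_nonneg ?_
    rw [le_div_iff₀ hq]
    have := Real.exp_pos (2 + 4 * K / α)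
    have := min_le_left p (α / β)
    linarith
  linarith

/-- The factor `α / β` inside `feedbackGap` absorbs the mismatch between the upper and the lower
growth rate. -/
lemma A_step_le_of_gap (F : MarginFlow cls s h α β K T A P M) (hh : 0 ≤ h) (hα : 0 < α)
    (hK : 0 ≤ K) (hsmall : h * (β + 4 * K) ≤ 1 / 4) (hβ : 0 < β) (hp : 0 < p) {t : ℕ}
    (ht : t < T) {i k : ι}
    (hgap : feedbackGap α β K p ≤ proxy cls s A P t i - proxy cls s A P t k) :
    A (t + 1) i - A t i ≤ A (t + 1) k - A t k := by
  have h1 := F.weight_le_of_gap hh hα hK hsmall hβ hp ht hgap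
  have h2 := F.A_upper t ht i
  have h3 := F.A_lower t ht k
  have h4 : β * h * logisticWeight (M t i) ≤ β * h * (α / β * logisticWeight (M t k)) := by
    gcongr
    refine h1.trans ?_
    gcongr
    · exact (logisticWeight_pos _).le
    · exact min_le_right _ _
  have h5 : β * h * (α / β * logisticWeight (M t k)) = α * h * logisticWeight (M t k) := by
    field_simp
  linarith

/-- The two samples share their signal part, so only the noise parts compete and the barrier applies
directly. -/
lemma same_kind (F : MarginFlow cls s h α β K T A P M) (hh : 0 ≤ h) (hα : 0 < α)
    (hK : 0 ≤ K) (hsmall : h * (β + 4 * K) ≤ 1 / 4) (hβ : 0 < β) (hp : 0 < p) (hp1 : p ≤ 1)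
    {t : ℕ} (ht : t ≤ T) {i k : ι} (hc : cls i = cls k) (hs : s i = s k) :
    proxy cls s A P t i - proxy cls s A P t k ≤ feedbackGap α β K p + 1 := by
  have key : ∀ t, proxy cls s A P t i - proxy cls s A P t k = A t i - A t k := by
    intro t; simp [proxy, hc, hs]
  refine le_add_one_of_barrier (X := fun t => proxy cls s A P t i - proxy cls s A P t k)
    (T := T) ?_ ?_ ?_ t ht
  · simp only [key, F.A_zero, sub_self]
    exact feedbackGap_nonneg hp hα hβ hp1
  · intro t ht
    simp only [key]
    have h1 := F.A_step_le hh hβ.le ht i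
    have h2 := F.A_mono hh hα.le ht k
    nlinarith
  · intro t ht hb
    have := F.A_step_le_of_gap hh hα hK hsmall hβ hp ht hb
    simp only [key]
    linarith

/-- Beyond the barrier both mechanisms shrink the gap: the noise part of the smaller margin grows
faster, and the drift of the class favours its kind. -/
lemma opposite_kind (F : MarginFlow cls s h α β K T A P M) (hh : 0 ≤ h) (hα : 0 < α)
    (hK : 0 ≤ K) (hsmall : h * (β + 4 * K) ≤ 1 / 4) (hβ : 0 < β) (hp : 0 < p) (hp1 : p ≤ 1)
    (hpop : Populated cls s p) {t : ℕ} (ht : t ≤ T) {i k : ι} (hc : cls i = cls k)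
    (hs : s k = -s i) :
    proxy cls s A P t i - proxy cls s A P t k ≤ 3 * feedbackGap α β K p + 3 := by
  have hG := feedbackGap_nonneg (K := K) hp hα hβ hp1
  have hh4 : 4 * (h * K) ≤ 1 / 4 := by nlinarith [mul_nonneg hh hβ.le]
  have hhβ : β * h ≤ 1 / 4 := by nlinarith [mul_nonneg hh hK]
  have key : ∀ t, proxy cls s A P t i - proxy cls s A P t k =
      A t i - A t k + 2 * (lab (s i) * P t (cls i)) := by
    intro t; simp only [proxy, ← hc, hs, lab_neg]; ring
  have := le_add_one_of_barrier (X := fun t => proxy cls s A P t i - proxy cls s A P t k)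
    (T := T) (b := 3 * feedbackGap α β K p + 2) ?_ ?_ ?_ t ht
  · linarith
  · simp only [key, F.A_zero, F.P_zero]
    linarith
  · intro t ht
    simp only [key]
    have h1 := F.A_step_le hh hβ.le ht i
    have h2 := F.A_mono hh hα.le ht k
    have h3 := (abs_le.1 (F.abs_step_le hh hK ht (cls i) (s i))).2
    linarith
  · intro t ht hb
    have hA := F.A_step_le_of_gap hh hα hK hsmall hβ hp ht (i := i) (k := k) (by linarith)
    -- The drift involves all samples of the class. Replacing `i` and `k` by others of their kinds
    -- costs `G + 1` twice, with `G` the feedback gap, so a gap of `3G + 2` still leaves `G` for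
    -- every pair.
    have hd : 0 ≤ lab (-s i) * drift cls s (M t) (cls i) := by
      refine lab_mul_drift_nonneg hp hpop fun k' i' hk' hsk' hi' hsi' => ?_
      rw [neg_neg] at hsi'
      have h1 := F.same_kind hh hα hK hsmall hβ hp hp1 ht.le (i := i) (k := i') hi'.symm hsi'.symm
      have h2 := F.same_kind hh hα hK hsmall hβ hp hp1 ht.le (i := k') (k := k)
        (hk'.trans hc) (hsk'.trans hs.symm)
      refine (F.weight_le_of_gap hh hα hK hsmall hβ hp ht (i := i') (k := k') (by linarith)).trans ?_
      exact mul_le_mul_of_nonneg_right (min_le_left _ _) (logisticWeight_pos _).le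
    have hP := F.lab_mul_step hh hK ht (q := 0) le_rfl (c := cls i) (σ := -s i) (by linarith)
    rw [lab_neg] at hP
    simp only [key]
    linarith

lemma same_class (F : MarginFlow cls s h α β K T A P M) (hh : 0 ≤ h) (hα : 0 < α)
    (hK : 0 ≤ K) (hsmall : h * (β + 4 * K) ≤ 1 / 4) (hβ : 0 < β) (hp : 0 < p) (hp1 : p ≤ 1)
    (hpop : Populated cls s p) {t : ℕ} (ht : t ≤ T) {i k : ι} (hc : cls i = cls k) :
    proxy cls s A P t i - proxy cls s A P t k ≤ 3 * feedbackGap α β K p + 3 := by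
  have hG := feedbackGap_nonneg (K := K) hp hα hβ hp1
  rcases eq_or_ne (s i) (s k) with hs | hs
  · linarith [F.same_kind hh hα hK hsmall hβ hp hp1 ht hc hs]
  · refine F.opposite_kind hh hα hK hsmall hβ hp hp1 hpop ht hc ?_
    exact Int.units_ne_iff_eq_neg.1 hs.symm

/-- All margins agree up to a constant. -/
theorem proxy_sub_le (F : MarginFlow cls s h α β K T A P M) (hh : 0 ≤ h) (hα : 0 < α)
    (hK : 0 ≤ K) (hsmall : h * (β + 4 * K) ≤ 1 / 4) (hβ : 0 < β) (hp : 0 < p) (hp1 : p ≤ 1)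
    (hpop : Populated cls s p) {t : ℕ} (ht : t ≤ T) (i k : ι) :
    proxy cls s A P t i - proxy cls s A P t k ≤ marginGap α β K p := by
  have hG := feedbackGap_nonneg (K := K) hp hα hβ hp1
  unfold marginGap
  have hhβ : β * h ≤ 1 / 4 := by nlinarith [mul_nonneg hh hK]
  -- With one clean and one noisy representative per class, the signal part cancels in the sum of
  -- the two proxies, so classes can be compared through noise parts alone.
  obtain ⟨i₁, hi₁, hsi₁⟩ := hpop.exists hp (cls i) (s i)
  obtain ⟨i₂, hi₂, hsi₂⟩ := hpop.exists hp (cls i) (-s i)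
  obtain ⟨k₁, hk₁, hsk₁⟩ := hpop.exists hp (cls k) (s k)
  obtain ⟨k₂, hk₂, hsk₂⟩ := hpop.exists hp (cls k) (-s k)
  have keyi : ∀ t, A t i₁ + A t i₂ = proxy cls s A P t i₁ + proxy cls s A P t i₂ := by
    intro t; simp only [proxy, hi₁, hi₂, hsi₁, hsi₂, lab_neg]; ring
  have keyk : ∀ t, A t k₁ + A t k₂ = proxy cls s A P t k₁ + proxy cls s A P t k₂ := by
    intro t; simp only [proxy, hk₁, hk₂, hsk₁, hsk₂, lab_neg]; ring
  have sc := fun (t : ℕ) (ht : t ≤ T) (i k : ι) (hc : cls i = cls k) =>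
    F.same_class hh hα hK hsmall hβ hp hp1 hpop ht hc
  -- Half of this level minus the two spreads within classes, `(7G + 6) - (3G + 3)`, still exceeds
  -- the feedback gap `G` for each pair of representatives. Returning to `i` and `k` gives at most
  -- `(14G + 13)/2 + 2(3G + 3) ≤ 13G + 13`.
  have := le_add_one_of_barrier (X := fun t => (A t i₁ + A t i₂) - (A t k₁ + A t k₂))
    (T := T) (b := 14 * feedbackGap α β K p + 12) ?_ ?_ ?_ t ht
  · rw [keyi, keyk] at this
    linarith [sc t ht i i₁ hi₁.symm, sc t ht i i₂ hi₂.symm, sc t ht k₁ k hk₁, sc t ht k₂ k hk₂]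
  · simp only [F.A_zero]
    linarith
  · intro t ht
    linarith [F.A_step_le hh hβ.le ht i₁, F.A_step_le hh hβ.le ht i₂, F.A_mono hh hα.le ht k₁,
      F.A_mono hh hα.le ht k₂]
  · intro t ht hb
    rw [keyi, keyk] at hb
    have i12 := sc t ht.le i₁ i₂ (hi₁.trans hi₂.symm)
    have i21 := sc t ht.le i₂ i₁ (hi₂.trans hi₁.symm)
    have k12 := sc t ht.le k₁ k₂ (hk₁.trans hk₂.symm)
    have k21 := sc t ht.le k₂ k₁ (hk₂.trans hk₁.symm)
    linarith [F.A_step_le_of_gap hh hα hK hsmall hβ hp ht (i := i₁) (k := k₁) (by linarith),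
      F.A_step_le_of_gap hh hα hK hsmall hβ hp ht (i := i₂) (k := k₂) (by linarith)]

lemma marginGap_nonneg (hp : 0 < p) (hα : 0 < α) (hβ : 0 < β) (hp1 : p ≤ 1) :
    0 ≤ marginGap α β K p := by
  unfold marginGap
  linarith [feedbackGap_nonneg (K := K) hp hα hβ hp1]

/-- All logistic weights are comparable. -/
theorem weight_le (F : MarginFlow cls s h α β K T A P M) (hh : 0 ≤ h) (hα : 0 < α)
    (hK : 0 ≤ K) (hsmall : h * (β + 4 * K) ≤ 1 / 4) (hβ : 0 < β) (hp : 0 < p) (hp1 : p ≤ 1)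
    (hpop : Populated cls s p) {t : ℕ} (ht : t < T) (i k : ι) :
    logisticWeight (M t i) ≤ Real.exp (marginGap α β K p + 1) * logisticWeight (M t k) := by
  have h1 := F.proxy_sub_le hh hα hK hsmall hβ hp hp1 hpop ht.le k i
  have h2 := abs_le.1 (F.approx t ht i)
  have h3 := abs_le.1 (F.approx t ht k)
  have h4 := marginGap_nonneg (K := K) hp hα hβ hp1
  unfold proxy at h1
  exact logisticWeight_le_exp_mul (by linarith) (by linarith)

/-- The level `Q` is the mean noise part of a clean and a noisy sample of one class, which is free
of the signal part and nondecreasing. All margins are within a constant of `Q`, so its steps are of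
order `h e^{-Q}` and `e^Q` grows linearly in `ht`. -/
lemma exists_level (F : MarginFlow cls s h α β K T A P M) (hh : 0 ≤ h) (hα : 0 < α)
    (hK : 0 ≤ K) (hsmall : h * (β + 4 * K) ≤ 1 / 4) (hβ : 0 < β) (hp : 0 < p) (hp1 : p ≤ 1)
    (hpop : Populated cls s p) {t : ℕ} (ht : t ≤ T) :
    ∃ Q : ℝ, (∀ i, |proxy cls s A P t i - Q| ≤ marginGap α β K p) ∧
      1 + α / (2 * Real.exp (marginGap α β K p + 1 / 2)) * (h * t) ≤ Real.exp Q ∧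
      Real.exp Q ≤ 1 + 2 * β * Real.exp (marginGap α β K p + 1 / 2) * (h * t) := by
  set B := marginGap α β K p with hB
  have hB0 : 0 ≤ B := marginGap_nonneg (K := K) hp hα hβ hp1
  have hhβ : β * h ≤ 1 / 4 := by nlinarith [mul_nonneg hh hK]
  obtain ⟨i₁, hi₁, hsi₁⟩ := hpop.exists hp 1 1
  obtain ⟨i₂, hi₂, hsi₂⟩ := hpop.exists hp 1 (-1)
  have key : ∀ t, A t i₁ + A t i₂ = proxy cls s A P t i₁ + proxy cls s A P t i₂ := by
    intro t; simp only [proxy, hi₁, hi₂, hsi₁, hsi₂, lab_neg]; ring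
  set Q : ℕ → ℝ := fun t => (A t i₁ + A t i₂) / 2 with hQ
  have hdist : ∀ t ≤ T, ∀ i, |proxy cls s A P t i - Q t| ≤ B := by
    intro t ht i
    have h1 := F.proxy_sub_le hh hα hK hsmall hβ hp hp1 hpop ht i i₁
    have h2 := F.proxy_sub_le hh hα hK hsmall hβ hp hp1 hpop ht i i₂
    have h3 := F.proxy_sub_le hh hα hK hsmall hβ hp hp1 hpop ht i₁ i
    have h4 := F.proxy_sub_le hh hα hK hsmall hβ hp hp1 hpop ht i₂ i
    simp only [hQ, key]
    rw [abs_le]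
    constructor <;> linarith
  have hM : ∀ t < T, ∀ i, |M t i - Q t| ≤ B + 1 / 2 := by
    intro t ht i
    have h1 := abs_le.1 (hdist t ht.le i)
    have h2 := abs_le.1 (F.approx t ht i)
    unfold proxy at h1
    rw [abs_le]
    constructor <;> linarith
  refine ⟨Q t, hdist t ht, ?_, ?_⟩
  · induction t with
    | zero => simp [hQ, F.A_zero]
    | succ t ih =>
      have ih := ih (by omega)
      have hQ0 : 0 ≤ Q t := by
        have h1 := F.A_nonneg hh hα.le (t := t) (by omega) i₁
        have h2 := F.A_nonneg hh hα.le (t := t) (by omega) i₂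
        simp only [hQ]; linarith
      set w := logisticWeight (Q t + (B + 1 / 2)) with hw
      have hstep : α * h * w ≤ Q (t + 1) - Q t := by
        have h1 := F.A_lower t ht i₁
        have h2 := F.A_lower t ht i₂
        have h3 : ∀ i, α * h * w ≤ α * h * logisticWeight (M t i) := fun i => by
          gcongr
          exact logisticWeight_anti (by linarith [(abs_le.1 (hM t ht i)).2])
        simp only [hQ]
        linarith [h3 i₁, h3 i₂]
      -- As `Q ≥ 0`, the `1` in the denominator of the weight is at most `e^{Q + B + 1/2}`.
      have hw2 : 1 / (2 * Real.exp (B + 1 / 2)) ≤ Real.exp (Q t) * w := by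
        rw [hw, logisticWeight, mul_one_div, div_le_div_iff₀ (by positivity) (by positivity),
          Real.exp_add (Q t)]
        have h1 := Real.one_le_exp hQ0
        have h2 : 1 ≤ Real.exp (B + 1 / 2) := Real.one_le_exp (by linarith)
        nlinarith
      have h1 : Real.exp (Q t) * (1 + (Q (t + 1) - Q t)) ≤ Real.exp (Q (t + 1)) := by
        have : Real.exp (Q (t + 1)) = Real.exp (Q t) * Real.exp (Q (t + 1) - Q t) := by
          rw [← Real.exp_add]; ring_nf
        rw [this]
        gcongr
        linarith [Real.add_one_le_exp (Q (t + 1) - Q t)]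
      have h2 : α / (2 * Real.exp (B + 1 / 2)) * h ≤ Real.exp (Q t) * (Q (t + 1) - Q t) := by
        calc _ = α * h * (1 / (2 * Real.exp (B + 1 / 2))) := by ring
          _ ≤ α * h * (Real.exp (Q t) * w) := by gcongr
          _ = Real.exp (Q t) * (α * h * w) := by ring
          _ ≤ _ := by gcongr
      push_cast
      linarith
  · induction t with
    | zero => simp [hQ, F.A_zero]
    | succ t ih =>
      have ih := ih (by omega)
      have hstep : Q (t + 1) - Q t ≤ β * h * Real.exp (-(Q t) + (B + 1 / 2)) := by
        have h1 := F.A_upper t ht i₁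
        have h2 := F.A_upper t ht i₂
        have h3 : ∀ i, β * h * logisticWeight (M t i) ≤
            β * h * Real.exp (-(Q t) + (B + 1 / 2)) := fun i => by
          gcongr
          refine (logisticWeight_le_exp_neg _).trans (Real.exp_le_exp.2 ?_)
          linarith [(abs_le.1 (hM t ht i)).1]
        simp only [hQ] at h3 ⊢
        linarith [h3 i₁, h3 i₂]
      have hstep0 : 0 ≤ Q (t + 1) - Q t := by
        have h1 := F.A_mono hh hα.le ht i₁
        have h2 := F.A_mono hh hα.le ht i₂
        simp only [hQ]; linarith
      have hstep1 : Q (t + 1) - Q t ≤ 1 := by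
        have h1 := F.A_step_le hh hβ.le ht i₁
        have h2 := F.A_step_le hh hβ.le ht i₂
        simp only [hQ]; linarith
      -- Steps of `Q` are at most `1`, so the exponential is linear up to the factor `2`.
      have h1 : Real.exp (Q (t + 1) - Q t) ≤ 1 + 2 * (Q (t + 1) - Q t) := by
        have := Real.abs_exp_sub_one_le (x := Q (t + 1) - Q t) (by rwa [abs_of_nonneg hstep0])
        rw [abs_of_nonneg hstep0] at this
        linarith [le_abs_self (Real.exp (Q (t + 1) - Q t) - 1)]
      have h2 : Real.exp (Q t) * Real.exp (-(Q t) + (B + 1 / 2)) = Real.exp (B + 1 / 2) := by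
        rw [← Real.exp_add]; ring_nf
      have h3 : Real.exp (Q (t + 1)) ≤ Real.exp (Q t) + 2 * β * Real.exp (B + 1 / 2) * h := by
        calc Real.exp (Q (t + 1)) = Real.exp (Q t) * Real.exp (Q (t + 1) - Q t) := by
              rw [← Real.exp_add]; ring_nf
          _ ≤ Real.exp (Q t) * (1 + 2 * (β * h * Real.exp (-(Q t) + (B + 1 / 2)))) := by
              gcongr; linarith
          _ = Real.exp (Q t) + 2 * β * h *
              (Real.exp (Q t) * Real.exp (-(Q t) + (B + 1 / 2))) := by ring
          _ = _ := by rw [h2]; ring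
      push_cast
      linarith

/-- The margins grow logarithmically in time. -/
theorem le_exp_proxy (F : MarginFlow cls s h α β K T A P M) (hh : 0 ≤ h) (hα : 0 < α)
    (hK : 0 ≤ K) (hsmall : h * (β + 4 * K) ≤ 1 / 4) (hβ : 0 < β) (hp : 0 < p) (hp1 : p ≤ 1)
    (hpop : Populated cls s p) {t : ℕ} (ht : t ≤ T) (i : ι) :
    α / (2 * Real.exp (marginGap α β K p + 1 / 2)) * (h * t) ≤
      Real.exp (marginGap α β K p) * Real.exp (proxy cls s A P t i) := by
  obtain ⟨Q, h1, h2, -⟩ := F.exists_level hh hα hK hsmall hβ hp hp1 hpop ht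
  have h3 : Real.exp Q ≤ Real.exp (marginGap α β K p) * Real.exp (proxy cls s A P t i) := by
    rw [← Real.exp_add]
    exact Real.exp_le_exp.2 (by linarith [(abs_le.1 (h1 i)).1])
  linarith

/-- The noise parts grow at most logarithmically in time. -/
theorem A_le (F : MarginFlow cls s h α β K T A P M) (hh : 0 ≤ h) (hα : 0 < α)
    (hK : 0 ≤ K) (hsmall : h * (β + 4 * K) ≤ 1 / 4) (hβ : 0 < β) (hp : 0 < p) (hp1 : p ≤ 1)
    (hpop : Populated cls s p) {t : ℕ} (ht : t ≤ T) (i : ι) :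
    A t i ≤ 2 * Real.log (1 + 2 * β * Real.exp (marginGap α β K p + 1 / 2) * (h * t)) +
      2 * marginGap α β K p := by
  obtain ⟨Q, h1, -, h2⟩ := F.exists_level hh hα hK hsmall hβ hp hp1 hpop ht
  -- Adding the proxy of an opposite sample of the same class removes `P`. As `A_k ≥ 0`, this leaves
  -- `A_i ≤ 2Q + 2B` with `B` the margin gap.
  obtain ⟨k, hk, hsk⟩ := hpop.exists hp (cls i) (-s i)
  have h3 : Q ≤ Real.log (1 + 2 * β * Real.exp (marginGap α β K p + 1 / 2) * (h * t)) := by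
    rw [Real.le_log_iff_exp_le (lt_of_lt_of_le (Real.exp_pos _) h2)]
    exact h2
  have h4 := (abs_le.1 (h1 i)).2
  have h5 := (abs_le.1 (h1 k)).2
  have h6 := F.A_nonneg hh hα.le ht k
  simp only [proxy, hk, hsk, lab_neg] at h4 h5
  linarith

end MarginFlow

/-! ### A training run -/

lemma abs_relu_sub_relu_le (z w : ℝ) : |relu z - relu w| ≤ |z - w| := by
  simpa [relu, max_comm] using abs_max_sub_max_le_abs z w 0

lemma relu_of_nonneg {z : ℝ} (h : 0 ≤ z) : relu z = z := max_eq_right h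

lemma relu_of_nonpos {z : ℝ} (h : z ≤ 0) : relu z = 0 := max_eq_left h

lemma reluDeriv_nonneg (z : ℝ) : 0 ≤ reluDeriv z := by unfold reluDeriv; split_ifs <;> norm_num

lemma reluDeriv_le_one (z : ℝ) : reluDeriv z ≤ 1 := by unfold reluDeriv; split_ifs <;> norm_num

/-- The data that determine a run of gradient descent. -/
structure Run (n m d : ℕ) where
  μ : Patch d
  y : Fin n → ℤˣ
  yt : Fin n → ℤˣ
  pos : Fin n → Bool
  ξ : Fin n → Patch d
  η : ℝ
  W₀ : Weights m d

namespace Run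

variable {n m d : ℕ}

/-- The training inputs. -/
def x (R : Run n m d) : Fin n → Input d := trainInput R.μ R.y R.pos R.ξ

/-- The iterates. -/
def W (R : Run n m d) (t : ℕ) : Weights m d := gd R.η R.x R.yt R.W₀ t

/-- The margin with respect to the observed label. -/
def margin (R : Run n m d) (t : ℕ) (i : Fin n) : ℝ := lab (R.yt i) * net (R.W t) (R.x i)

/-- The sign that tells clean from noisy samples. -/
def clean (R : Run n m d) (i : Fin n) : ℤˣ := R.yt i * R.y i

/-- The signal coefficients. -/
def γ (R : Run n m d) (t : ℕ) (j : ℤˣ) (r : Fin m) : ℝ :=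
  ∑ s ∈ Finset.range t, R.η * ‖R.μ‖ ^ 2 / (n * m) * ∑ i, lab (R.clean i) *
    logisticWeight (R.margin s i) * reluDeriv (inner ℝ (R.W s j r) (lab (R.y i) • R.μ))

/-- The noise coefficients. -/
def ρ (R : Run n m d) (t : ℕ) (j : ℤˣ) (r : Fin m) (i : Fin n) : ℝ :=
  ∑ s ∈ Finset.range t, R.η * ‖R.ξ i‖ ^ 2 / (n * m) * (lab j * lab (R.yt i) *
    logisticWeight (R.margin s i) * reluDeriv (inner ℝ (R.W s j r) (R.ξ i)))

lemma W_zero (R : Run n m d) : R.W 0 = R.W₀ := rfl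

lemma γ_zero (R : Run n m d) (j : ℤˣ) (r : Fin m) : R.γ 0 j r = 0 := by simp [γ]

lemma ρ_zero (R : Run n m d) (j : ℤˣ) (r : Fin m) (i : Fin n) : R.ρ 0 j r i = 0 := by simp [ρ]

lemma γ_succ (R : Run n m d) (t : ℕ) (j : ℤˣ) (r : Fin m) : R.γ (t + 1) j r = R.γ t j r +
    R.η * ‖R.μ‖ ^ 2 / (n * m) * ∑ i, lab (R.clean i) *
    logisticWeight (R.margin t i) * reluDeriv (inner ℝ (R.W t j r) (lab (R.y i) • R.μ)) := by
  simp [γ, Finset.sum_range_succ]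

lemma ρ_succ (R : Run n m d) (t : ℕ) (j : ℤˣ) (r : Fin m) (i : Fin n) :
    R.ρ (t + 1) j r i = R.ρ t j r i + R.η * ‖R.ξ i‖ ^ 2 / (n * m) * (lab j * lab (R.yt i) *
    logisticWeight (R.margin t i) * reluDeriv (inner ℝ (R.W t j r) (R.ξ i))) := by
  simp [ρ, Finset.sum_range_succ]

/-- The gradient is symmetric in the two patches, so their order drops out here. -/
lemma W_succ (R : Run n m d) (t : ℕ) (j : ℤˣ) (r : Fin m) : R.W (t + 1) j r = R.W t j r +
    (R.η / (n * m)) • ∑ i, (lab j * lab (R.yt i) * logisticWeight (R.margin t i)) •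
      (reluDeriv (inner ℝ (R.W t j r) (lab (R.y i) • R.μ)) • lab (R.y i) • R.μ +
        reluDeriv (inner ℝ (R.W t j r) (R.ξ i)) • R.ξ i) := by
  have h1 : R.W (t + 1) = gdStep R.η R.x R.yt (R.W t) := by
    simp only [W, gd, Function.iterate_succ_apply']
  rw [h1]
  unfold gdStep gradLoss
  rw [sub_eq_add_neg, ← smul_neg, ← smul_neg, ← Finset.sum_neg_distrib, smul_smul]
  congr 1
  rw [mul_one_div]
  congr 1
  refine Finset.sum_congr rfl fun i _ => ?_
  have h2 : -(lossDeriv (net (R.W t) (R.x i)) (lab (R.yt i)) * lab j * lab (R.yt i)) =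
      lab j * lab (R.yt i) * logisticWeight (R.margin t i) := by
    unfold lossDeriv logisticWeight margin; ring
  rw [← neg_smul, h2]
  congr 1
  unfold x trainInput
  split_ifs
  · rfl
  · rw [add_comm]

/-- The weights in terms of the signal and noise coefficients. -/
theorem isDecomposition (R : Run n m d) (hμ : R.μ ≠ 0) (hξ : ∀ i, R.ξ i ≠ 0) (t : ℕ) :
    IsDecomposition R.μ R.ξ R.W₀ (R.W t) (R.γ t) (R.ρ t) := by
  intro j r
  induction t with
  | zero => simp [W_zero, γ_zero, ρ_zero]
  | succ t ih =>
    have hμ' : ‖R.μ‖ ^ 2 ≠ 0 := by simpa using hμ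
    have hξ : ∀ i, ‖R.ξ i‖ ≠ 0 := fun i => by simpa using hξ i
    rw [W_succ, γ_succ]
    simp only [ρ_succ, add_mul, mul_add, add_smul, smul_add, Finset.sum_add_distrib,
      Finset.smul_sum]
    have e1 : ∑ i, (R.η / (n * m)) • (lab j * lab (R.yt i) * logisticWeight (R.margin t i)) •
        reluDeriv (inner ℝ (R.W t j r) (lab (R.y i) • R.μ)) • lab (R.y i) • R.μ =
        (lab j * (R.η * ‖R.μ‖ ^ 2 / (n * m) * ∑ i, lab (R.clean i) *
          logisticWeight (R.margin t i) * reluDeriv (inner ℝ (R.W t j r) (lab (R.y i) • R.μ))) *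
          (‖R.μ‖ ^ 2)⁻¹) • R.μ := by
      simp only [smul_smul, ← Finset.sum_smul]
      congr 1
      rw [Finset.mul_sum, Finset.mul_sum, Finset.sum_mul]
      refine Finset.sum_congr rfl fun i _ => ?_
      rw [clean, lab_mul]
      field_simp
    have e2 : ∑ i, (R.η / (n * m)) • (lab j * lab (R.yt i) * logisticWeight (R.margin t i)) •
        reluDeriv (inner ℝ (R.W t j r) (R.ξ i)) • R.ξ i =
        ∑ i, (R.η * ‖R.ξ i‖ ^ 2 / (n * m) * (lab j * lab (R.yt i) *
          logisticWeight (R.margin t i) * reluDeriv (inner ℝ (R.W t j r) (R.ξ i))) *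
          (‖R.ξ i‖ ^ 2)⁻¹) • R.ξ i := by
      refine Finset.sum_congr rfl fun i _ => ?_
      rw [smul_smul, smul_smul]
      congr 1
      have := hξ i
      field_simp
    rw [e1, e2]
    nth_rewrite 1 [ih]
    abel

/-- Every increment carries the sign `lab j * lab (yt i)`, which does not depend on time. -/
lemma ρ_label_nonneg (R : Run n m d) (hη : 0 ≤ R.η) (t : ℕ) (r : Fin m) (i : Fin n) :
    0 ≤ R.ρ t (R.yt i) r i := by
  unfold ρ
  refine Finset.sum_nonneg fun s _ => ?_
  rw [lab_mul_self, one_mul]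
  have := logisticWeight_pos (R.margin s i)
  have := reluDeriv_nonneg (inner ℝ (R.W s (R.yt i) r) (R.ξ i))
  positivity

lemma ρ_neg_label_nonpos (R : Run n m d) (hη : 0 ≤ R.η) (t : ℕ) (r : Fin m) (i : Fin n) :
    R.ρ t (-R.yt i) r i ≤ 0 := by
  unfold ρ
  refine Finset.sum_nonpos fun s _ => ?_
  rw [lab_neg, neg_mul, lab_mul_self, neg_mul, neg_mul, one_mul, mul_neg, neg_nonpos]
  have := logisticWeight_pos (R.margin s i)
  have := reluDeriv_nonneg (inner ℝ (R.W s (-R.yt i) r) (R.ξ i))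
  positivity

/-- The averaged noise coefficient of a sample for its observed label. -/
def noisePart (R : Run n m d) (t : ℕ) (i : Fin n) : ℝ := 1 / m * ∑ r, R.ρ t (R.yt i) r i

end Run

/-- The positive part, cut off at `2 * ε`. -/
def cutoff (ε z : ℝ) : ℝ := max 0 (z - 2 * ε)

/-- The activation of a neuron is known only when its coefficient exceeds the approximation error
`ε`. Below `ε`, one step stays below `2ε`, where the cutoff vanishes; above it the step is `Δ`. So
the cutoff always moves in the direction of `Δ`. -/
lemma cutoff_step {ε z z' Δ : ℝ} (hz : ε < z → z' = z + Δ) (hstep : |z' - z| ≤ ε) :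
    (0 ≤ Δ → 0 ≤ cutoff ε z' - cutoff ε z ∧ cutoff ε z' - cutoff ε z ≤ Δ) ∧
    (Δ ≤ 0 → Δ ≤ cutoff ε z' - cutoff ε z ∧ cutoff ε z' - cutoff ε z ≤ 0) := by
  have h1 := abs_le.1 hstep
  unfold cutoff
  rcases le_or_gt z ε with h | h
  · rw [max_eq_left (by linarith), max_eq_left (by linarith)]
    simp
  · rw [hz h]
    constructor
    · intro hΔ
      rcases max_cases 0 (z + Δ - 2 * ε) with ⟨h3, h4⟩ | ⟨h3, h4⟩ <;>
        rcases max_cases 0 (z - 2 * ε) with ⟨h5, h6⟩ | ⟨h5, h6⟩ <;>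
        rw [h3, h5] <;> constructor <;> linarith
    · intro hΔ
      rcases max_cases 0 (z + Δ - 2 * ε) with ⟨h3, h4⟩ | ⟨h3, h4⟩ <;>
        rcases max_cases 0 (z - 2 * ε) with ⟨h5, h6⟩ | ⟨h5, h6⟩ <;>
        rw [h3, h5] <;> constructor <;> linarith

lemma abs_relu_sub_cutoff_le {ε u z : ℝ} (h : |u - z| ≤ ε) : |relu u - cutoff ε z| ≤ 3 * ε := by
  have hε : 0 ≤ ε := (abs_nonneg _).trans h
  have h1 := abs_relu_sub_relu_le u (z - 2 * ε)
  have h2 : |u - (z - 2 * ε)| ≤ 3 * ε := by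
    rw [abs_le] at h ⊢
    constructor <;> linarith
  exact h1.trans h2

/-! ### Regular runs: inner products and margins in terms of the coefficients. -/

namespace Run

variable {n m d : ℕ}

/-- A proxy for the contribution of the signal patch of class `c` to the margin of clean samples
of this class. -/
def signalPart (R : Run n m d) (ε : ℝ) (t : ℕ) (c : ℤˣ) : ℝ :=
  1 / m * ∑ r, (cutoff ε (R.γ t c r) - cutoff ε (-R.γ t (-c) r))

/-- The properties of the training noise and of the initialization that drive the analysis. -/
structure Regular (R : Run n m d) (D ν Λ c₁ c₂ : ℝ) : Prop where
  n_pos : 0 < n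
  m_pos : 0 < m
  η_pos : 0 < R.η
  D_pos : 0 < D
  ν_nonneg : 0 ≤ ν
  Λ_ge : 1 ≤ Λ
  c₁_pos : 0 < c₁
  signal_lower : c₁ * D ≤ n * ‖R.μ‖ ^ 2
  signal_upper : n * ‖R.μ‖ ^ 2 ≤ c₂ * D
  noise_lower : ∀ i, D / 2 ≤ ‖R.ξ i‖ ^ 2
  noise_upper : ∀ i, ‖R.ξ i‖ ^ 2 ≤ 2 * D
  noise_noise : ∀ i k, i ≠ k → |inner ℝ (R.ξ i) (R.ξ k)| ≤ ν * D / (n * Λ)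
  signal_noise : ∀ i, |inner ℝ R.μ (R.ξ i)| ≤ ν * D / (n * Λ)
  init_noise : ∀ j r i, |inner ℝ (R.W₀ j r) (R.ξ i)| ≤ ν
  init_signal : ∀ j r, |inner ℝ (R.W₀ j r) R.μ| ≤ ν
  active : ∀ i, (m : ℝ) / 4 ≤
    ({r | 0 ≤ inner ℝ (R.W₀ (R.yt i) r) (R.ξ i)} : Finset (Fin m)).card

namespace Regular

variable {R : Run n m d} {D ν Λ c₁ c₂ : ℝ}

lemma μ_sq_pos (H : R.Regular D ν Λ c₁ c₂) : 0 < ‖R.μ‖ ^ 2 := by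
  have h1 := mul_pos H.c₁_pos H.D_pos
  have h2 := H.signal_lower
  have h3 : (0 : ℝ) < n := by exact_mod_cast H.n_pos
  by_contra h
  nlinarith

lemma μ_ne (H : R.Regular D ν Λ c₁ c₂) : R.μ ≠ 0 := by
  have := H.μ_sq_pos
  rintro h
  simp [h] at this

lemma ξ_sq_pos (H : R.Regular D ν Λ c₁ c₂) (i : Fin n) : 0 < ‖R.ξ i‖ ^ 2 := by
  linarith [H.noise_lower i, H.D_pos]

lemma ξ_ne (H : R.Regular D ν Λ c₁ c₂) (i : Fin n) : R.ξ i ≠ 0 := by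
  have := H.ξ_sq_pos i
  rintro h
  simp [h] at this

lemma c₂_pos (H : R.Regular D ν Λ c₁ c₂) : 0 < c₂ := by
  have h1 := mul_pos H.c₁_pos H.D_pos
  have h2 := H.signal_lower
  have h3 := H.signal_upper
  have := H.D_pos
  by_contra h
  nlinarith

lemma isDecomposition (H : R.Regular D ν Λ c₁ c₂) (t : ℕ) :
    IsDecomposition R.μ R.ξ R.W₀ (R.W t) (R.γ t) (R.ρ t) :=
  R.isDecomposition H.μ_ne H.ξ_ne t

lemma inner_W (H : R.Regular D ν Λ c₁ c₂) (t : ℕ) (j : ℤˣ) (r : Fin m) (v : Patch d) :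
    inner ℝ (R.W t j r) v = inner ℝ (R.W₀ j r) v +
      lab j * R.γ t j r * (‖R.μ‖ ^ 2)⁻¹ * inner ℝ R.μ v +
      ∑ k, R.ρ t j r k * (‖R.ξ k‖ ^ 2)⁻¹ * inner ℝ (R.ξ k) v := by
  rw [H.isDecomposition t j r, inner_add_left, inner_add_left, real_inner_smul_left, sum_inner]
  simp only [real_inner_smul_left]

/-- The factor `1 / (nΛ)` in the near-orthogonality bounds is there to absorb the size `Λ` of the
coefficients and the number `n` of cross terms. -/
lemma abs_cross_le (H : R.Regular D ν Λ c₁ c₂) {b a : ℝ} (hb : |b| ≤ Λ) (k : Fin n)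
    (ha : |a| ≤ ν * D / (n * Λ)) : |b * (‖R.ξ k‖ ^ 2)⁻¹ * a| ≤ 2 * ν / n := by
  have hn : (0 : ℝ) < n := by exact_mod_cast H.n_pos
  have hD := H.D_pos
  have hΛ := H.Λ_ge
  have hν := H.ν_nonneg
  have h1 : (‖R.ξ k‖ ^ 2)⁻¹ ≤ 2 / D := by
    rw [inv_le_comm₀ (H.ξ_sq_pos k) (by positivity), inv_div]
    exact H.noise_lower k
  rw [abs_mul, abs_mul, abs_of_nonneg (inv_nonneg.2 (H.ξ_sq_pos k).le)]
  calc _ ≤ Λ * (2 / D) * (ν * D / (n * Λ)) := by gcongr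
    _ = _ := by field_simp

/-- The error consists of `ν` from the initialization, `ν / c₁` from the signal direction and `2ν`
from the other noise patches. -/
lemma abs_inner_noise_sub_le (H : R.Regular D ν Λ c₁ c₂) {t : ℕ} {j : ℤˣ} {r : Fin m}
    (hγ : |R.γ t j r| ≤ Λ) (hρ : ∀ i, |R.ρ t j r i| ≤ Λ) (i : Fin n) :
    |inner ℝ (R.W t j r) (R.ξ i) - R.ρ t j r i| ≤ ν * (3 + 1 / c₁) := by
  have hn : (0 : ℝ) < n := by exact_mod_cast H.n_pos
  have hD := H.D_pos
  have hΛ := H.Λ_ge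
  have hν := H.ν_nonneg
  have hc := H.c₁_pos
  have hμ := H.μ_sq_pos
  rw [H.inner_W, ← Finset.add_sum_erase _ _ (Finset.mem_univ i), real_inner_self_eq_norm_sq,
    mul_assoc (R.ρ t j r i), inv_mul_cancel₀ (H.ξ_sq_pos i).ne', mul_one]
  have h1 := H.init_noise j r i
  have h2 : |lab j * R.γ t j r * (‖R.μ‖ ^ 2)⁻¹ * inner ℝ R.μ (R.ξ i)| ≤ ν * (1 / c₁) := by
    rw [abs_mul, abs_mul, abs_mul, abs_lab, one_mul, abs_of_nonneg (inv_nonneg.2 hμ.le)]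
    calc _ ≤ Λ * (‖R.μ‖ ^ 2)⁻¹ * (ν * D / (n * Λ)) := by
          gcongr
          exact H.signal_noise i
      _ = ν * (D / (n * ‖R.μ‖ ^ 2)) := by field_simp
      _ ≤ _ := by
        refine mul_le_mul_of_nonneg_left ?_ hν
        rw [div_le_div_iff₀ (by positivity) hc]
        linarith [H.signal_lower]
  have h3 : |∑ k ∈ Finset.univ.erase i, R.ρ t j r k * (‖R.ξ k‖ ^ 2)⁻¹ *
      inner ℝ (R.ξ k) (R.ξ i)| ≤ 2 * ν := by
    refine (Finset.abs_sum_le_sum_abs _ _).trans ?_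
    calc _ ≤ ∑ k ∈ Finset.univ.erase i, 2 * ν / n :=
          Finset.sum_le_sum fun k hk => H.abs_cross_le (hρ k) k
            (H.noise_noise k i (Finset.ne_of_mem_erase hk))
      _ ≤ ∑ k : Fin n, 2 * ν / n :=
          Finset.sum_le_sum_of_subset_of_nonneg (Finset.erase_subset _ _)
            fun _ _ _ => by positivity
      _ = _ := by simp; field_simp
  rw [abs_le] at h1 h2 h3 ⊢
  constructor <;> linarith

lemma abs_inner_signal_sub_le (H : R.Regular D ν Λ c₁ c₂) {t : ℕ} {j : ℤˣ} {r : Fin m}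
    (hρ : ∀ i, |R.ρ t j r i| ≤ Λ) :
    |inner ℝ (R.W t j r) (lab j • R.μ) - R.γ t j r| ≤ ν * (3 + 1 / c₁) := by
  have hn : (0 : ℝ) < n := by exact_mod_cast H.n_pos
  have hν := H.ν_nonneg
  have hc := H.c₁_pos
  have hμ := H.μ_sq_pos
  have h0 : inner ℝ (R.W t j r) (lab j • R.μ) - R.γ t j r = lab j * (inner ℝ (R.W₀ j r) R.μ +
      ∑ k, R.ρ t j r k * (‖R.ξ k‖ ^ 2)⁻¹ * inner ℝ (R.ξ k) R.μ) := by
    rw [real_inner_smul_right, H.inner_W, real_inner_self_eq_norm_sq,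
      mul_assoc _ (‖R.μ‖ ^ 2)⁻¹, inv_mul_cancel₀ hμ.ne', mul_one]
    linear_combination (R.γ t j r) * lab_mul_self j
  rw [h0, abs_mul, abs_lab, one_mul]
  have h1 := H.init_signal j r
  have h3 : |∑ k, R.ρ t j r k * (‖R.ξ k‖ ^ 2)⁻¹ * inner ℝ (R.ξ k) R.μ| ≤ 2 * ν := by
    refine (Finset.abs_sum_le_sum_abs _ _).trans ?_
    calc _ ≤ ∑ k : Fin n, 2 * ν / n :=
          Finset.sum_le_sum fun k hk => H.abs_cross_le (hρ k) k
            (by rw [real_inner_comm]; exact H.signal_noise k)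
      _ = _ := by simp; field_simp
  have h4 : 0 ≤ ν * (1 / c₁) := by positivity
  refine (abs_add_le _ _).trans ?_
  linarith

end Regular

lemma branch_x (R : Run n m d) (W : Weights m d) (j : ℤˣ) (i : Fin n) : branch W j (R.x i) =
    1 / m * ∑ r, relu (inner ℝ (W j r) (lab (R.y i) • R.μ)) +
      1 / m * ∑ r, relu (inner ℝ (W j r) (R.ξ i)) := by
  unfold branch x trainInput
  rw [← mul_add, ← Finset.sum_add_distrib]
  split_ifs
  · rfl
  · simp only [add_comm]

lemma lab_mul_net (W : Weights m d) (x : Input d) (j : ℤˣ) :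
    lab j * net W x = branch W j x - branch W (-j) x := by
  unfold net
  rcases Int.units_eq_one_or j with rfl | rfl
  · simp [lab_one]
  · simp [lab_neg, lab_one]

lemma abs_avg_sub_avg_le (hm : 0 < m) {f g : Fin m → ℝ} {ε : ℝ} (h : ∀ r, |f r - g r| ≤ ε) :
    |1 / m * ∑ r, f r - 1 / m * ∑ r, g r| ≤ ε := by
  have hm' : (0 : ℝ) < m := by exact_mod_cast hm
  rw [← mul_sub, ← Finset.sum_sub_distrib, abs_mul, abs_of_nonneg (by positivity)]
  calc _ ≤ 1 / (m : ℝ) * ∑ r : Fin m, ε := by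
        gcongr
        exact (Finset.abs_sum_le_sum_abs _ _).trans (Finset.sum_le_sum fun r _ => h r)
    _ = ε := by simp; field_simp

namespace Regular

variable {R : Run n m d} {D ν Λ c₁ c₂ : ℝ}

/-- On the noise patch the sign of `ρ` decides what the ReLU keeps, with error `ε` per branch. On
the signal patch the cutoff replaces the ReLU, with error `3ε` per branch. -/
lemma abs_margin_sub_le (H : R.Regular D ν Λ c₁ c₂) {t : ℕ} (hγ : ∀ j r, |R.γ t j r| ≤ Λ)
    (hρ : ∀ j r i, |R.ρ t j r i| ≤ Λ) (i : Fin n) :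
    |R.margin t i - (R.noisePart t i +
      lab (R.clean i) * R.signalPart (ν * (3 + 1 / c₁)) t (R.y i))| ≤ 8 * (ν * (3 + 1 / c₁)) := by
  set ε := ν * (3 + 1 / c₁) with hε
  have hN : ∀ j r, |inner ℝ (R.W t j r) (R.ξ i) - R.ρ t j r i| ≤ ε := fun j r =>
    H.abs_inner_noise_sub_le (hγ j r) (hρ j r) i
  have h1 : |1 / m * ∑ r, relu (inner ℝ (R.W t (R.yt i) r) (R.ξ i)) - R.noisePart t i| ≤ ε := by
    refine abs_avg_sub_avg_le H.m_pos fun r => ?_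
    have := abs_relu_sub_relu_le (inner ℝ (R.W t (R.yt i) r) (R.ξ i)) (R.ρ t (R.yt i) r i)
    rw [relu_of_nonneg (R.ρ_label_nonneg H.η_pos.le t r i)] at this
    exact this.trans (hN _ _)
  have h2 : |1 / m * ∑ r, relu (inner ℝ (R.W t (-R.yt i) r) (R.ξ i)) -
      1 / m * ∑ r : Fin m, 0| ≤ ε := by
    refine abs_avg_sub_avg_le H.m_pos fun r => ?_
    have := abs_relu_sub_relu_le (inner ℝ (R.W t (-R.yt i) r) (R.ξ i)) (R.ρ t (-R.yt i) r i)
    rw [relu_of_nonpos (R.ρ_neg_label_nonpos H.η_pos.le t r i)] at this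
    exact this.trans (hN _ _)
  have h3 : |1 / m * ∑ r, relu (inner ℝ (R.W t (R.y i) r) (lab (R.y i) • R.μ)) -
      1 / m * ∑ r, cutoff ε (R.γ t (R.y i) r)| ≤ 3 * ε :=
    abs_avg_sub_avg_le H.m_pos fun r =>
      abs_relu_sub_cutoff_le (H.abs_inner_signal_sub_le (hρ (R.y i) r))
  have h4 : |1 / m * ∑ r, relu (inner ℝ (R.W t (-R.y i) r) (lab (R.y i) • R.μ)) -
      1 / m * ∑ r, cutoff ε (-R.γ t (-R.y i) r)| ≤ 3 * ε := by
    refine abs_avg_sub_avg_le H.m_pos fun r => abs_relu_sub_cutoff_le ?_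
    have := H.abs_inner_signal_sub_le (hρ (-R.y i) r)
    rw [lab_neg, neg_smul, inner_neg_right] at this
    rw [← abs_neg]
    convert this using 2
    ring
  have h5 : R.signalPart ε t (R.y i) = 1 / m * ∑ r, cutoff ε (R.γ t (R.y i) r) -
      1 / m * ∑ r, cutoff ε (-R.γ t (-R.y i) r) := by
    unfold signalPart
    rw [Finset.sum_sub_distrib, mul_sub]
  rw [margin, lab_mul_net, branch_x, branch_x, h5]
  simp only [Finset.sum_const_zero, mul_zero, sub_zero] at h2
  rw [abs_le] at h1 h2 h3 h4 ⊢
  -- For a noisy sample the branch of the observed label is the one opposite to the true class, so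
  -- the signal enters with a minus sign.
  rcases eq_or_ne (R.yt i) (R.y i) with he | he
  · have hc : lab (R.clean i) = 1 := by rw [clean, lab_mul, he, lab_mul_self]
    rw [hc, one_mul]
    rw [he] at h1 h2 ⊢
    constructor <;> linarith
  · have he' := Int.units_ne_iff_eq_neg.1 he
    have hc : lab (R.clean i) = -1 := by
      rw [clean, lab_mul, he', lab_neg, neg_mul, lab_mul_self]
    rw [hc]
    rw [he', neg_neg] at h2 ⊢
    rw [he'] at h1
    constructor <;> linarith

end Regular
end Run

/-! ### One-step estimates and the bootstrap. -/

namespace Run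

variable {n m d : ℕ}

/-- The coefficients are bounded and the initially active neurons of each sample are active. -/
def Controlled (R : Run n m d) (Λ : ℝ) (t : ℕ) : Prop :=
  (∀ j r, |R.γ t j r| ≤ Λ) ∧ (∀ j r i, |R.ρ t j r i| ≤ Λ) ∧
    ∀ i r, 0 ≤ inner ℝ (R.W₀ (R.yt i) r) (R.ξ i) → 0 ≤ inner ℝ (R.W t (R.yt i) r) (R.ξ i)

/-- The effective step size of the noise coefficients. -/
def rate (R : Run n m d) (D : ℝ) : ℝ := R.η * D / (n * m)

lemma noisePart_succ_sub (R : Run n m d) (t : ℕ) (i : Fin n) :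
    R.noisePart (t + 1) i - R.noisePart t i = R.η * ‖R.ξ i‖ ^ 2 / (n * m) *
      logisticWeight (R.margin t i) *
      (1 / m * ∑ r, reluDeriv (inner ℝ (R.W t (R.yt i) r) (R.ξ i))) := by
  unfold noisePart
  simp only [ρ_succ, lab_mul_self, Finset.sum_add_distrib, one_mul, ← Finset.mul_sum]
  ring

/-- A neuron with a definite sign on `μ` is active on the signal patches of exactly one class, so
its `γ` sees the drift of that class alone. -/
lemma γ_succ_sub_of_active (R : Run n m d) (hn : 0 < n) {t : ℕ} {j σ : ℤˣ} {r : Fin m}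
    (h : 0 < lab σ * inner ℝ (R.W t j r) (lab j • R.μ)) :
    R.γ (t + 1) j r - R.γ t j r =
      R.η * ‖R.μ‖ ^ 2 / m * drift R.y R.clean (R.margin t) (σ * j) := by
  have hn' : (0 : ℝ) < n := by exact_mod_cast hn
  rw [γ_succ, add_sub_cancel_left, drift, Finset.sum_filter, Fintype.card_fin]
  have h1 : ∀ i, lab (R.clean i) * logisticWeight (R.margin t i) *
      reluDeriv (inner ℝ (R.W t j r) (lab (R.y i) • R.μ)) =
      if R.y i = σ * j then lab (R.clean i) * logisticWeight (R.margin t i) else 0 := by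
    intro i
    rw [real_inner_smul_right, ← mul_assoc, ← lab_mul] at h
    rw [real_inner_smul_right]
    split_ifs with hi
    · rw [hi, reluDeriv, if_pos h.le, mul_one]
    · rw [Int.units_ne_iff_eq_neg.1 hi, lab_neg, reluDeriv, if_neg (by linarith), mul_zero]
  simp only [h1]
  field_simp

namespace Regular

variable {R : Run n m d} {D ν Λ c₁ c₂ p : ℝ}

lemma rate_pos (H : R.Regular D ν Λ c₁ c₂) : 0 < R.rate D := by
  have hn : (0 : ℝ) < n := by exact_mod_cast H.n_pos
  have hm : (0 : ℝ) < m := by exact_mod_cast H.m_pos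
  have := H.η_pos
  have := H.D_pos
  unfold rate; positivity

lemma signal_rate_le (H : R.Regular D ν Λ c₁ c₂) : R.η * ‖R.μ‖ ^ 2 / m ≤ R.rate D * c₂ := by
  have hn : (0 : ℝ) < n := by exact_mod_cast H.n_pos
  have hm : (0 : ℝ) < m := by exact_mod_cast H.m_pos
  have hη := H.η_pos
  have := H.signal_upper
  unfold rate
  rw [div_mul_eq_mul_div, div_le_div_iff₀ hm (by positivity)]
  have h1 := mul_le_mul_of_nonneg_left this (mul_nonneg hη.le hm.le)
  linarith

lemma abs_γ_step_le (H : R.Regular D ν Λ c₁ c₂) {t : ℕ} {q : ℝ}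
    (hq : ∀ i, logisticWeight (R.margin t i) ≤ q) (j : ℤˣ) (r : Fin m) :
    |R.γ (t + 1) j r - R.γ t j r| ≤ R.rate D * c₂ * q := by
  have hn : (0 : ℝ) < n := by exact_mod_cast H.n_pos
  have hm : (0 : ℝ) < m := by exact_mod_cast H.m_pos
  have hη := H.η_pos
  have hq0 : 0 ≤ q := (logisticWeight_pos _).le.trans (hq ⟨0, H.n_pos⟩)
  rw [γ_succ, add_sub_cancel_left, abs_mul, abs_of_nonneg (by positivity)]
  calc _ ≤ R.η * ‖R.μ‖ ^ 2 / (n * m) * ∑ i : Fin n, q := by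
        gcongr
        refine (Finset.abs_sum_le_sum_abs _ _).trans (Finset.sum_le_sum fun i _ => ?_)
        rw [abs_mul, abs_mul, abs_lab, one_mul, abs_of_pos (logisticWeight_pos _),
          abs_of_nonneg (reluDeriv_nonneg _)]
        exact (mul_le_of_le_one_right (logisticWeight_pos _).le (reluDeriv_le_one _)).trans (hq i)
    _ = R.η * ‖R.μ‖ ^ 2 / m * q := by simp; field_simp
    _ ≤ _ := by gcongr; exact H.signal_rate_le

lemma abs_ρ_step_le (H : R.Regular D ν Λ c₁ c₂) (t : ℕ) (j : ℤˣ) (r : Fin m) (i : Fin n) :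
    |R.ρ (t + 1) j r i - R.ρ t j r i| ≤ 2 * R.rate D * logisticWeight (R.margin t i) := by
  have hn : (0 : ℝ) < n := by exact_mod_cast H.n_pos
  have hm : (0 : ℝ) < m := by exact_mod_cast H.m_pos
  have hη := H.η_pos
  have hD := H.D_pos
  have hw := logisticWeight_pos (R.margin t i)
  have hr := reluDeriv_nonneg (inner ℝ (R.W t j r) (R.ξ i))
  rw [ρ_succ, add_sub_cancel_left, abs_mul, abs_of_nonneg (by positivity), abs_mul, abs_mul,
    abs_mul, abs_lab, abs_lab, one_mul, one_mul, abs_of_pos hw, abs_of_nonneg (reluDeriv_nonneg _)]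
  calc _ ≤ R.η * (2 * D) / (n * m) * (logisticWeight (R.margin t i) * 1) := by
        gcongr
        · exact H.noise_upper i
        · exact reluDeriv_le_one _
    _ = _ := by unfold rate; ring

lemma active_fraction (H : R.Regular D ν Λ c₁ c₂) {t : ℕ} (hC : R.Controlled Λ t) (i : Fin n) :
    1 / 4 ≤ 1 / m * ∑ r, reluDeriv (inner ℝ (R.W t (R.yt i) r) (R.ξ i)) ∧
      1 / m * ∑ r, reluDeriv (inner ℝ (R.W t (R.yt i) r) (R.ξ i)) ≤ 1 := by
  have hm : (0 : ℝ) < m := by exact_mod_cast H.m_pos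
  constructor
  · have h1 : (({r | 0 ≤ inner ℝ (R.W₀ (R.yt i) r) (R.ξ i)} : Finset (Fin m)).card : ℝ) ≤
        ∑ r, reluDeriv (inner ℝ (R.W t (R.yt i) r) (R.ξ i)) := by
      rw [Finset.card_filter]
      push_cast
      refine Finset.sum_le_sum fun r _ => ?_
      split_ifs with h
      · rw [reluDeriv, if_pos (hC.2.2 i r h)]
      · exact reluDeriv_nonneg _
    rw [one_div_mul_eq_div, le_div_iff₀ hm]
    linarith [H.active i]
  · rw [one_div_mul_eq_div, div_le_one hm]
    calc _ ≤ ∑ r : Fin m, (1 : ℝ) := Finset.sum_le_sum fun r _ => reluDeriv_le_one _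
      _ = m := by simp

lemma noisePart_step (H : R.Regular D ν Λ c₁ c₂) {t : ℕ} (hC : R.Controlled Λ t) (i : Fin n) :
    1 / 8 * R.rate D * logisticWeight (R.margin t i) ≤ R.noisePart (t + 1) i - R.noisePart t i ∧
    R.noisePart (t + 1) i - R.noisePart t i ≤ 2 * R.rate D * logisticWeight (R.margin t i) := by
  have hn : (0 : ℝ) < n := by exact_mod_cast H.n_pos
  have hm : (0 : ℝ) < m := by exact_mod_cast H.m_pos
  have hη := H.η_pos
  have hD := H.D_pos
  have hw := logisticWeight_pos (R.margin t i)
  obtain ⟨h1, h2⟩ := H.active_fraction hC i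
  rw [noisePart_succ_sub]
  constructor
  · calc _ = R.η * (D / 2) / (n * m) * logisticWeight (R.margin t i) * (1 / 4) := by
          unfold rate; ring
      _ ≤ _ := by
        gcongr
        exact H.noise_lower i
  · calc _ ≤ R.η * (2 * D) / (n * m) * logisticWeight (R.margin t i) * 1 := by
          gcongr
          exact H.noise_upper i
      _ = _ := by unfold rate; ring

/-- Two groups of neurons respond to the signal of class `c`: those with `j = c` and `γ > ε`, and
those with `j = -c` and `γ < -ε`. A step `Δ` of `γ` raises the output of branch `c` and lowers that
of branch `-c`, so the contributions add up, whence the factor `2`. -/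
lemma signalPart_step (H : R.Regular D ν Λ c₁ c₂) {t : ℕ} (hC : R.Controlled Λ t)
    (hstep : R.rate D * c₂ ≤ ν * (3 + 1 / c₁)) (c : ℤˣ) :
    (0 ≤ drift R.y R.clean (R.margin t) c →
      0 ≤ R.signalPart (ν * (3 + 1 / c₁)) (t + 1) c - R.signalPart (ν * (3 + 1 / c₁)) t c ∧
      R.signalPart (ν * (3 + 1 / c₁)) (t + 1) c - R.signalPart (ν * (3 + 1 / c₁)) t c ≤
        2 * R.rate D * c₂ * drift R.y R.clean (R.margin t) c) ∧
    (drift R.y R.clean (R.margin t) c ≤ 0 →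
      2 * R.rate D * c₂ * drift R.y R.clean (R.margin t) c ≤
        R.signalPart (ν * (3 + 1 / c₁)) (t + 1) c - R.signalPart (ν * (3 + 1 / c₁)) t c ∧
      R.signalPart (ν * (3 + 1 / c₁)) (t + 1) c - R.signalPart (ν * (3 + 1 / c₁)) t c ≤ 0) := by
  set ε := ν * (3 + 1 / c₁) with hε
  set δ := drift R.y R.clean (R.margin t) c with hδ
  set Δ := R.η * ‖R.μ‖ ^ 2 / m * δ with hΔ
  have hm : (0 : ℝ) < m := by exact_mod_cast H.m_pos
  have hη := H.η_pos
  have hrate := H.signal_rate_le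
  have hk : 0 ≤ R.η * ‖R.μ‖ ^ 2 / m := by positivity
  have hγ : ∀ j r, |R.γ (t + 1) j r - R.γ t j r| ≤ ε := fun j r => by
    have := H.abs_γ_step_le (t := t) (fun i => logisticWeight_le_one _) j r
    linarith
  have hP : ∀ r, _ := fun r => cutoff_step (ε := ε) (z := R.γ t c r) (z' := R.γ (t + 1) c r)
    (Δ := Δ) (fun hz => by
      have h1 := (abs_le.1 (H.abs_inner_signal_sub_le (hC.2.1 c r))).1
      have h2 := R.γ_succ_sub_of_active H.n_pos (t := t) (j := c) (σ := 1) (r := r)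
        (by rw [lab_one, one_mul]; linarith)
      rw [one_mul] at h2
      linarith) (hγ c r)
  have hN : ∀ r, _ := fun r => cutoff_step (ε := ε) (z := -R.γ t (-c) r)
    (z' := -R.γ (t + 1) (-c) r) (Δ := -Δ) (fun hz => by
      have h1 := (abs_le.1 (H.abs_inner_signal_sub_le (hC.2.1 (-c) r))).2
      have h2 := R.γ_succ_sub_of_active H.n_pos (t := t) (j := -c) (σ := -1) (r := r)
        (by rw [lab_neg, lab_one]; linarith)
      rw [neg_mul_neg, one_mul] at h2
      linarith) (by rw [← abs_neg]; convert hγ (-c) r using 2; ring)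
  have hsum : R.signalPart ε (t + 1) c - R.signalPart ε t c = 1 / m * ∑ r,
      ((cutoff ε (R.γ (t + 1) c r) - cutoff ε (R.γ t c r)) -
        (cutoff ε (-R.γ (t + 1) (-c) r) - cutoff ε (-R.γ t (-c) r))) := by
    unfold signalPart
    rw [← mul_sub, ← Finset.sum_sub_distrib]
    congr 1
    exact Finset.sum_congr rfl fun r _ => by ring
  have havg : 1 / (m : ℝ) * ∑ r : Fin m, 2 * Δ = 2 * Δ := by simp; field_simp
  rw [hsum]
  constructor
  · intro h0
    have hΔ0 : 0 ≤ Δ := mul_nonneg hk h0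
    constructor
    · refine mul_nonneg (by positivity) (Finset.sum_nonneg fun r _ => ?_)
      linarith [((hP r).1 hΔ0).1, ((hN r).2 (by linarith)).2]
    · calc _ ≤ 1 / (m : ℝ) * ∑ r : Fin m, 2 * Δ := by
            gcongr with r
            linarith [((hP r).1 hΔ0).2, ((hN r).2 (by linarith)).1]
        _ ≤ _ := by
            rw [havg, hΔ]
            nlinarith [mul_le_mul_of_nonneg_right hrate h0]
  · intro h0
    have hΔ0 : Δ ≤ 0 := mul_nonpos_of_nonneg_of_nonpos hk h0
    constructor
    · calc _ ≤ 1 / (m : ℝ) * ∑ r : Fin m, 2 * Δ := by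
            rw [havg, hΔ]
            nlinarith [mul_le_mul_of_nonpos_right hrate h0]
        _ ≤ _ := by
            gcongr with r
            linarith [((hP r).2 hΔ0).1, ((hN r).1 (by linarith)).2]
    · refine mul_nonpos_of_nonneg_of_nonpos (by positivity) (Finset.sum_nonpos fun r _ => ?_)
      linarith [((hP r).2 hΔ0).2, ((hN r).1 (by linarith)).1]

/-- As long as the run is controlled, its margins form a margin flow. -/
theorem marginFlow (H : R.Regular D ν Λ c₁ c₂) {T : ℕ} (hC : ∀ t < T, R.Controlled Λ t)
    (hstep : R.rate D * c₂ ≤ ν * (3 + 1 / c₁)) (hν : 16 * (ν * (3 + 1 / c₁)) ≤ 1) :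
    MarginFlow R.y R.clean (R.rate D) (1 / 8) 2 c₂ T R.noisePart
      (R.signalPart (ν * (3 + 1 / c₁))) R.margin where
  A_zero i := by simp [noisePart, ρ_zero]
  P_zero c := by simp [signalPart, γ_zero]
  A_lower t ht i := (H.noisePart_step (hC t ht) i).1
  A_upper t ht i := (H.noisePart_step (hC t ht) i).2
  P_of_nonneg t ht c := (H.signalPart_step (hC t ht) hstep c).1
  P_of_nonpos t ht c := (H.signalPart_step (hC t ht) hstep c).2
  approx t ht i := by
    have := H.abs_margin_sub_le (hC t ht).1 (hC t ht).2.1 i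
    linarith

/-- A neuron with the observed label of a sample that is active on its noise stays active. -/
lemma active_succ (H : R.Regular D ν Λ c₁ c₂) {t : ℕ} {q : ℝ} (hq : 0 ≤ q) (hqν : 4 * q * ν ≤ 1)
    {i : Fin n} (hw : ∀ k, logisticWeight (R.margin t k) ≤ q * logisticWeight (R.margin t i))
    {r : Fin m} (h : 0 ≤ inner ℝ (R.W t (R.yt i) r) (R.ξ i)) :
    0 ≤ inner ℝ (R.W (t + 1) (R.yt i) r) (R.ξ i) := by
  have hn : (0 : ℝ) < n := by exact_mod_cast H.n_pos
  have hm : (0 : ℝ) < m := by exact_mod_cast H.m_pos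
  have hη := H.η_pos
  have hD := H.D_pos
  have hΛ := H.Λ_ge
  have hν := H.ν_nonneg
  set w := logisticWeight (R.margin t i) with hw'
  have hwpos : 0 < w := logisticWeight_pos _
  rw [W_succ, inner_add_left, real_inner_smul_left, sum_inner]
  refine add_nonneg h (mul_nonneg (by positivity) ?_)
  simp only [real_inner_smul_left, inner_add_left]
  set b := ν * D / n with hb
  have hbΛ : ν * D / (n * Λ) ≤ b := by
    rw [hb]
    apply div_le_div_of_nonneg_left (by positivity) hn
    nlinarith
  have hb0 : 0 ≤ b := by positivity
  have hterm : ∀ k, |lab (R.yt i) * lab (R.yt k) * logisticWeight (R.margin t k)| ≤ q * w := by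
    intro k
    rw [abs_mul, abs_mul, abs_lab, abs_lab, one_mul, one_mul, abs_of_pos (logisticWeight_pos _)]
    exact hw k
  have hsig : ∀ k, |reluDeriv (inner ℝ (R.W t (R.yt i) r) (lab (R.y k) • R.μ)) *
      (lab (R.y k) * inner ℝ R.μ (R.ξ i))| ≤ b := by
    intro k
    rw [abs_mul, abs_mul, abs_lab, one_mul, abs_of_nonneg (reluDeriv_nonneg _)]
    calc _ ≤ 1 * b := mul_le_mul (reluDeriv_le_one _) ((H.signal_noise i).trans hbΛ)
          (abs_nonneg _) zero_le_one
      _ = b := one_mul b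
  have hnoi : ∀ k, k ≠ i → |reluDeriv (inner ℝ (R.W t (R.yt i) r) (R.ξ k)) *
      inner ℝ (R.ξ k) (R.ξ i)| ≤ b := by
    intro k hk
    rw [abs_mul, abs_of_nonneg (reluDeriv_nonneg _)]
    calc _ ≤ 1 * b := mul_le_mul (reluDeriv_le_one _) ((H.noise_noise k i hk).trans hbΛ)
          (abs_nonneg _) zero_le_one
      _ = b := one_mul b
  -- The own noise patch contributes `wD/2`, while each sample contributes cross terms of size at
  -- most `2qwb`. In total the latter amount to `2qν · wD`, which `4qν ≤ 1` makes harmless.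
  have hlow : ∀ k, (if k = i then w * (D / 2) else 0) - 2 * (q * w * b) ≤
      lab (R.yt i) * lab (R.yt k) * logisticWeight (R.margin t k) *
      (reluDeriv (inner ℝ (R.W t (R.yt i) r) (lab (R.y k) • R.μ)) *
        (lab (R.y k) * inner ℝ R.μ (R.ξ i)) +
        reluDeriv (inner ℝ (R.W t (R.yt i) r) (R.ξ k)) * inner ℝ (R.ξ k) (R.ξ i)) := by
    intro k
    have h1 := hterm k
    have h2 := abs_mul (lab (R.yt i) * lab (R.yt k) * logisticWeight (R.margin t k))
      (reluDeriv (inner ℝ (R.W t (R.yt i) r) (lab (R.y k) • R.μ)) *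
        (lab (R.y k) * inner ℝ R.μ (R.ξ i)))
    have h3 := mul_le_mul h1 (hsig k) (abs_nonneg _) (by positivity)
    rw [← h2] at h3
    have h4 := (abs_le.1 h3).1
    rw [mul_add]
    split_ifs with hk
    · subst hk
      rw [lab_mul_self, one_mul, ← hw'] at h4 ⊢
      rw [real_inner_self_eq_norm_sq (R.ξ k)]
      have h6 : reluDeriv (inner ℝ (R.W t (R.yt k) r) (R.ξ k)) = 1 := if_pos h
      rw [h6, one_mul]
      have h5 := mul_le_mul_of_nonneg_left (H.noise_lower k) hwpos.le
      have : 0 ≤ q * w * b := by positivity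
      linarith
    · have h5 := mul_le_mul h1 (hnoi k hk) (abs_nonneg _) (by positivity)
      rw [← abs_mul] at h5
      linarith [(abs_le.1 h5).1]
  calc (0 : ℝ) ≤ w * (D / 2) - n * (2 * (q * w * b)) := by
        have : n * (2 * (q * w * b)) = w * D * (2 * q * ν) := by rw [hb]; field_simp
        rw [this]
        nlinarith [mul_pos hwpos hD]
    _ = ∑ k, ((if k = i then w * (D / 2) else 0) - 2 * (q * w * b)) := by
        rw [Finset.sum_sub_distrib, Finset.sum_ite_eq' Finset.univ i]
        simp
    _ ≤ _ := Finset.sum_le_sum fun k _ => hlow k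

/-- A regular run is controlled as long as its coefficients may be expected to stay below `Λ`. -/
theorem controlled (H : R.Regular D ν Λ c₁ c₂) (hp : 0 < p) (hp1 : p ≤ 1)
    (hpop : Populated R.y R.clean p) (hstep : R.rate D * c₂ ≤ ν * (3 + 1 / c₁))
    (hν : 16 * (ν * (3 + 1 / c₁)) ≤ 1) (hsmall : R.rate D * (2 + 4 * c₂) ≤ 1 / 4)
    (hact : 4 * Real.exp (marginGap (1 / 8) 2 c₂ p + 1) * ν ≤ 1) {T : ℕ}
    (hΛ : (16 + 8 * c₂ * Real.exp (marginGap (1 / 8) 2 c₂ p + 1)) *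
      (2 * Real.log (1 + 2 * 2 * Real.exp (marginGap (1 / 8) 2 c₂ p + 1 / 2) * (R.rate D * T)) +
        2 * marginGap (1 / 8) 2 c₂ p) ≤ Λ) :
    ∀ t ≤ T, R.Controlled Λ t := by
  set B := marginGap (1 / 8) 2 c₂ p with hB
  have hh := H.rate_pos
  have hc₂ := H.c₂_pos
  have : Nonempty (Fin n) := ⟨⟨0, H.n_pos⟩⟩
  intro t
  induction t using Nat.strong_induction_on with
  | _ t ih =>
    intro ht
    rcases t with _ | t
    · have := H.Λ_ge
      refine ⟨fun j r => ?_, fun j r i => ?_, fun i r h => h⟩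
      · rw [γ_zero, abs_zero]; linarith
      · rw [ρ_zero, abs_zero]; linarith
    -- A flow up to time `t + 1` uses control at times before `t + 1` only, yet it bounds the noise
    -- parts at time `t + 1`. This closes the induction.
    · have F := H.marginFlow (T := t + 1) (fun s hs => ih s hs (by omega)) hstep hν
      have hw : ∀ s < t + 1, ∀ i k, logisticWeight (R.margin s k) ≤
          Real.exp (B + 1) * logisticWeight (R.margin s i) := fun s hs i k =>
        F.weight_le hh.le (by norm_num) hc₂.le hsmall (by norm_num) hp hp1 hpop hs k i
      have hA : ∀ i, (16 + 8 * c₂ * Real.exp (B + 1)) * R.noisePart (t + 1) i ≤ Λ := by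
        intro i
        refine le_trans ?_ hΛ
        gcongr
        refine (F.A_le hh.le (by norm_num) hc₂.le hsmall (by norm_num) hp hp1 hpop le_rfl i).trans ?_
        gcongr
      -- Here `16 = 2 / (1/8)` is the ratio of the largest step of a `ρ` to the smallest step of the
      -- noise part at the same weight.
      have hρ : ∀ s ≤ t + 1, ∀ j r i, |R.ρ s j r i| ≤ 16 * R.noisePart s i := by
        intro s
        induction s with
        | zero => intro _ j r i; simp [ρ_zero, noisePart]
        | succ s ihs =>
          intro hs j r i
          have h1 := ihs (by omega) j r i
          have h2 := H.abs_ρ_step_le s j r i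
          have h3 := F.A_lower s (by omega) i
          have h4 := abs_sub_abs_le_abs_sub (R.ρ (s + 1) j r i) (R.ρ s j r i)
          linarith
      -- A step of `γ` involves all weights, but these are at most `e^{B+1}` times the weight of any
      -- single sample `i`.
      have hγ : ∀ s ≤ t + 1, ∀ j r i,
          |R.γ s j r| ≤ 8 * c₂ * Real.exp (B + 1) * R.noisePart s i := by
        intro s
        induction s with
        | zero => intro _ j r i; simp [γ_zero, ρ_zero, noisePart]
        | succ s ihs =>
          intro hs j r i
          have h1 := ihs (by omega) j r i
          have h2 := H.abs_γ_step_le (hw s (by omega) i) j r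
          have h3 := F.A_lower s (by omega) i
          have h4 := abs_sub_abs_le_abs_sub (R.γ (s + 1) j r) (R.γ s j r)
          have h5 := mul_le_mul_of_nonneg_left h3
            (show 0 ≤ 8 * c₂ * Real.exp (B + 1) by positivity)
          linarith
      have hA0 : ∀ i, 0 ≤ R.noisePart (t + 1) i := fun i =>
        F.A_nonneg hh.le (by norm_num) le_rfl i
      have he : 0 ≤ 8 * c₂ * Real.exp (B + 1) := by positivity
      refine ⟨fun j r => ?_, fun j r i => ?_, fun i r h => ?_⟩
      · have i : Fin n := ⟨0, H.n_pos⟩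
        have h1 := hγ (t + 1) le_rfl j r i
        have := hA i
        have := hA0 i
        linarith
      · have h1 := hρ (t + 1) le_rfl j r i
        have := hA i
        have := mul_nonneg he (hA0 i)
        linarith
      · exact H.active_succ (q := Real.exp (B + 1)) (Real.exp_pos _).le hact
          (fun k => hw t (by omega) i k) ((ih t (by omega) (by omega)).2.2 i r h)

end Regular
end Run

/-! ### Loss, uniqueness of the coefficients, weight norms and memorization. -/

lemma le_cutoff_sub_cutoff {ε : ℝ} (hε : 0 ≤ ε) (z : ℝ) :
    z ≤ cutoff ε z - cutoff ε (-z) + 2 * ε := by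
  unfold cutoff
  rcases max_cases 0 (z - 2 * ε) with ⟨h1, h2⟩ | ⟨h1, h2⟩ <;>
    rcases max_cases 0 (-z - 2 * ε) with ⟨h3, h4⟩ | ⟨h3, h4⟩ <;> rw [h1, h3] <;> linarith

lemma logisticLoss_le_exp_neg (f y : ℝ) : logisticLoss f y ≤ Real.exp (-(y * f)) := by
  unfold logisticLoss
  rw [mul_comm f y]
  have := Real.log_le_sub_one_of_pos (show 0 < 1 + Real.exp (-(y * f)) by positivity)
  linarith

namespace Run

variable {n m d : ℕ}

lemma trainLoss_le (R : Run n m d) {t : ℕ} {ε : ℝ} (hn : 0 < n)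
    (h : ∀ i, Real.exp (-R.margin t i) ≤ ε) : trainLoss R.x R.yt (R.W t) ≤ ε := by
  have hn' : (0 : ℝ) < n := by exact_mod_cast hn
  unfold trainLoss
  calc _ ≤ 1 / (n : ℝ) * ∑ i : Fin n, ε := by
        gcongr with i
        exact (logisticLoss_le_exp_neg _ _).trans (h i)
    _ = ε := by simp; field_simp

namespace Regular

variable {R : Run n m d} {D ν Λ c₁ c₂ p : ℝ}

/-- The signal and noise coefficients are unique. -/
theorem isUniqueDecomposition (H : R.Regular D ν Λ c₁ c₂) (hν : 16 * (ν * (3 + 1 / c₁)) ≤ 1)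
    (t : ℕ) : IsUniqueDecomposition R.μ R.ξ R.W₀ (R.W t) (R.γ t) (R.ρ t) := by
  refine ⟨H.isDecomposition t, fun γ' ρ' h' => ?_⟩
  have hn : (0 : ℝ) < n := by exact_mod_cast H.n_pos
  have hD := H.D_pos
  have hν0 := H.ν_nonneg
  have hc := H.c₁_pos
  have hμ := H.μ_sq_pos
  have hΛ := H.Λ_ge
  have hb : ν * D / (n * Λ) ≤ ν * D / n := by
    apply div_le_div_of_nonneg_left (by positivity) hn
    nlinarith
  -- The difference of two decompositions solves a homogeneous system. Pairing it with `μ` and each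
  -- `ξ_i` shows that the system is diagonally dominant: the sum `X` of the `|b i|` is at most `2ν(1
  -- + ν / c₁) X`, which forces `X = 0`.
  suffices hz : ∀ j r, γ' j r - R.γ t j r = 0 ∧ ∀ i, ρ' j r i - R.ρ t j r i = 0 by
    refine ⟨?_, ?_⟩
    · ext j r; exact sub_eq_zero.1 (hz j r).1
    · ext j r i; exact sub_eq_zero.1 ((hz j r).2 i)
  intro j r
  set a := γ' j r - R.γ t j r with ha
  set b : Fin n → ℝ := fun i => ρ' j r i - R.ρ t j r i with hbdef
  have hzero : (lab j * a * (‖R.μ‖ ^ 2)⁻¹) • R.μ + ∑ i, (b i * (‖R.ξ i‖ ^ 2)⁻¹) • R.ξ i = 0 := by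
    have h1 := H.isDecomposition t j r
    rw [h' j r] at h1
    simp only [ha, hbdef, sub_mul, mul_sub, sub_smul, Finset.sum_sub_distrib]
    rw [← sub_eq_zero.2 h1]
    abel
  have hinner : ∀ v : Patch d, lab j * a * (‖R.μ‖ ^ 2)⁻¹ * inner ℝ R.μ v +
      ∑ k, b k * (‖R.ξ k‖ ^ 2)⁻¹ * inner ℝ (R.ξ k) v = 0 := by
    intro v
    have := congrArg (fun w => inner ℝ w v) hzero
    simpa only [inner_add_left, real_inner_smul_left, sum_inner, inner_zero_left] using this
  have hcross : ∀ (k : Fin n) (e : ℝ), |e| ≤ ν * D / (n * Λ) →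
      |b k * (‖R.ξ k‖ ^ 2)⁻¹ * e| ≤ 2 * ν / n * |b k| := by
    intro k e he
    have h1 : (‖R.ξ k‖ ^ 2)⁻¹ ≤ 2 / D := by
      rw [inv_le_comm₀ (H.ξ_sq_pos k) (by positivity), inv_div]
      exact H.noise_lower k
    rw [abs_mul, abs_mul, abs_of_nonneg (inv_nonneg.2 (H.ξ_sq_pos k).le)]
    calc _ ≤ |b k| * (2 / D) * (ν * D / n) := by
          gcongr
          exact he.trans hb
      _ = _ := by field_simp
  set X := ∑ k, |b k| with hX
  have hX0 : 0 ≤ X := Finset.sum_nonneg fun _ _ => abs_nonneg _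
  have h1 : |a| ≤ 2 * ν / n * X := by
    have h2 := hinner R.μ
    rw [real_inner_self_eq_norm_sq, mul_assoc, inv_mul_cancel₀ hμ.ne', mul_one] at h2
    have h3 : |a| = |lab j * a| := by rw [abs_mul, abs_lab, one_mul]
    rw [h3, eq_neg_of_add_eq_zero_left h2, abs_neg, hX, Finset.mul_sum]
    refine (Finset.abs_sum_le_sum_abs _ _).trans (Finset.sum_le_sum fun k _ => hcross k _ ?_)
    rw [real_inner_comm]
    exact H.signal_noise k
  have h2 : ∀ i, |b i| ≤ |a| * (ν * (1 / c₁)) + 2 * ν / n * X := by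
    intro i
    have h3 := hinner (R.ξ i)
    rw [← Finset.add_sum_erase _ _ (Finset.mem_univ i), real_inner_self_eq_norm_sq,
      mul_assoc (b i), inv_mul_cancel₀ (H.ξ_sq_pos i).ne', mul_one] at h3
    have h4 : b i = -(lab j * a * (‖R.μ‖ ^ 2)⁻¹ * inner ℝ R.μ (R.ξ i)) -
        ∑ k ∈ Finset.univ.erase i, b k * (‖R.ξ k‖ ^ 2)⁻¹ * inner ℝ (R.ξ k) (R.ξ i) := by
      linarith
    rw [h4]
    refine (abs_sub _ _).trans (add_le_add ?_ ?_)
    · rw [abs_neg, abs_mul, abs_mul, abs_mul, abs_lab, one_mul,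
        abs_of_nonneg (inv_nonneg.2 hμ.le), mul_assoc]
      refine mul_le_mul_of_nonneg_left ?_ (abs_nonneg a)
      calc _ ≤ (‖R.μ‖ ^ 2)⁻¹ * (ν * D / n) := by
            gcongr
            exact (H.signal_noise i).trans hb
        _ = ν * (D / (n * ‖R.μ‖ ^ 2)) := by field_simp
        _ ≤ _ := by
          refine mul_le_mul_of_nonneg_left ?_ hν0
          rw [div_le_div_iff₀ (by positivity) hc]
          linarith [H.signal_lower]
    · refine (Finset.abs_sum_le_sum_abs _ _).trans ?_
      calc _ ≤ ∑ k ∈ Finset.univ.erase i, 2 * ν / n * |b k| :=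
            Finset.sum_le_sum fun k hk => hcross k _
              (H.noise_noise k i (Finset.ne_of_mem_erase hk))
        _ ≤ ∑ k, 2 * ν / n * |b k| :=
            Finset.sum_le_sum_of_subset_of_nonneg (Finset.erase_subset _ _)
              fun _ _ _ => by positivity
        _ = _ := by rw [hX, Finset.mul_sum]
  have h3 : X ≤ n * (|a| * (ν * (1 / c₁)) + 2 * ν / n * X) := by
    calc X ≤ ∑ i : Fin n, (|a| * (ν * (1 / c₁)) + 2 * ν / n * X) :=
          Finset.sum_le_sum fun i _ => h2 i
      _ = _ := by rw [Finset.sum_const, Finset.card_univ, Fintype.card_fin, nsmul_eq_mul]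
  have h4 : n * (2 * ν / n * X) = 2 * ν * X := by field_simp
  have h5 : n * |a| ≤ 2 * ν * X := by
    rw [← h4]
    gcongr
  have hcν : 0 ≤ ν * (1 / c₁) := by positivity
  have h6 : X ≤ 2 * ν * X * (ν * (1 / c₁)) + 2 * ν * X := by
    calc X ≤ _ := h3
      _ = n * |a| * (ν * (1 / c₁)) + n * (2 * ν / n * X) := by ring
      _ ≤ _ := by rw [h4]; gcongr
  have h7 : X = 0 := by
    have h8 : ν ≤ 1 / 48 := by linarith
    have h9 : ν * (1 / c₁) ≤ 1 / 16 := by linarith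
    have h10 : 2 * ν * X * (ν * (1 / c₁)) ≤ 2 * ν * X * (1 / 16) := by gcongr
    nlinarith
  rw [h7, mul_zero] at h1
  refine ⟨abs_nonpos_iff.1 h1, fun i => ?_⟩
  rw [hX, Finset.sum_eq_zero_iff_of_nonneg fun _ _ => abs_nonneg _] at h7
  exact abs_eq_zero.1 (h7 i (Finset.mem_univ i))

/-- With `V = W - W₀`, only one factor of `⟨V, V⟩` is expanded. The inner products of `V` with `μ`
and the `ξ_i` are already known to be at most `2Λ`, so no double sum over the noise patches arises.
-/
lemma sq_norm_W_le (H : R.Regular D ν Λ c₁ c₂) (hν : 16 * (ν * (3 + 1 / c₁)) ≤ 1) {t : ℕ}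
    (hC : R.Controlled Λ t) (j : ℤˣ) (r : Fin m) :
    ‖R.W t j r‖ ^ 2 ≤ 2 * ‖R.W₀ j r‖ ^ 2 + (4 / c₁ + 8) * (n * Λ ^ 2 / D) := by
  have hn : (0 : ℝ) < n := by exact_mod_cast H.n_pos
  have hD := H.D_pos
  have hν0 := H.ν_nonneg
  have hc := H.c₁_pos
  have hμ := H.μ_sq_pos
  have hΛ := H.Λ_ge
  have hcν : 0 ≤ ν * (1 / c₁) := by positivity
  set V := R.W t j r - R.W₀ j r with hV
  have hγ := hC.1 j r
  have hρ := hC.2.1 j r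
  have hVξ : ∀ i, |inner ℝ (R.ξ i) V| ≤ 2 * Λ := by
    intro i
    have h1 := abs_le.1 (H.abs_inner_noise_sub_le hγ hρ i)
    have h2 := abs_le.1 (H.init_noise j r i)
    have h3 := abs_le.1 (hρ i)
    rw [real_inner_comm, hV, inner_sub_left, abs_le]
    constructor <;> linarith
  have hVμ : |inner ℝ R.μ V| ≤ 2 * Λ := by
    have h1 := abs_le.1 (H.abs_inner_signal_sub_le (t := t) hρ)
    have h2 := abs_le.1 (H.init_signal j r)
    have h3 := abs_le.1 hγ
    have h4 : |lab j * inner ℝ (R.W t j r) R.μ| ≤ Λ + 1 / 16 := by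
      rw [← real_inner_smul_right, abs_le]
      constructor <;> linarith
    rw [abs_mul, abs_lab, one_mul, abs_le] at h4
    rw [real_inner_comm, hV, inner_sub_left, abs_le]
    constructor <;> linarith
  have hVeq : V = (lab j * R.γ t j r * (‖R.μ‖ ^ 2)⁻¹) • R.μ +
      ∑ i, (R.ρ t j r i * (‖R.ξ i‖ ^ 2)⁻¹) • R.ξ i := by
    rw [hV, H.isDecomposition t j r, add_assoc, add_sub_cancel_left]
  have hVsq : ‖V‖ ^ 2 ≤ (2 / c₁ + 4) * (n * Λ ^ 2 / D) := by
    rw [← real_inner_self_eq_norm_sq]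
    nth_rewrite 1 [hVeq]
    rw [inner_add_left, sum_inner]
    simp only [real_inner_smul_left]
    have h1 : lab j * R.γ t j r * (‖R.μ‖ ^ 2)⁻¹ * inner ℝ R.μ V ≤ 2 / c₁ * (n * Λ ^ 2 / D) := by
      refine (le_abs_self _).trans ?_
      rw [abs_mul, abs_mul, abs_mul, abs_lab, one_mul, abs_of_nonneg (inv_nonneg.2 hμ.le)]
      have h2 : (‖R.μ‖ ^ 2)⁻¹ ≤ n / (c₁ * D) := by
        rw [inv_le_comm₀ hμ (by positivity), inv_div, div_le_iff₀ hn]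
        linarith [H.signal_lower]
      calc _ ≤ Λ * (n / (c₁ * D)) * (2 * Λ) := by gcongr
        _ = _ := by field_simp
    have h2 : ∑ i, R.ρ t j r i * (‖R.ξ i‖ ^ 2)⁻¹ * inner ℝ (R.ξ i) V ≤ 4 * (n * Λ ^ 2 / D) := by
      calc _ ≤ ∑ i : Fin n, 4 * (Λ ^ 2 / D) := by
            refine Finset.sum_le_sum fun i _ => (le_abs_self _).trans ?_
            have h1 : (‖R.ξ i‖ ^ 2)⁻¹ ≤ 2 / D := by
              rw [inv_le_comm₀ (H.ξ_sq_pos i) (by positivity), inv_div]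
              exact H.noise_lower i
            rw [abs_mul, abs_mul, abs_of_nonneg (inv_nonneg.2 (H.ξ_sq_pos i).le)]
            calc _ ≤ Λ * (2 / D) * (2 * Λ) := by
                  gcongr
                  · exact hρ i
                  · exact hVξ i
              _ = _ := by ring
        _ = _ := by simp; ring
    linarith
  have h1 : R.W t j r = R.W₀ j r + V := by rw [hV]; abel
  have h2 : ‖R.W t j r‖ ^ 2 ≤ 2 * ‖R.W₀ j r‖ ^ 2 + 2 * ‖V‖ ^ 2 := by
    rw [h1]
    have := norm_add_le (R.W₀ j r) V
    nlinarith [sq_nonneg (‖R.W₀ j r‖ - ‖V‖), norm_nonneg (R.W₀ j r + V)]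
  have h3 : (4 / c₁ + 8) * (n * Λ ^ 2 / D) = 2 * ((2 / c₁ + 4) * (n * Λ ^ 2 / D)) := by ring
  linarith

/-- Of two noisy samples from different classes with large margins, at least one has a larger
averaged noise than signal coefficient. -/
lemma noise_dominates_or (H : R.Regular D ν Λ c₁ c₂) (hν : 16 * (ν * (3 + 1 / c₁)) ≤ 1) {t : ℕ}
    (hC : R.Controlled Λ t) {i k : Fin n} (hi : R.yt i ≠ R.y i) (hk : R.yt k ≠ R.y k)
    (hik : R.y k = -R.y i) (hMi : 1 ≤ R.margin t i) (hMk : 1 ≤ R.margin t k) :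
    1 / (m : ℝ) * ∑ r, R.γ t (-R.yt i) r < 1 / (m : ℝ) * ∑ r, rhoBar (R.ρ t (R.yt i) r i) ∨
    1 / (m : ℝ) * ∑ r, R.γ t (-R.yt k) r < 1 / (m : ℝ) * ∑ r, rhoBar (R.ρ t (R.yt k) r k) := by
  set ε := ν * (3 + 1 / c₁) with hε
  have hm : (0 : ℝ) < m := by exact_mod_cast H.m_pos
  have hε0 : 0 ≤ ε := by
    have := H.ν_nonneg
    have := H.c₁_pos
    positivity
  by_contra hcon
  push Not at hcon
  obtain ⟨h1, h2⟩ := hcon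
  have hbar : ∀ i, 1 / (m : ℝ) * ∑ r, rhoBar (R.ρ t (R.yt i) r i) = R.noisePart t i := by
    intro i
    unfold noisePart
    congr 1
    exact Finset.sum_congr rfl fun r _ => if_pos (R.ρ_label_nonneg H.η_pos.le t r i)
  have hyt : ∀ i, R.yt i ≠ R.y i → -R.yt i = R.y i := fun i h => by
    rw [Int.units_ne_iff_eq_neg.1 h, neg_neg]
  have hcl : ∀ i, R.yt i ≠ R.y i → lab (R.clean i) = -1 := fun i h => by
    rw [clean, lab_mul, ← hyt i h, lab_neg, mul_neg, lab_mul_self]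
  have hγ : ∀ c, 1 / (m : ℝ) * ∑ r, R.γ t c r ≤ 1 / (m : ℝ) * ∑ r, cutoff ε (R.γ t c r) -
      1 / (m : ℝ) * ∑ r, cutoff ε (-R.γ t c r) + 2 * ε := by
    intro c
    have h3 : 1 / (m : ℝ) * ∑ r : Fin m, 2 * ε = 2 * ε := by simp; field_simp
    rw [← h3, ← mul_sub, ← mul_add, ← Finset.sum_sub_distrib, ← Finset.sum_add_distrib]
    gcongr with r
    exact le_cutoff_sub_cutoff hε0 _
  have hsig : ∀ c, R.signalPart ε t c = 1 / (m : ℝ) * ∑ r, cutoff ε (R.γ t c r) -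
      1 / (m : ℝ) * ∑ r, cutoff ε (-R.γ t (-c) r) := by
    intro c
    unfold signalPart
    rw [Finset.sum_sub_distrib, mul_sub]
  have happ := fun i => (abs_le.1 (H.abs_margin_sub_le hC.1 hC.2.1 i)).2
  have ai := happ i
  have ak := happ k
  rw [hcl i hi, hsig] at ai
  rw [hcl k hk, hsig, hik, neg_neg] at ak
  rw [hbar, hyt i hi] at h1
  rw [hbar, hyt k hk, hik] at h2
  -- In the sum of the two margins the cutoffs regroup by branch, and each branch recovers its
  -- averaged `γ` up to `2ε`. If noise dominated in neither sample, then `2 ≤ 20ε`, against `16ε ≤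
  -- 1`.
  linarith [hγ (R.y i), hγ (-R.y i)]

/-- After a long enough time all margins are large. -/
theorem exp_neg_margin_le (H : R.Regular D ν Λ c₁ c₂) (hp : 0 < p) (hp1 : p ≤ 1)
    (hpop : Populated R.y R.clean p) (hstep : R.rate D * c₂ ≤ ν * (3 + 1 / c₁))
    (hν : 16 * (ν * (3 + 1 / c₁)) ≤ 1) (hsmall : R.rate D * (2 + 4 * c₂) ≤ 1 / 4) {t : ℕ}
    (hC : ∀ s ≤ t, R.Controlled Λ s) (i : Fin n) :
    R.rate D * t * Real.exp (-R.margin t i) ≤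
      16 * Real.exp (2 * marginGap (1 / 8) 2 c₂ p + 1) := by
  have : Nonempty (Fin n) := ⟨⟨0, H.n_pos⟩⟩
  -- The horizon `t + 1` is needed because a flow approximates margins only strictly before its end.
  have F := H.marginFlow (T := t + 1) (fun s hs => hC s (by omega)) hstep hν
  have h1 := F.le_exp_proxy H.rate_pos.le (by norm_num) H.c₂_pos.le hsmall (by norm_num) hp hp1
    hpop (t := t) (by omega) i
  have h2 := (abs_le.1 (F.approx t (by omega) i)).1
  set B := marginGap (1 / 8) 2 c₂ p
  have h3 : Real.exp (MarginFlow.proxy R.y R.clean R.noisePart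
      (R.signalPart (ν * (3 + 1 / c₁))) t i) ≤ Real.exp (R.margin t i + 1 / 2) :=
    Real.exp_le_exp.2 (by unfold MarginFlow.proxy; linarith)
  have h4 : R.rate D * t ≤ 16 * Real.exp (2 * B + 1) * Real.exp (R.margin t i) := by
    have h5 : 1 / 8 / (2 * Real.exp (B + 1 / 2)) * (R.rate D * t) ≤
        Real.exp B * Real.exp (R.margin t i + 1 / 2) := h1.trans (by gcongr)
    rw [div_div, one_div_mul_eq_div, div_le_iff₀ (by positivity)] at h5
    refine h5.trans (le_of_eq ?_)
    have : Real.exp (2 * B + 1) * Real.exp (R.margin t i) =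
        Real.exp B * Real.exp (R.margin t i + 1 / 2) * Real.exp (B + 1 / 2) := by
      simp only [← Real.exp_add]; ring_nf
    linear_combination (-16 : ℝ) * this
  calc _ ≤ 16 * Real.exp (2 * B + 1) * Real.exp (R.margin t i) * Real.exp (-R.margin t i) := by
        gcongr
    _ = _ := by rw [mul_assoc, ← Real.exp_add]; simp

end Regular
end Run

/-! ### Gaussian concentration -/

section Gaussian

variable {d : ℕ}

instance isProbabilityMeasure_gaussianPatch (d : ℕ) (σ : ℝ) :
    IsProbabilityMeasure (gaussianPatch d σ) :=
  Measure.isProbabilityMeasure_map (by fun_prop)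

lemma map_inner_gaussianPatch (σ : ℝ) (v : Patch d) :
    (gaussianPatch d σ).map (fun x => inner ℝ x v) =
      gaussianReal 0 (σ ^ 2 * ‖v‖ ^ 2).toNNReal := by
  have h1 := IsGaussian.map_eq_gaussianReal (μ := stdGaussian (Patch d)) (innerSL ℝ (σ • v))
  rw [integral_strongDual_stdGaussian, variance_dual_stdGaussian, innerSL_apply_norm, norm_smul,
    mul_pow, Real.norm_eq_abs, sq_abs] at h1
  rw [gaussianPatch, Measure.map_map (by fun_prop) (by fun_prop), ← h1]
  congr 1
  ext x
  simp [real_inner_smul_right, real_inner_comm]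

lemma integrable_exp_inner (σ : ℝ) (v : Patch d) (t : ℝ) :
    Integrable (fun x => Real.exp (t * inner ℝ x v)) (gaussianPatch d σ) := by
  have h1 := integrable_exp_mul_gaussianReal (μ := 0) (v := (σ ^ 2 * ‖v‖ ^ 2).toNNReal) t
  rw [← map_inner_gaussianPatch] at h1
  exact h1.comp_measurable (by fun_prop)

lemma integral_exp_inner (σ : ℝ) (v : Patch d) (t : ℝ) :
    ∫ x, Real.exp (t * inner ℝ x v) ∂gaussianPatch d σ =
      Real.exp (σ ^ 2 * ‖v‖ ^ 2 * t ^ 2 / 2) := by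
  have h1 := mgf_gaussianReal (map_inner_gaussianPatch σ v) t
  rw [mgf, Real.coe_toNNReal _ (by positivity), zero_mul, zero_add] at h1
  exact h1

lemma integrable_exp_abs_inner (σ : ℝ) (v : Patch d) (t : ℝ) :
    Integrable (fun x => Real.exp (t * |inner ℝ x v|)) (gaussianPatch d σ) := by
  refine ((integrable_exp_inner σ v t).add (integrable_exp_inner σ v (-t))).mono'
    (by fun_prop) (Filter.Eventually.of_forall fun x => ?_)
  rw [Real.norm_of_nonneg (Real.exp_pos _).le]
  simp only [Pi.add_apply]
  have h1 := Real.exp_pos (t * inner ℝ x v)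
  have h2 := Real.exp_pos (-t * inner ℝ x v)
  rcases abs_choice (inner ℝ x v) with h | h
  · rw [h]; linarith
  · rw [h, mul_neg, ← neg_mul]; linarith

lemma integral_exp_abs_inner_le {σ V : ℝ} {v : Patch d} (hV : σ ^ 2 * ‖v‖ ^ 2 ≤ V) (t : ℝ) :
    ∫ x, Real.exp (t * |inner ℝ x v|) ∂gaussianPatch d σ ≤ 2 * Real.exp (V * t ^ 2 / 2) := by
  calc _ ≤ ∫ x, (Real.exp (t * inner ℝ x v) + Real.exp (-t * inner ℝ x v))
        ∂gaussianPatch d σ := by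
        refine integral_mono (integrable_exp_abs_inner σ v t)
          ((integrable_exp_inner σ v t).add (integrable_exp_inner σ v (-t))) fun x => ?_
        have h1 := Real.exp_pos (t * inner ℝ x v)
        have h2 := Real.exp_pos (-t * inner ℝ x v)
        rcases abs_choice (inner ℝ x v) with h | h
        · simp only [h]; linarith
        · simp only [h, mul_neg, ← neg_mul]; linarith
    _ = 2 * Real.exp (σ ^ 2 * ‖v‖ ^ 2 * t ^ 2 / 2) := by
        rw [integral_add (integrable_exp_inner σ v t) (integrable_exp_inner σ v (-t)),
          integral_exp_inner, integral_exp_inner, neg_sq]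
        ring
    _ ≤ _ := by gcongr

/-- The Gaussian tail bound for a linear functional. -/
lemma gaussianPatch_inner_tail {σ V s : ℝ} {v : Patch d} (hVpos : 0 < V)
    (hV : σ ^ 2 * ‖v‖ ^ 2 ≤ V) (hs : 0 ≤ s) :
    (gaussianPatch d σ).real {x | s ≤ |inner ℝ x v|} ≤ 2 * Real.exp (-(s ^ 2 / (2 * V))) := by
  -- The exponent `s / V` is the optimal Chernoff parameter for variance `V`.
  have h1 := mul_meas_ge_le_integral_of_nonneg (μ := gaussianPatch d σ)
    (f := fun x => Real.exp (s / V * |inner ℝ x v|))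
    (Filter.Eventually.of_forall fun x => (Real.exp_pos _).le)
    (integrable_exp_abs_inner σ v (s / V)) (Real.exp (s / V * s))
  have h2 := h1.trans (integral_exp_abs_inner_le hV (s / V))
  have h3 : {x : Patch d | s ≤ |inner ℝ x v|} ⊆
      {x | Real.exp (s / V * s) ≤ Real.exp (s / V * |inner ℝ x v|)} := by
    intro x hx
    exact Real.exp_le_exp.2 (mul_le_mul_of_nonneg_left hx (by positivity))
  have h4 := measureReal_mono (μ := gaussianPatch d σ) h3
  refine h4.trans ?_
  rw [mul_comm, ← le_div_iff₀ (Real.exp_pos _)] at h2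
  refine h2.trans (le_of_eq ?_)
  rw [mul_div_assoc, ← Real.exp_sub]
  congr 2
  field_simp
  ring

lemma half_le_gaussianPatch_inner_nonneg (σ : ℝ) (v : Patch d) :
    1 / 2 ≤ (gaussianPatch d σ).real {x | 0 ≤ inner ℝ x v} := by
  set V := (σ ^ 2 * ‖v‖ ^ 2).toNNReal
  have h1 : (gaussianPatch d σ).real {x | 0 ≤ inner ℝ x v} = (gaussianReal 0 V).real (Set.Ici 0) := by
    rw [← map_inner_gaussianPatch, map_measureReal_apply (by fun_prop) measurableSet_Ici]
    rfl
  have h2 : (gaussianReal 0 V).real (Set.Ici 0) = (gaussianReal 0 V).real (Set.Iic 0) := by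
    have h3 := gaussianReal_map_neg (μ := 0) (v := V)
    rw [neg_zero] at h3
    nth_rewrite 1 [← h3]
    rw [map_measureReal_apply (by fun_prop) measurableSet_Ici]
    congr 1
    ext x
    simp
  have h4 : 1 ≤ (gaussianReal 0 V).real (Set.Ici 0) + (gaussianReal 0 V).real (Set.Iic 0) := by
    refine le_trans ?_ (measureReal_union_le _ _)
    rw [Set.union_comm, Set.Iic_union_Ici]
    simp
  rw [h1]
  linarith

lemma integral_exp_mul_sq_gaussianReal {a : ℝ} (ha : a < 1 / 2) :
    ∫ x, Real.exp (a * x ^ 2) ∂gaussianReal 0 1 = (√(1 - 2 * a))⁻¹ := by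
  rw [integral_gaussianReal_eq_integral_smul one_ne_zero]
  have h1 : ∀ x : ℝ, gaussianPDFReal 0 1 x • Real.exp (a * x ^ 2) =
      (√(2 * Real.pi))⁻¹ * Real.exp (-(1 / 2 - a) * x ^ 2) := by
    intro x
    simp only [gaussianPDFReal, smul_eq_mul, NNReal.coe_one, mul_one, sub_zero]
    rw [mul_assoc, ← Real.exp_add]
    congr 2
    ring
  simp only [h1]
  rw [integral_const_mul, integral_gaussian]
  have hpi := Real.pi_pos
  have h2 : Real.pi / (1 / 2 - a) = 2 * Real.pi * (1 - 2 * a)⁻¹ := by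
    have : 1 / 2 - a ≠ 0 := by linarith
    have : 1 - 2 * a ≠ 0 := by linarith
    field_simp
  rw [h2, Real.sqrt_mul (x := 2 * Real.pi) (by positivity), Real.sqrt_inv, ← mul_assoc, inv_mul_cancel₀, one_mul]
  positivity

lemma integral_exp_mul_norm_sq_stdGaussian {a : ℝ} (ha : a < 1 / 2) :
    ∫ x, Real.exp (a * ‖x‖ ^ 2) ∂stdGaussian (Patch d) = ((√(1 - 2 * a))⁻¹) ^ d := by
  rw [← map_pi_eq_stdGaussian, integral_map (by fun_prop) (by fun_prop)]
  have h1 : ∀ x : Fin d → ℝ, Real.exp (a * ‖(WithLp.toLp 2 x : Patch d)‖ ^ 2) =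
      ∏ i, Real.exp (a * x i ^ 2) := by
    intro x
    rw [EuclideanSpace.norm_sq_eq, Finset.mul_sum, Real.exp_sum]
    simp
  simp only [h1]
  rw [integral_fintype_prod_eq_pow (fun x : ℝ => Real.exp (a * x ^ 2)),
    integral_exp_mul_sq_gaussianReal ha, Fintype.card_fin]

/-- Chernoff's bound for the chi-square distribution: `a > 0` gives the upper tail, `a < 0` the
lower one. -/
lemma stdGaussian_exp_norm_sq_tail {a : ℝ} (ha : a < 1 / 2) (b : ℝ) :
    (stdGaussian (Patch d)).real {x | b * d ≤ a * ‖x‖ ^ 2} ≤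
      (Real.exp (-b) * (√(1 - 2 * a))⁻¹) ^ d := by
  have h0 := integral_exp_mul_norm_sq_stdGaussian (d := d) ha
  have hpos : 0 < √(1 - 2 * a) := Real.sqrt_pos.2 (by linarith)
  have hint : Integrable (fun x => Real.exp (a * ‖x‖ ^ 2)) (stdGaussian (Patch d)) :=
    Integrable.of_integral_ne_zero (by rw [h0]; positivity)
  have h1 := mul_meas_ge_le_integral_of_nonneg
    (Filter.Eventually.of_forall fun x => (Real.exp_pos _).le) hint (Real.exp (b * d))
  simp only [Real.exp_le_exp, h0] at h1
  rw [mul_comm, ← le_div_iff₀ (Real.exp_pos _)] at h1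
  refine h1.trans (le_of_eq ?_)
  rw [mul_pow, ← Real.exp_nat_mul, div_eq_mul_inv, ← Real.exp_neg, mul_comm]
  congr 2
  ring

/-- The squared norm of a Gaussian vector is of the order of its expectation. -/
lemma gaussianPatch_norm_sq_tail {σ : ℝ} (hσ : 0 < σ) :
    (gaussianPatch d σ).real {x | ¬ (σ ^ 2 * d / 2 ≤ ‖x‖ ^ 2 ∧ ‖x‖ ^ 2 ≤ 2 * (σ ^ 2 * d))} ≤
      2 * Real.exp (-(d / 16 : ℝ)) := by
  have hσ2 : 0 < σ ^ 2 := by positivity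
  rw [gaussianPatch, map_measureReal_apply (by fun_prop) (by measurability)]
  have h1 : (fun v : Patch d => σ • v) ⁻¹'
      {x | ¬ (σ ^ 2 * d / 2 ≤ ‖x‖ ^ 2 ∧ ‖x‖ ^ 2 ≤ 2 * (σ ^ 2 * d))} ⊆
      {x | (-(1 / 4)) * (d : ℝ) ≤ (-(1 / 2)) * ‖x‖ ^ 2} ∪ {x | (1 / 2) * (d : ℝ) ≤ 1 / 4 * ‖x‖ ^ 2} := by
    intro x hx
    simp only [Set.mem_preimage, Set.mem_ofPred_eq, norm_smul, mul_pow, Real.norm_eq_abs, sq_abs,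
      not_and_or, not_le] at hx
    rcases hx with hx | hx
    · left
      have : σ ^ 2 * ‖x‖ ^ 2 < σ ^ 2 * (d / 2) := by linarith
      have := lt_of_mul_lt_mul_left this hσ2.le
      simp only [Set.mem_ofPred_eq]; linarith
    · right
      have : σ ^ 2 * (2 * d) < σ ^ 2 * ‖x‖ ^ 2 := by linarith
      have := lt_of_mul_lt_mul_left this hσ2.le
      simp only [Set.mem_ofPred_eq]; linarith
  refine (measureReal_mono h1).trans ((measureReal_union_le _ _).trans ?_)
  -- These parameters give the factors `e^{1/4}/√2` and `e^{-1/2}√2` per dimension, both below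
  -- `e^{-1/16}`.
  have h2 := stdGaussian_exp_norm_sq_tail (d := d) (a := -(1 / 2)) (by norm_num) (-(1 / 4))
  have h3 := stdGaussian_exp_norm_sq_tail (d := d) (a := 1 / 4) (by norm_num) (1 / 2)
  have hl2 := Real.log_two_gt_d9
  have hl2' := Real.log_two_lt_d9
  have hs : √(2 : ℝ) = Real.exp (Real.log 2 / 2) := by
    rw [Real.sqrt_eq_rpow, Real.rpow_def_of_pos (by norm_num)]
    congr 1; ring
  have e : Real.exp (-(d / 16 : ℝ)) = Real.exp (-(1 / 16)) ^ d := by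
    rw [← Real.exp_nat_mul]; congr 1; ring
  have h4 : (Real.exp (- -(1 / 4)) * (√(1 - 2 * -(1 / 2)))⁻¹) ≤ Real.exp (-(1 / 16)) := by
    rw [show (1 : ℝ) - 2 * -(1 / 2) = 2 by norm_num, hs, ← Real.exp_neg, ← Real.exp_add]
    exact Real.exp_le_exp.2 (by linarith)
  have h5 : (Real.exp (-(1 / 2)) * (√(1 - 2 * (1 / 4)))⁻¹) ≤ Real.exp (-(1 / 16)) := by
    rw [show (1 : ℝ) - 2 * (1 / 4) = 2⁻¹ by norm_num, Real.sqrt_inv, inv_inv, hs, ← Real.exp_add]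
    exact Real.exp_le_exp.2 (by linarith)
  have h6 := pow_le_pow_left₀ (by positivity) h4 d
  have h7 := pow_le_pow_left₀ (by positivity) h5 d
  rw [e]
  linarith

/-- Many of `m` independent Gaussian vectors have a nonnegative inner product with `v`. -/
lemma gaussianPatch_count_tail (m : ℕ) (σ : ℝ) (v : Patch d) :
    (Measure.pi fun _ : Fin m => gaussianPatch d σ).real
      {w | (({r | 0 ≤ inner ℝ (w r) v} : Finset (Fin m)).card : ℝ) < m / 4} ≤
      Real.exp (-(m / 16 : ℝ)) := by
  classical
  -- Chernoff's bound with parameter `-1`: as the event has probability at least `1/2`, the mean of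
  -- `g` is at most `11/16 ≤ e^{-5/16}`, and the threshold `m/4` leaves `e^{-m/16}`.
  set g : Patch d → ℝ := fun x => Real.exp (-(if 0 ≤ inner ℝ x v then 1 else 0)) with hg
  have hmeas : MeasurableSet {x : Patch d | 0 ≤ inner ℝ x v} :=
    measurableSet_le measurable_const (by fun_prop)
  have hint : ∫ x, g x ∂gaussianPatch d σ ≤ Real.exp (-(5 / 16)) := by
    have h1 : ∀ x, g x = 1 - (1 - Real.exp (-1)) *
        Set.indicator {x : Patch d | 0 ≤ inner ℝ x v} (fun _ => 1) x := by
      intro x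
      by_cases hx : 0 ≤ inner ℝ x v <;> simp [hg, hx]
    simp only [h1]
    rw [integral_sub (integrable_const _) (((integrable_const _).indicator hmeas).const_mul _),
      integral_const_mul, integral_indicator hmeas]
    simp only [integral_const, smul_eq_mul, mul_one, measureReal_restrict_apply MeasurableSet.univ,
      Set.univ_inter, probReal_univ]
    have h2 := half_le_gaussianPatch_inner_nonneg σ v
    have h3 : Real.exp (-1) ≤ 0.375 := by
      rw [Real.exp_neg]
      have := Real.exp_one_gt_d9
      rw [inv_le_comm₀ (by positivity) (by norm_num)]
      linarith
    have h4 := Real.add_one_le_exp (-(5 / 16 : ℝ))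
    nlinarith
  have hprod : ∀ w : Fin m → Patch d, ∏ r, g (w r) =
      Real.exp (-(({r | 0 ≤ inner ℝ (w r) v} : Finset (Fin m)).card : ℝ)) := by
    intro w
    rw [← Real.exp_sum, Finset.sum_neg_distrib, Finset.card_filter]
    push_cast
    rfl
  have hI : ∫ w : Fin m → Patch d, ∏ r, g (w r) ∂(Measure.pi fun _ => gaussianPatch d σ) =
      (∫ x, g x ∂gaussianPatch d σ) ^ m := by
    rw [integral_fintype_prod_eq_pow g, Fintype.card_fin]
  have hgm : Measurable g := by
    refine Real.measurable_exp.comp (Measurable.neg ?_)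
    exact Measurable.ite hmeas measurable_const measurable_const
  have hbound : Integrable (fun w : Fin m → Patch d => ∏ r, g (w r))
      (Measure.pi fun _ => gaussianPatch d σ) := by
    refine Integrable.of_bound (C := 1) ?_ (Filter.Eventually.of_forall fun w => ?_)
    · exact (Finset.measurable_prod _ fun r _ =>
        hgm.comp (measurable_pi_apply r)).aestronglyMeasurable
    · rw [hprod, Real.norm_of_nonneg (Real.exp_pos _).le, Real.exp_le_one_iff]
      simp
  have h1 := mul_meas_ge_le_integral_of_nonneg
    (Filter.Eventually.of_forall fun w => Finset.prod_nonneg fun r _ => (Real.exp_pos _).le)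
    hbound (Real.exp (-(m / 4 : ℝ)))
  rw [hI] at h1
  have h2 : (∫ x, g x ∂gaussianPatch d σ) ^ m ≤ Real.exp (-(5 / 16)) ^ m :=
    pow_le_pow_left₀ (integral_nonneg fun x => (Real.exp_pos _).le) hint m
  have h3 : {w : Fin m → Patch d |
      (({r | 0 ≤ inner ℝ (w r) v} : Finset (Fin m)).card : ℝ) < m / 4} ⊆
      {w | Real.exp (-(m / 4 : ℝ)) ≤ ∏ r, g (w r)} := by
    intro w hw
    simp only [Set.mem_ofPred_eq] at hw ⊢
    rw [hprod]
    exact Real.exp_le_exp.2 (by linarith)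
  refine (measureReal_mono h3).trans ?_
  have h4 := h1.trans h2
  rw [mul_comm, ← le_div_iff₀ (Real.exp_pos _)] at h4
  refine h4.trans (le_of_eq ?_)
  rw [← Real.exp_nat_mul, ← Real.exp_sub]
  congr 1
  ring

/-- A bound on all sections bounds the measure of a subset of a product. -/
lemma prod_real_le_of_section_le {α β : Type*} [MeasurableSpace α] [MeasurableSpace β]
    {P : Measure α} {Q : Measure β} [IsProbabilityMeasure P] [IsProbabilityMeasure Q]
    {S : Set (α × β)} (hS : MeasurableSet S) {q : ℝ}
    (h : ∀ b, P.real {a | (a, b) ∈ S} ≤ q) : (P.prod Q).real S ≤ q := by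
  have hq : 0 ≤ q := measureReal_nonneg.trans (h (Classical.choice Q.nonempty_of_neZero))
  rw [measureReal_def, Measure.prod_apply_symm hS]
  refine ENNReal.toReal_le_of_le_ofReal hq ?_
  calc _ ≤ ∫⁻ _ : β, ENNReal.ofReal q ∂Q := by
        refine lintegral_mono fun b => ?_
        rw [← ENNReal.ofReal_toReal (measure_ne_top P _)]
        exact ENNReal.ofReal_le_ofReal (h b)
    _ = _ := by simp

/-- The inner product of two independent Gaussian vectors is small, unless one of them is large. -/
lemma gaussianPatch_prod_tail {σ σ' N s : ℝ} (hσ : 0 < σ) (hN : 0 < N) (hs : 0 ≤ s) :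
    ((gaussianPatch d σ).prod (gaussianPatch d σ')).real
      {p | s ≤ |inner ℝ p.1 p.2| ∧ ‖p.2‖ ^ 2 ≤ N} ≤
      2 * Real.exp (-(s ^ 2 / (2 * (σ ^ 2 * N)))) := by
  refine prod_real_le_of_section_le ?_ fun b => ?_
  · have h1 : Measurable fun p : Patch d × Patch d => |inner ℝ p.1 p.2| := by fun_prop
    have h2 : Measurable fun p : Patch d × Patch d => ‖p.2‖ ^ 2 := by fun_prop
    exact (measurableSet_le measurable_const h1).inter (measurableSet_le h2 measurable_const)
  · by_cases hb : ‖b‖ ^ 2 ≤ N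
    · simp only [Set.mem_ofPred_eq, hb, and_true]
      exact gaussianPatch_inner_tail (by positivity) (by gcongr) hs
    · simp only [Set.mem_ofPred_eq, hb, and_false, Set.ofPred_false, measureReal_empty]
      positivity

end Gaussian

/-! ### The good event -/

section Event

variable {n m d : ℕ} {σ0 σξ : ℝ}

instance isProbabilityMeasure_trainLaw (n m d : ℕ) (σ0 σξ : ℝ) :
    IsProbabilityMeasure (trainLaw n m d σ0 σξ) := by
  unfold trainLaw; infer_instance

lemma measurePreserving_noise (i : Fin n) : MeasurePreserving
    (fun p : Weights m d × (Fin n → Patch d) => p.2 i) (trainLaw n m d σ0 σξ)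
    (gaussianPatch d σξ) :=
  (measurePreserving_eval (fun _ : Fin n => gaussianPatch d σξ) i).comp measurePreserving_snd

lemma measurePreserving_eval_eval (j : ℤˣ) (r : Fin m) : MeasurePreserving
    (fun w : Weights m d => w j r)
    (Measure.pi fun _ : ℤˣ => Measure.pi fun _ : Fin m => gaussianPatch d σ0)
    (gaussianPatch d σ0) :=
  (measurePreserving_eval (fun _ : Fin m => gaussianPatch d σ0) r).comp
    (measurePreserving_eval (fun _ : ℤˣ => Measure.pi fun _ : Fin m => gaussianPatch d σ0) j)

lemma measurePreserving_init (j : ℤˣ) (r : Fin m) : MeasurePreserving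
    (fun p : Weights m d × (Fin n → Patch d) => p.1 j r) (trainLaw n m d σ0 σξ)
    (gaussianPatch d σ0) :=
  (measurePreserving_eval_eval j r).comp measurePreserving_fst

lemma measurePreserving_init_noise (j : ℤˣ) (r : Fin m) (i : Fin n) : MeasurePreserving
    (fun p : Weights m d × (Fin n → Patch d) => (p.1 j r, p.2 i)) (trainLaw n m d σ0 σξ)
    ((gaussianPatch d σ0).prod (gaussianPatch d σξ)) :=
  (measurePreserving_eval_eval j r).prod
    (measurePreserving_eval (fun _ : Fin n => gaussianPatch d σξ) i)

lemma measurePreserving_branch_noise (j : ℤˣ) (i : Fin n) : MeasurePreserving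
    (fun p : Weights m d × (Fin n → Patch d) => (p.1 j, p.2 i)) (trainLaw n m d σ0 σξ)
    ((Measure.pi fun _ : Fin m => gaussianPatch d σ0).prod (gaussianPatch d σξ)) :=
  (measurePreserving_eval (fun _ : ℤˣ => Measure.pi fun _ : Fin m => gaussianPatch d σ0) j).prod
    (measurePreserving_eval (fun _ : Fin n => gaussianPatch d σξ) i)

lemma measurePreserving_noise_noise {i k : Fin n} (h : i ≠ k) : MeasurePreserving
    (fun p : Weights m d × (Fin n → Patch d) => (p.2 i, p.2 k)) (trainLaw n m d σ0 σξ)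
    ((gaussianPatch d σξ).prod (gaussianPatch d σξ)) := by
  have h1 : MeasurePreserving (fun w : Fin n → Patch d => (w i, w k))
      (Measure.pi fun _ : Fin n => gaussianPatch d σξ)
      ((gaussianPatch d σξ).prod (gaussianPatch d σξ)) := by
    refine ⟨by fun_prop, ?_⟩
    have h2 := (iIndepFun_pi (μ := fun _ : Fin n => gaussianPatch d σξ)
      (X := fun _ x => x) fun _ => aemeasurable_id).indepFun h
    rw [indepFun_iff_map_prod_eq_prod_map_map (measurable_pi_apply i).aemeasurable
      (measurable_pi_apply k).aemeasurable] at h2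
    rw [h2]
    congr 1
    · exact (measurePreserving_eval (fun _ : Fin n => gaussianPatch d σξ) i).map_eq
    · exact (measurePreserving_eval (fun _ : Fin n => gaussianPatch d σξ) k).map_eq
  exact h1.comp measurePreserving_snd

lemma measureReal_iUnion_le_card_mul {α β : Type*} [MeasurableSpace α] [Fintype β] {P : Measure α}
    {f : β → Set α} {q : ℝ} (h : ∀ b, P.real (f b) ≤ q) :
    P.real (⋃ b, f b) ≤ Fintype.card β * q := by
  refine (measureReal_iUnion_fintype_le f).trans ((Finset.sum_le_sum fun b _ => h b).trans ?_)
  simp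

lemma measurableSet_count_lt (m d : ℕ) : MeasurableSet {p : (Fin m → Patch d) × Patch d |
    (({r | 0 ≤ inner ℝ (p.1 r) p.2} : Finset (Fin m)).card : ℝ) < m / 4} := by
  classical
  refine measurableSet_lt ?_ measurable_const
  simp only [Finset.card_filter, Nat.cast_sum]
  refine Finset.measurable_sum _ fun r _ => ?_
  have h1 : Measurable fun p : (Fin m → Patch d) × Patch d => (inner ℝ (p.1 r) p.2 : ℝ) := by
    fun_prop
  have h2 : MeasurableSet {p : (Fin m → Patch d) × Patch d | 0 ≤ (inner ℝ (p.1 r) p.2 : ℝ)} :=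
    measurableSet_le measurable_const h1
  simp only [Nat.cast_ite, Nat.cast_one, Nat.cast_zero]
  exact Measurable.ite h2 measurable_const measurable_const

/-- With high probability the training noise is nearly orthogonal, the initialization is small, and
each sample has many active neurons. -/
theorem exists_good_event (yt : Fin n → ℤˣ) {μ : Patch d} (hμ : μ ≠ 0) (hσ0 : 0 < σ0)
    (hσξ : 0 < σξ) (hd : 0 < d) {b ν : ℝ} (hb : 0 ≤ b) (hν : 0 ≤ ν) :
    ∃ E : Set (Weights m d × (Fin n → Patch d)), MeasurableSet E ∧
      1 - (n * (2 * Real.exp (-(d / 16 : ℝ))) + 2 * m * (2 * Real.exp (-(d / 16 : ℝ))) +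
        n * n * (2 * Real.exp (-(b ^ 2 / (2 * (σξ ^ 2 * (2 * (σξ ^ 2 * d))))))) +
        n * (2 * Real.exp (-(b ^ 2 / (2 * (σξ ^ 2 * ‖μ‖ ^ 2))))) +
        2 * m * n * (2 * Real.exp (-(ν ^ 2 / (2 * (σ0 ^ 2 * (2 * (σξ ^ 2 * d))))))) +
        2 * m * (2 * Real.exp (-(ν ^ 2 / (2 * (σ0 ^ 2 * ‖μ‖ ^ 2))))) +
        n * Real.exp (-(m / 16 : ℝ))) ≤ (trainLaw n m d σ0 σξ).real E ∧
      ∀ W₀ ξ, (W₀, ξ) ∈ E →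
        (∀ i, σξ ^ 2 * d / 2 ≤ ‖ξ i‖ ^ 2 ∧ ‖ξ i‖ ^ 2 ≤ 2 * (σξ ^ 2 * d)) ∧
        (∀ j r, ‖W₀ j r‖ ^ 2 ≤ 2 * (σ0 ^ 2 * d)) ∧
        (∀ i k, i ≠ k → |inner ℝ (ξ i) (ξ k)| ≤ b) ∧
        (∀ i, |inner ℝ μ (ξ i)| ≤ b) ∧
        (∀ j r i, |inner ℝ (W₀ j r) (ξ i)| ≤ ν) ∧
        (∀ j r, |inner ℝ (W₀ j r) μ| ≤ ν) ∧
        (∀ i, (m : ℝ) / 4 ≤ ({r | 0 ≤ inner ℝ (W₀ (yt i) r) (ξ i)} : Finset (Fin m)).card) := by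
  set P := trainLaw n m d σ0 σξ with hP
  have hd' : (0 : ℝ) < d := by exact_mod_cast hd
  have hμ' : 0 < ‖μ‖ := norm_pos_iff.2 hμ
  have hprod : ∀ (s N : ℝ), MeasurableSet {p : Patch d × Patch d |
      s ≤ |inner ℝ p.1 p.2| ∧ ‖p.2‖ ^ 2 ≤ N} := by
    intro s N
    have h1 : Measurable fun p : Patch d × Patch d => |inner ℝ p.1 p.2| := by fun_prop
    have h2 : Measurable fun p : Patch d × Patch d => ‖p.2‖ ^ 2 := by fun_prop
    exact (measurableSet_le measurable_const h1).inter (measurableSet_le h2 measurable_const)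
  have hlin : ∀ s : ℝ, MeasurableSet {x : Patch d | s ≤ |inner ℝ x μ|} := by
    intro s
    have h1 : Measurable fun x : Patch d => |inner ℝ x μ| := by fun_prop
    exact measurableSet_le measurable_const h1
  have hnorm : ∀ σ : ℝ, MeasurableSet {x : Patch d |
      ¬ (σ ^ 2 * d / 2 ≤ ‖x‖ ^ 2 ∧ ‖x‖ ^ 2 ≤ 2 * (σ ^ 2 * d))} := by
    intro σ; measurability
  let S₁ : Fin n → Set (Weights m d × (Fin n → Patch d)) := fun i =>
    {p | ¬ (σξ ^ 2 * d / 2 ≤ ‖p.2 i‖ ^ 2 ∧ ‖p.2 i‖ ^ 2 ≤ 2 * (σξ ^ 2 * d))}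
  let S₂ : ℤˣ × Fin m → Set (Weights m d × (Fin n → Patch d)) := fun q =>
    {p | ¬ (σ0 ^ 2 * d / 2 ≤ ‖p.1 q.1 q.2‖ ^ 2 ∧ ‖p.1 q.1 q.2‖ ^ 2 ≤ 2 * (σ0 ^ 2 * d))}
  -- The norm condition makes the Gaussian tail uniform once one vector is fixed. It costs nothing,
  -- because `S₁` already excludes large norms.
  let S₃ : Fin n × Fin n → Set (Weights m d × (Fin n → Patch d)) := fun q =>
    {p | q.1 ≠ q.2 ∧ b ≤ |inner ℝ (p.2 q.1) (p.2 q.2)| ∧ ‖p.2 q.2‖ ^ 2 ≤ 2 * (σξ ^ 2 * d)}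
  let S₄ : Fin n → Set (Weights m d × (Fin n → Patch d)) := fun i =>
    {p | b ≤ |inner ℝ (p.2 i) μ|}
  let S₅ : (ℤˣ × Fin m) × Fin n → Set (Weights m d × (Fin n → Patch d)) := fun q =>
    {p | ν ≤ |inner ℝ (p.1 q.1.1 q.1.2) (p.2 q.2)| ∧ ‖p.2 q.2‖ ^ 2 ≤ 2 * (σξ ^ 2 * d)}
  let S₆ : ℤˣ × Fin m → Set (Weights m d × (Fin n → Patch d)) := fun q =>
    {p | ν ≤ |inner ℝ (p.1 q.1 q.2) μ|}
  let S₇ : Fin n → Set (Weights m d × (Fin n → Patch d)) := fun i =>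
    {p | (({r | 0 ≤ inner ℝ (p.1 (yt i) r) (p.2 i)} : Finset (Fin m)).card : ℝ) < m / 4}
  have hcardU : (Fintype.card (ℤˣ × Fin m) : ℝ) = 2 * m := by simp
  have b₁ : P.real (⋃ i, S₁ i) ≤ n * (2 * Real.exp (-(d / 16 : ℝ))) := by
    have := measureReal_iUnion_le_card_mul (P := P) (f := S₁) fun i =>
      ((measurePreserving_noise i).measureReal_preimage (hnorm σξ).nullMeasurableSet).le.trans
        (gaussianPatch_norm_sq_tail hσξ)
    rwa [Fintype.card_fin] at this
  have b₂ : P.real (⋃ q, S₂ q) ≤ 2 * m * (2 * Real.exp (-(d / 16 : ℝ))) := by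
    have := measureReal_iUnion_le_card_mul (P := P) (f := S₂) fun q =>
      ((measurePreserving_init q.1 q.2).measureReal_preimage
        (hnorm σ0).nullMeasurableSet).le.trans (gaussianPatch_norm_sq_tail hσ0)
    rwa [hcardU] at this
  have b₃ : P.real (⋃ q, S₃ q) ≤
      n * n * (2 * Real.exp (-(b ^ 2 / (2 * (σξ ^ 2 * (2 * (σξ ^ 2 * d))))))) := by
    have := measureReal_iUnion_le_card_mul (P := P) (f := S₃) (q :=
      2 * Real.exp (-(b ^ 2 / (2 * (σξ ^ 2 * (2 * (σξ ^ 2 * d))))))) fun q => by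
        by_cases hq : q.1 = q.2
        · have : S₃ q = ∅ := by
            ext p; simp [S₃, hq]
          rw [this, measureReal_empty]
          positivity
        · have : S₃ q = (fun p : Weights m d × (Fin n → Patch d) => (p.2 q.1, p.2 q.2)) ⁻¹'
              {p | b ≤ |inner ℝ p.1 p.2| ∧ ‖p.2‖ ^ 2 ≤ 2 * (σξ ^ 2 * d)} := by
            ext p; simp [S₃, hq]
          rw [this, hP, (measurePreserving_noise_noise hq).measureReal_preimage
            (hprod _ _).nullMeasurableSet]
          exact gaussianPatch_prod_tail hσξ (by positivity) hb
    simpa using this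
  have b₄ : P.real (⋃ i, S₄ i) ≤
      n * (2 * Real.exp (-(b ^ 2 / (2 * (σξ ^ 2 * ‖μ‖ ^ 2))))) := by
    have := measureReal_iUnion_le_card_mul (P := P) (f := S₄) fun i =>
      ((measurePreserving_noise i).measureReal_preimage (hlin b).nullMeasurableSet).le.trans
        (gaussianPatch_inner_tail (V := σξ ^ 2 * ‖μ‖ ^ 2) (by positivity) le_rfl hb)
    rwa [Fintype.card_fin] at this
  have b₅ : P.real (⋃ q, S₅ q) ≤
      2 * m * n * (2 * Real.exp (-(ν ^ 2 / (2 * (σ0 ^ 2 * (2 * (σξ ^ 2 * d))))))) := by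
    have := measureReal_iUnion_le_card_mul (P := P) (f := S₅) fun q =>
      ((measurePreserving_init_noise q.1.1 q.1.2 q.2).measureReal_preimage
        (hprod ν (2 * (σξ ^ 2 * d))).nullMeasurableSet).le.trans
        (gaussianPatch_prod_tail hσ0 (by positivity) hν)
    rw [Fintype.card_prod, Nat.cast_mul, hcardU, Fintype.card_fin] at this
    exact this
  have b₆ : P.real (⋃ q, S₆ q) ≤
      2 * m * (2 * Real.exp (-(ν ^ 2 / (2 * (σ0 ^ 2 * ‖μ‖ ^ 2))))) := by
    have := measureReal_iUnion_le_card_mul (P := P) (f := S₆) fun q =>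
      ((measurePreserving_init q.1 q.2).measureReal_preimage (hlin ν).nullMeasurableSet).le.trans
        (gaussianPatch_inner_tail (V := σ0 ^ 2 * ‖μ‖ ^ 2) (by positivity) le_rfl hν)
    rwa [hcardU] at this
  have b₇ : P.real (⋃ i, S₇ i) ≤ n * Real.exp (-(m / 16 : ℝ)) := by
    have := measureReal_iUnion_le_card_mul (P := P) (f := S₇) fun i =>
      ((measurePreserving_branch_noise (yt i) i).measureReal_preimage
        (measurableSet_count_lt m d).nullMeasurableSet).le.trans
        (prod_real_le_of_section_le (measurableSet_count_lt m d)
          fun v => gaussianPatch_count_tail m σ0 v)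
    rwa [Fintype.card_fin] at this
  set bad := (⋃ i, S₁ i) ∪ (⋃ q, S₂ q) ∪ (⋃ q, S₃ q) ∪ (⋃ i, S₄ i) ∪ (⋃ q, S₅ q) ∪
    (⋃ q, S₆ q) ∪ (⋃ i, S₇ i) with hbad
  -- The measurable hull has the same measure as `bad`, so the measurability of `bad` itself need
  -- not be checked.
  refine ⟨(toMeasurable P bad)ᶜ, (measurableSet_toMeasurable _ _).compl, ?_, ?_⟩
  · rw [probReal_compl_eq_one_sub (measurableSet_toMeasurable _ _), measureReal_def P,
      measure_toMeasurable, ← measureReal_def]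
    have u₁ := measureReal_union_le (μ := P) (⋃ i, S₁ i) (⋃ q, S₂ q)
    have u₂ := measureReal_union_le (μ := P) ((⋃ i, S₁ i) ∪ (⋃ q, S₂ q)) (⋃ q, S₃ q)
    have u₃ := measureReal_union_le (μ := P)
      ((⋃ i, S₁ i) ∪ (⋃ q, S₂ q) ∪ (⋃ q, S₃ q)) (⋃ i, S₄ i)
    have u₄ := measureReal_union_le (μ := P)
      ((⋃ i, S₁ i) ∪ (⋃ q, S₂ q) ∪ (⋃ q, S₃ q) ∪ (⋃ i, S₄ i)) (⋃ q, S₅ q)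
    have u₅ := measureReal_union_le (μ := P)
      ((⋃ i, S₁ i) ∪ (⋃ q, S₂ q) ∪ (⋃ q, S₃ q) ∪ (⋃ i, S₄ i) ∪ (⋃ q, S₅ q)) (⋃ q, S₆ q)
    have u₆ := measureReal_union_le (μ := P) ((⋃ i, S₁ i) ∪ (⋃ q, S₂ q) ∪ (⋃ q, S₃ q) ∪
      (⋃ i, S₄ i) ∪ (⋃ q, S₅ q) ∪ (⋃ q, S₆ q)) (⋃ i, S₇ i)
    linarith
  · intro W₀ ξ hE
    have hnb : (W₀, ξ) ∉ bad := fun h => hE (subset_toMeasurable _ _ h)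
    simp only [hbad, Set.mem_union, Set.mem_iUnion, not_or, not_exists] at hnb
    obtain ⟨⟨⟨⟨⟨⟨n₁, n₂⟩, n₃⟩, n₄⟩, n₅⟩, n₆⟩, n₇⟩ := hnb
    have m₁ : ∀ i, σξ ^ 2 * d / 2 ≤ ‖ξ i‖ ^ 2 ∧ ‖ξ i‖ ^ 2 ≤ 2 * (σξ ^ 2 * d) :=
      fun i => not_not.1 (n₁ i)
    refine ⟨m₁, fun j r => (not_not.1 (n₂ (j, r))).2, fun i k hik => ?_, fun i => ?_,
      fun j r i => ?_, fun j r => ?_, fun i => not_lt.1 (n₇ i)⟩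
    · by_contra h
      exact n₃ (i, k) ⟨hik, (not_le.1 h).le, (m₁ k).2⟩
    · rw [real_inner_comm]
      exact (not_le.1 (n₄ i)).le
    · by_contra h
      exact n₅ ((j, r), i) ⟨(not_le.1 h).le, (m₁ i).2⟩
    · exact (not_le.1 (n₆ (j, r))).le

end Event

/-! ### The test error -/

section Test

variable {n m d : ℕ}

lemma abs_branch_sub_le (W : Weights m d) (j : ℤˣ) (u v ζ : Patch d) :
    |branch W j (u, v + ζ) - branch W j (u, v)| ≤ 1 / m * ∑ r, |inner ℝ ζ (W j r)| := by
  unfold branch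
  rw [← mul_sub, ← Finset.sum_sub_distrib, abs_mul, abs_of_nonneg (by positivity)]
  gcongr
  refine (Finset.abs_sum_le_sum_abs _ _).trans (Finset.sum_le_sum fun r _ => ?_)
  rw [add_sub_add_left_eq_sub]
  refine (abs_relu_sub_relu_le _ _).trans (le_of_eq ?_)
  rw [inner_add_right, add_sub_cancel_left, real_inner_comm]

/-- The average size of the response of the neurons to a perturbation. -/
def response (W : Weights m d) (ζ : Patch d) : ℝ :=
  1 / m * ∑ r, |inner ℝ ζ (W 1 r)| + 1 / m * ∑ r, |inner ℝ ζ (W (-1) r)|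

lemma measurable_response (W : Weights m d) : Measurable (response W) := by
  unfold response; fun_prop

lemma abs_net_sub_le (W : Weights m d) (u v ζ : Patch d) :
    |net W (u, v + ζ) - net W (u, v)| ≤ response W ζ := by
  have h1 := abs_le.1 (abs_branch_sub_le W 1 u v ζ)
  have h2 := abs_le.1 (abs_branch_sub_le W (-1) u v ζ)
  unfold net response
  rw [abs_le]
  constructor <;> linarith

/-- Jensen's inequality. It avoids a union bound over the neurons, so the tail of the response does
not depend on `m`. -/
lemma exp_avg_le (hm : 0 < m) (f : Fin m → ℝ) :
    Real.exp (1 / m * ∑ r, f r) ≤ 1 / m * ∑ r, Real.exp (f r) := by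
  have hm' : (0 : ℝ) < m := by exact_mod_cast hm
  have := convexOn_exp.map_sum_le (t := Finset.univ) (w := fun _ : Fin m => 1 / (m : ℝ)) (p := f)
    (fun _ _ => by positivity) (by simp; field_simp) (fun _ _ => Set.mem_univ _)
  simpa only [smul_eq_mul, ← Finset.mul_sum] using this

/-- The response to Gaussian noise is small if the weights are. -/
lemma response_tail (hn : 0 < n) (hm : 0 < m) {σ : ℝ} {W : Weights m d}
    (hW : ∀ j r, σ ^ 2 * ‖W j r‖ ^ 2 ≤ 1 / (16 * n)) :
    (gaussianPatch d σ).real {ζ | 1 ≤ response W ζ} ≤ Real.exp (-(n : ℝ)) := by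
  have hn' : (0 : ℝ) < n := by exact_mod_cast hn
  have hm' : (0 : ℝ) < m := by exact_mod_cast hm
  -- The response is twice the mean of its two branches, so `8n` here bounds the exponential moment
  -- of the response at `4n`. Variance `1/(16n)` gives the moment `2e^{2n}`, and `2e^{2n - 4n} ≤
  -- e^{-n}`.
  set g : ℤˣ → Patch d → ℝ := fun j ζ => 1 / m * ∑ r, Real.exp (8 * n * |inner ℝ ζ (W j r)|) with hg
  have hgint : ∀ j, Integrable (g j) (gaussianPatch d σ) := fun j =>
    (integrable_finsetSum _ fun r _ => integrable_exp_abs_inner σ (W j r) (8 * n)).const_mul _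
  have hgle : ∀ j, ∫ ζ, g j ζ ∂gaussianPatch d σ ≤ 2 * Real.exp (2 * n) := by
    intro j
    simp only [hg]
    rw [integral_const_mul,
      integral_finsetSum _ fun r _ => integrable_exp_abs_inner σ (W j r) (8 * n)]
    calc _ ≤ 1 / (m : ℝ) * ∑ r : Fin m, 2 * Real.exp (2 * n) := by
          gcongr with r
          refine (integral_exp_abs_inner_le (hW j r) (8 * n)).trans (le_of_eq ?_)
          congr 2
          field_simp
          norm_num
      _ = _ := by simp; field_simp
  have hpt : ∀ ζ, Real.exp (4 * n * response W ζ) ≤ 1 / 2 * (g 1 ζ + g (-1) ζ) := by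
    intro ζ
    have h1 : ∀ j, Real.exp (1 / m * ∑ r, 8 * n * |inner ℝ ζ (W j r)|) ≤ g j ζ := fun j =>
      exp_avg_le hm _
    have h2 := convexOn_exp.2 (Set.mem_univ (1 / m * ∑ r, 8 * n * |inner ℝ ζ (W 1 r)|))
      (Set.mem_univ (1 / m * ∑ r, 8 * n * |inner ℝ ζ (W (-1) r)|))
      (show (0 : ℝ) ≤ 1 / 2 by norm_num) (show (0 : ℝ) ≤ 1 / 2 by norm_num) (by norm_num)
    simp only [smul_eq_mul] at h2
    have h3 : 4 * n * response W ζ = 1 / 2 * (1 / m * ∑ r, 8 * n * |inner ℝ ζ (W 1 r)|) +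
        1 / 2 * (1 / m * ∑ r, 8 * n * |inner ℝ ζ (W (-1) r)|) := by
      unfold response
      simp only [← Finset.mul_sum]
      ring
    rw [h3]
    linarith [h1 1, h1 (-1)]
  have h1 := mul_meas_ge_le_integral_of_nonneg (μ := gaussianPatch d σ)
    (f := fun ζ => 1 / 2 * (g 1 ζ + g (-1) ζ))
    (Filter.Eventually.of_forall fun ζ => (Real.exp_pos _).le.trans (hpt ζ))
    (((hgint 1).add (hgint (-1))).const_mul _) (Real.exp (4 * n))
  rw [integral_const_mul, integral_add (hgint 1) (hgint (-1))] at h1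
  have h2 : {ζ | 1 ≤ response W ζ} ⊆ {ζ | Real.exp (4 * n) ≤ 1 / 2 * (g 1 ζ + g (-1) ζ)} := by
    intro ζ hζ
    refine le_trans (Real.exp_le_exp.2 ?_) (hpt ζ)
    have : (1 : ℝ) ≤ response W ζ := hζ
    nlinarith
  refine (measureReal_mono h2).trans ?_
  have h3 : Real.exp (4 * n) *
      (gaussianPatch d σ).real {ζ | Real.exp (4 * n) ≤ 1 / 2 * (g 1 ζ + g (-1) ζ)} ≤
      2 * Real.exp (2 * n) := by linarith [hgle 1, hgle (-1)]
  rw [mul_comm, ← le_div_iff₀ (Real.exp_pos _)] at h3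
  refine h3.trans ?_
  rw [div_le_iff₀ (Real.exp_pos _), ← Real.exp_add]
  have h4 : -(n : ℝ) + 4 * n = n + 2 * n := by ring
  rw [h4, Real.exp_add]
  have h5 : 2 ≤ Real.exp n := by
    have h6 : (1 : ℝ) ≤ n := by exact_mod_cast hn
    linarith [Real.add_one_le_exp (n : ℝ)]
  gcongr

instance measurableSingletonClass_intUnits : MeasurableSingletonClass ℤˣ :=
  ⟨fun a => ⟨{(a : ℤ)}, measurableSet_singleton _, by ext b; simp [Units.ext_iff]⟩⟩

/-- Samples that are misclassified with a margin contribute to the test error. -/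
theorem card_le_testError (hn : 0 < n) {σ q : ℝ} {μ : Patch d} {ξ : Fin n → Patch d}
    {W : Weights m d} (hq : (gaussianPatch d σ).real {ζ | 1 ≤ response W ζ} ≤ q)
    (y : Fin n → ℤˣ) (S : Finset (Fin n))
    (hS : ∀ i ∈ S, lab (y i) * net W (lab (y i) • μ, ξ i) ≤ -1) :
    (S.card : ℝ) * (1 / 2 * (1 / n * (1 - q))) ≤ testError μ σ ξ W := by
  have : Nonempty (Fin n) := ⟨⟨0, hn⟩⟩
  set G := {ζ : Patch d | 1 ≤ response W ζ}ᶜ with hG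
  have hGm' : MeasurableSet {ζ : Patch d | 1 ≤ response W ζ} :=
    measurableSet_le measurable_const (measurable_response W)
  have hGm : MeasurableSet G := hGm'.compl
  have hGq : 1 - q ≤ (gaussianPatch d σ).real G := by
    rw [hG, probReal_compl_eq_one_sub hGm']
    linarith
  have hu : ∀ a : ℤˣ, (uniformOn (Set.univ : Set ℤˣ)).real {a} = 1 / 2 := by
    intro a
    rw [measureReal_def, uniformOn_univ, Measure.count_singleton]
    simp
  have hf : ∀ i : Fin n, (uniformOn (Set.univ : Set (Fin n))).real {i} = 1 / n := by
    intro a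
    rw [measureReal_def, uniformOn_univ, Measure.count_singleton]
    simp
  have : IsProbabilityMeasure (uniformOn (Set.univ : Set ℤˣ)) :=
    isProbabilityMeasure_uniformOn Set.finite_univ Set.univ_nonempty
  have : IsProbabilityMeasure (uniformOn (Set.univ : Set (Fin n))) :=
    isProbabilityMeasure_uniformOn Set.finite_univ Set.univ_nonempty
  have : IsProbabilityMeasure (testLaw n d σ) := by unfold testLaw; infer_instance
  -- The test label is drawn independently of the index and agrees with `y i` with probability
  -- `1/2`. The sets are disjoint because the index determines `i`.
  let T : Fin n → Set (ℤˣ × Fin n × Patch d) := fun i => {y i} ×ˢ ({i} ×ˢ G)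
  have hT : ∀ i, 1 / 2 * (1 / n * (1 - q)) ≤ (testLaw n d σ).real (T i) := by
    intro i
    rw [testLaw, measureReal_prod_prod, measureReal_prod_prod, hu, hf]
    gcongr
  calc (S.card : ℝ) * (1 / 2 * (1 / n * (1 - q))) = ∑ i ∈ S, 1 / 2 * (1 / n * (1 - q)) := by simp
    _ ≤ ∑ i ∈ S, (testLaw n d σ).real (T i) := Finset.sum_le_sum fun i _ => hT i
    _ = (testLaw n d σ).real (⋃ i ∈ S, T i) := by
        rw [measureReal_biUnion_finset]
        · intro i _ k _ hik
          rw [Function.onFun, Set.disjoint_left]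
          rintro p ⟨-, h1, -⟩ ⟨-, h2, -⟩
          exact hik (h1.symm.trans h2)
        · intro i _
          exact (measurableSet_singleton _).prod ((measurableSet_singleton _).prod hGm)
    _ ≤ _ := by
        refine measureReal_mono ?_
        intro p hp
        simp only [Set.mem_iUnion] at hp
        obtain ⟨i, hi, h1, h2, h3⟩ := hp
        simp only [Set.mem_singleton_iff] at h1 h2
        have h4 : response W p.2.2 < 1 := not_le.1 h3
        have h5 := hS i hi
        have h6 := abs_net_sub_le W (lab (y i) • μ) (ξ i) p.2.2
        have h7 : |lab (y i) * (net W (lab (y i) • μ, ξ i + p.2.2) -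
            net W (lab (y i) • μ, ξ i))| < 1 := by
          rw [abs_mul, abs_lab, one_mul]
          linarith
        have h8 := (abs_lt.1 h7).2
        change lab p.1 * net W (lab p.1 • μ, ξ p.2.1 + p.2.2) < 0
        rw [h1, h2]
        linarith

end Test

/-! ### Consequences of the label counts -/

namespace LabelCounts

variable {n : ℕ} {y yt : Fin n → ℤˣ} {τp τm : ℝ}

lemma card_noisy (hL : LabelCounts y yt τp τm) :
    (({i | yt i ≠ y i} : Finset (Fin n)).card : ℝ) = (τp + τm) * n / 2 := by
  have h1 : (({i | yt i ≠ y i} : Finset (Fin n)).card : ℝ) =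
      ({i | y i = 1 ∧ yt i ≠ y i} : Finset (Fin n)).card +
        ({i | y i = -1 ∧ yt i ≠ y i} : Finset (Fin n)).card := by
    simp only [Finset.card_filter, Nat.cast_sum, ← Finset.sum_add_distrib]
    refine Finset.sum_congr rfl fun i _ => ?_
    rcases Int.units_eq_one_or (y i) with h | h <;> simp [h]
  rw [h1, hL.pos_noisy, hL.neg_noisy]
  ring

lemma populated (hL : LabelCounts y yt τp τm) {τ : ℝ} (hp : τ ≤ τp) (hm : τ ≤ τm)
    (hp' : τp ≤ 1 / 2) (hm' : τm ≤ 1 / 2) :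
    Populated y (fun i => yt i * y i) (τ / 2) := by
  have e1 : ∀ i, yt i * y i = 1 ↔ yt i = y i := fun i => by
    rcases Int.units_eq_one_or (y i) with h | h <;>
      rcases Int.units_eq_one_or (yt i) with h' | h' <;> simp [h, h']
  have e2 : ∀ i, yt i * y i = -1 ↔ yt i ≠ y i := fun i => by
    rcases Int.units_eq_one_or (y i) with h | h <;>
      rcases Int.units_eq_one_or (yt i) with h' | h' <;> simp [h, h']
  have hn : (0 : ℝ) ≤ n := n.cast_nonneg
  intro c σ
  rw [Fintype.card_fin]
  rcases Int.units_eq_one_or c with rfl | rfl <;> rcases Int.units_eq_one_or σ with rfl | rfl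
  · simp only [e1, hL.pos_clean]; nlinarith
  · simp only [e2, hL.pos_noisy]; nlinarith
  · simp only [e1, hL.neg_clean]; nlinarith
  · simp only [e2, hL.neg_noisy]; nlinarith

lemma four_le (hL : LabelCounts y yt τp τm) (hn : 0 < n) (hτ : 0 < τp) (hτ' : τp ≤ 1 / 2) :
    (4 : ℝ) ≤ n := by
  have hn' : (0 : ℝ) < n := by exact_mod_cast hn
  have h1 : (0 : ℝ) < ({i | y i = 1 ∧ yt i ≠ y i} : Finset (Fin n)).card := by
    rw [hL.pos_noisy]; positivity
  have h2 : (1 : ℝ) ≤ ({i | y i = 1 ∧ yt i ≠ y i} : Finset (Fin n)).card := by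
    exact_mod_cast (by exact_mod_cast h1 : 0 < _)
  rw [hL.pos_noisy] at h2
  nlinarith

/-- Unequal fractions of flipped labels differ by at least `2 / n`. -/
lemma two_min_add_le (hL : LabelCounts y yt τp τm) (hn : 0 < n) (hne : τp ≠ τm) :
    2 * min τp τm + 2 / n ≤ τp + τm := by
  have hn' : (0 : ℝ) < n := by exact_mod_cast hn
  have h1 := hL.pos_noisy
  have h2 := hL.neg_noisy
  set a := ({i | y i = 1 ∧ yt i ≠ y i} : Finset (Fin n)).card
  set b := ({i | y i = -1 ∧ yt i ≠ y i} : Finset (Fin n)).card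
  -- Both fractions are integer multiples of `2 / n`, so distinct ones differ by at least one such
  -- unit.
  have hp : τp = 2 / n * a := by rw [h1]; field_simp
  have hm : τm = 2 / n * b := by rw [h2]; field_simp
  have h2n : 0 < 2 / (n : ℝ) := by positivity
  rcases lt_or_gt_of_ne hne with h | h
  · rw [min_eq_left h.le]
    have h3 : (a : ℝ) < b := by
      rw [hp, hm] at h; exact lt_of_mul_lt_mul_left h h2n.le
    have h4 : (a : ℝ) + 1 ≤ b := by exact_mod_cast h3
    rw [hp, hm]
    nlinarith
  · rw [min_eq_right h.le]
    have h3 : (b : ℝ) < a := by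
      rw [hp, hm] at h; exact lt_of_mul_lt_mul_left h h2n.le
    have h4 : (b : ℝ) + 1 ≤ a := by exact_mod_cast h3
    rw [hp, hm]
    nlinarith

end LabelCounts

/-- Each count times its exponential is at most `δ / 100`; with the numerical factors the total is
`19δ / 100`. -/
lemma union_bound_le {n m δ e₁ e₂ e₃ e₄ e₅ e₆ : ℝ} (hn : 100 ≤ n) (hm : 100 ≤ m) (hδ : 0 < δ)
    (hδ1 : δ < 1) (y₁ : e₁ ≤ (δ / (n * m)) ^ 4) (y₂ : e₂ ≤ (δ / (n * m)) ^ 4)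
    (y₃ : e₃ ≤ (δ / (n * m)) ^ 4) (y₄ : e₄ ≤ (δ / (n * m)) ^ 4) (y₅ : e₅ ≤ (δ / m) ^ 2)
    (y₆ : e₆ ≤ (δ / n) ^ 2) :
    n * (2 * e₁) + 2 * m * (2 * e₁) + n * n * (2 * e₂) + n * (2 * e₃) + 2 * m * n * (2 * e₄) +
      2 * m * (2 * e₅) + n * e₆ ≤ δ := by
  have hm0 : 0 < m := by linarith
  have hn0 : 0 < n := by linarith
  set q := n * m with hq
  have hq0 : 0 < q := by positivity
  have hnq : n ≤ q := by nlinarith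
  have hmq : m ≤ q := by nlinarith
  have hX1 : q ^ 2 * (δ / q) ^ 4 ≤ δ / 100 := by
    have h1 : q ^ 2 * (δ / q) ^ 4 = δ ^ 4 / q ^ 2 := by field_simp
    rw [h1, div_le_div_iff₀ (by positivity) (by norm_num)]
    have h2 : δ ^ 4 ≤ δ := by
      have : δ ^ 3 ≤ 1 := pow_le_one₀ hδ.le hδ1.le
      nlinarith
    have h3 : (100 : ℝ) ≤ q ^ 2 := by nlinarith
    nlinarith
  have z : ∀ a : ℝ, 0 ≤ a → a ≤ q ^ 2 → ∀ e, e ≤ (δ / q) ^ 4 → a * e ≤ δ / 100 := by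
    intro a ha0 ha e he
    calc a * e ≤ a * (δ / q) ^ 4 := by gcongr
      _ ≤ q ^ 2 * (δ / q) ^ 4 := by gcongr
      _ ≤ _ := hX1
  have hqq : q ≤ q ^ 2 := by nlinarith
  have hsqδ : ∀ a : ℝ, 100 ≤ a → a * (δ / a) ^ 2 ≤ δ / 100 := by
    intro a ha
    have h1 : a * (δ / a) ^ 2 = δ ^ 2 / a := by
      have : a ≠ 0 := by linarith
      field_simp
    rw [h1, div_le_div_iff₀ (by linarith) (by norm_num)]
    nlinarith
  have z₁ := z n hn0.le (hnq.trans hqq) e₁ y₁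
  have z₂ := z m hm0.le (hmq.trans hqq) e₁ y₁
  have z₃ := z (n * n) (by positivity) (by nlinarith) e₂ y₂
  have z₄ := z n hn0.le (hnq.trans hqq) e₃ y₃
  have z₅ := z (m * n) (by positivity) (by rwa [mul_comm m n]) e₄ y₄
  have z₆ : m * e₅ ≤ δ / 100 := (mul_le_mul_of_nonneg_left y₅ hm0.le).trans (hsqδ m hm)
  have z₇ : n * e₆ ≤ δ / 100 := (mul_le_mul_of_nonneg_left y₆ hn0.le).trans (hsqδ n hn)
  linarith

/-! ### Consequences of the standing condition -/

namespace Condition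

variable {C c₁ c₂ τlo τhi Tstar : ℝ} {n m d : ℕ} {μ : Patch d} {σξ σ0 η τp τm δ : ℝ}

lemma n_pos (H : Condition C c₁ c₂ τlo τhi Tstar n m d μ σξ σ0 η τp τm δ) (hc : 0 < c₁) :
    0 < n := by
  rcases Nat.eq_zero_or_pos n with rfl | h
  · have := H.snr_mem.1
    simp at this
    linarith
  · exact h

lemma snr_pos (H : Condition C c₁ c₂ τlo τhi Tstar n m d μ σξ σ0 η τp τm δ) (hc : 0 < c₁) :
    0 < snr μ σξ ^ 2 := by
  have h1 := H.snr_mem.1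
  have hn : (0 : ℝ) < n := by exact_mod_cast H.n_pos hc
  by_contra h
  nlinarith

lemma d_pos (H : Condition C c₁ c₂ τlo τhi Tstar n m d μ σξ σ0 η τp τm δ) (hc : 0 < c₁) :
    0 < d := by
  rcases Nat.eq_zero_or_pos d with rfl | h
  · have := H.snr_pos hc
    simp [snr] at this
  · exact h

lemma μ_ne (H : Condition C c₁ c₂ τlo τhi Tstar n m d μ σξ σ0 η τp τm δ) (hc : 0 < c₁) :
    μ ≠ 0 := by
  rintro rfl
  have := H.snr_pos hc
  simp [snr] at this

lemma signal_bounds (H : Condition C c₁ c₂ τlo τhi Tstar n m d μ σξ σ0 η τp τm δ)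
    (hc : 0 < c₁) : c₁ * (σξ ^ 2 * d) ≤ n * ‖μ‖ ^ 2 ∧ n * ‖μ‖ ^ 2 ≤ c₂ * (σξ ^ 2 * d) := by
  have hσ := H.σξ_pos
  have hd : (0 : ℝ) < d := by exact_mod_cast H.d_pos hc
  have h0 : n * snr μ σξ ^ 2 = n * ‖μ‖ ^ 2 / (σξ ^ 2 * d) := by
    rw [snr, div_pow, mul_pow, Real.sq_sqrt hd.le, mul_div_assoc]
  obtain ⟨h1, h2⟩ := H.snr_mem
  rw [h0] at h1 h2
  rw [le_div_iff₀ (by positivity)] at h1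
  rw [div_le_iff₀ (by positivity)] at h2
  exact ⟨h1, h2⟩

lemma log_n_ge (H : Condition C c₁ c₂ τlo τhi Tstar n m d μ σξ σ0 η τp τm δ)
    (h4 : (4 : ℝ) ≤ n) : 1 ≤ Real.log (n / δ) := by
  have hδ := H.δ_pos
  have h1 : (4 : ℝ) ≤ n / δ := by
    rw [le_div_iff₀ hδ]; nlinarith [H.δ_lt]
  rw [Real.le_log_iff_exp_le (by linarith)]
  linarith [Real.exp_one_lt_d9]

lemma m_ge (H : Condition C c₁ c₂ τlo τhi Tstar n m d μ σξ σ0 η τp τm δ)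
    (h4 : (4 : ℝ) ≤ n) (hC : 0 ≤ C) : C ≤ m := by
  have h1 := mul_le_mul_of_nonneg_left (H.log_n_ge h4) hC
  linarith [H.width_large]

lemma log_m_ge (H : Condition C c₁ c₂ τlo τhi Tstar n m d μ σξ σ0 η τp τm δ)
    (h4 : (4 : ℝ) ≤ n) (hC : 100 ≤ C) : 1 ≤ Real.log (m / δ) := by
  have hδ := H.δ_pos
  have hm := H.m_ge h4 (by linarith)
  have h1 : (4 : ℝ) ≤ m / δ := by
    rw [le_div_iff₀ hδ]; nlinarith [H.δ_lt]
  rw [Real.le_log_iff_exp_le (by linarith)]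
  linarith [Real.exp_one_lt_d9]

lemma n_ge (H : Condition C c₁ c₂ τlo τhi Tstar n m d μ σξ σ0 η τp τm δ)
    (h4 : (4 : ℝ) ≤ n) (hC : 100 ≤ C) : C ≤ n := by
  have h1 := mul_le_mul_of_nonneg_left (H.log_m_ge h4 hC) (by linarith : 0 ≤ C)
  linarith [H.sample_large]

lemma log_nm_ge (H : Condition C c₁ c₂ τlo τhi Tstar n m d μ σξ σ0 η τp τm δ)
    (h4 : (4 : ℝ) ≤ n) (hC : 100 ≤ C) : 1 ≤ Real.log (n * m / δ) := by
  have hδ := H.δ_pos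
  have hm := H.m_ge h4 (by linarith)
  refine (H.log_n_ge h4).trans (Real.log_le_log (by positivity) ?_)
  gcongr
  nlinarith

/-- The effective step size is small. -/
lemma rate_le (H : Condition C c₁ c₂ τlo τhi Tstar n m d μ σξ σ0 η τp τm δ) (hc : 0 < c₁)
    (h4 : (4 : ℝ) ≤ n) (hC : 100 ≤ C) : C * (η * (σξ ^ 2 * d) / (n * m)) ≤ 1 := by
  have hσ := H.σξ_pos
  have hd : (0 : ℝ) < d := by exact_mod_cast H.d_pos hc
  have hm := H.m_ge h4 (by linarith)
  have h1 : η ≤ C⁻¹ * ((σξ ^ 2)⁻¹ * (d : ℝ)⁻¹ * n) :=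
    H.step_small.trans (by gcongr; exact min_le_right _ _)
  have hm0 : (0 : ℝ) < m := by linarith
  have hC0 : 0 < C := by linarith
  calc C * (η * (σξ ^ 2 * d) / (n * m)) ≤
        C * (C⁻¹ * ((σξ ^ 2)⁻¹ * (d : ℝ)⁻¹ * n) * (σξ ^ 2 * d) / (n * m)) := by gcongr
    _ = 1 / (m : ℝ) := by field_simp
    _ ≤ 1 := by rw [div_le_one hm0]; linarith

lemma d_ge (H : Condition C c₁ c₂ τlo τhi Tstar n m d μ σξ σ0 η τp τm δ) (hC : 100 ≤ C) :
    C * ((n : ℝ) ^ 2 * Real.log (n * m / δ) * Real.log Tstar ^ 2) ≤ d :=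
  le_trans (by gcongr; exact le_max_left _ _) H.dim_large

/-- The initialization is small compared to the noise. -/
lemma init_noise_small (H : Condition C c₁ c₂ τlo τhi Tstar n m d μ σξ σ0 η τp τm δ)
    (hc : 0 < c₁) (hC : 100 ≤ C) : C ^ 2 * (σ0 ^ 2 * (σξ ^ 2 * d)) * d ≤ n := by
  have hσ := H.σξ_pos
  have hσ0 := H.σ0_pos
  have hd : (0 : ℝ) < d := by exact_mod_cast H.d_pos hc
  have hC0 : 0 < C := by linarith
  have h1 : σ0 ≤ C⁻¹ * (√(n : ℝ) * σξ⁻¹ * (d : ℝ)⁻¹) :=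
    H.init_small.trans (by gcongr; exact min_le_left _ _)
  have h2 : σ0 ^ 2 ≤ (C⁻¹ * (√(n : ℝ) * σξ⁻¹ * (d : ℝ)⁻¹)) ^ 2 := by gcongr
  have h3 : (C⁻¹ * (√(n : ℝ) * σξ⁻¹ * (d : ℝ)⁻¹)) ^ 2 =
      C⁻¹ ^ 2 * (n * (σξ⁻¹) ^ 2 * ((d : ℝ)⁻¹) ^ 2) := by
    rw [mul_pow, mul_pow, mul_pow, Real.sq_sqrt n.cast_nonneg]
  rw [h3] at h2
  calc _ ≤ C ^ 2 * (C⁻¹ ^ 2 * (n * (σξ⁻¹) ^ 2 * ((d : ℝ)⁻¹) ^ 2) * (σξ ^ 2 * d)) * d := by gcongr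
    _ = n := by field_simp

/-- The initialization is small compared to the signal. -/
lemma init_signal_small (H : Condition C c₁ c₂ τlo τhi Tstar n m d μ σξ σ0 η τp τm δ)
    (hc : 0 < c₁) (h4 : (4 : ℝ) ≤ n) (hC : 100 ≤ C) :
    C ^ 2 * (σ0 ^ 2 * ‖μ‖ ^ 2) * Real.log (m / δ) ≤ 1 := by
  have hσ0 := H.σ0_pos
  have hC0 : 0 < C := by linarith
  have hμ : 0 < ‖μ‖ := norm_pos_iff.2 (H.μ_ne hc)
  have hl := H.log_m_ge h4 hC
  have h1 : σ0 ≤ C⁻¹ * (‖μ‖⁻¹ * (√(Real.log (m / δ)))⁻¹) :=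
    H.init_small.trans (by gcongr; exact min_le_right _ _)
  have h2 : σ0 ^ 2 ≤ (C⁻¹ * (‖μ‖⁻¹ * (√(Real.log (m / δ)))⁻¹)) ^ 2 := by gcongr
  have h3 : (C⁻¹ * (‖μ‖⁻¹ * (√(Real.log (m / δ)))⁻¹)) ^ 2 =
      C⁻¹ ^ 2 * (‖μ‖⁻¹ ^ 2 * (Real.log (m / δ))⁻¹) := by
    rw [mul_pow, mul_pow, inv_pow (√_), Real.sq_sqrt (by linarith)]
  rw [h3] at h2
  have hl0 : 0 < Real.log (m / δ) := by linarith
  calc _ ≤ C ^ 2 * (C⁻¹ ^ 2 * (‖μ‖⁻¹ ^ 2 * (Real.log (m / δ))⁻¹) * ‖μ‖ ^ 2) *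
        Real.log (m / δ) := by gcongr
    _ = 1 := by field_simp

/-- After cancellation the exponent is `ν²d / (4n²cΛ² log² T*)`. This is where the bound `d ≥ C n²
log(nm/δ) log² T*` is needed. -/
lemma noise_noise_exponent (H : Condition C c₁ c₂ τlo τhi Tstar n m d μ σξ σ0 η τp τm δ) (hc : 0 < c₁)
    (h4 : (4 : ℝ) ≤ n) (hC : 100 ≤ C) {ν cΛ : ℝ} (hcΛ : 1 ≤ cΛ)
    (hL : 1 ≤ Real.log Tstar) (hC₁ : 16 * cΛ ^ 2 ≤ C * ν ^ 2) {b : ℝ}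
    (hb : b = ν * (σξ ^ 2 * d) / (n * (cΛ * Real.log Tstar))) :
    4 * Real.log (n * m / δ) ≤ b ^ 2 / (2 * (σξ ^ 2 * (2 * (σξ ^ 2 * d)))) := by
  have hσ := H.σξ_pos
  have hσ0 := H.σ0_pos
  have hd : (0 : ℝ) < d := by exact_mod_cast H.d_pos hc
  have hμ : 0 < ‖μ‖ := norm_pos_iff.2 (H.μ_ne hc)
  have hn := H.n_ge h4 hC
  have hω := H.log_nm_ge h4 hC
  have hdge := H.d_ge hC
  have hn0 : (0 : ℝ) < n := by linarith
  have hC0 : 0 < C := by linarith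
  set ω := Real.log (n * m / δ) with hωdef
  set L := Real.log Tstar with hLdef
  have hL2 : 1 ≤ L ^ 2 := one_le_pow₀ hL
  have hω0 : 0 < ω := by linarith
  have hsq : b ^ 2 = ν ^ 2 * (σξ ^ 2 * d) ^ 2 / (n ^ 2 * (cΛ ^ 2 * L ^ 2)) := by
    rw [hb]; ring
  have hcΛ0 : 0 < cΛ := by linarith
  have hL0 : 0 < L := by linarith
  have h1 : b ^ 2 / (2 * (σξ ^ 2 * (2 * (σξ ^ 2 * d)))) =
      ν ^ 2 * d / (4 * (n ^ 2 * (cΛ ^ 2 * L ^ 2))) := by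
    rw [hsq]; field_simp; norm_num
  rw [h1, le_div_iff₀ (by positivity)]
  calc 4 * ω * (4 * (n ^ 2 * (cΛ ^ 2 * L ^ 2))) =
        (16 * cΛ ^ 2) * ((n : ℝ) ^ 2 * ω * L ^ 2) := by ring
    _ ≤ (C * ν ^ 2) * ((n : ℝ) ^ 2 * ω * L ^ 2) := by gcongr
    _ = ν ^ 2 * (C * ((n : ℝ) ^ 2 * ω * L ^ 2)) := by ring
    _ ≤ _ := by gcongr

/-- Bounded `n·SNR²` makes `‖μ‖²` smaller than `σξ²d` by a factor of order `1/n`, so this case has a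
factor `n` to spare, which is dropped at the end. -/
lemma signal_noise_exponent (H : Condition C c₁ c₂ τlo τhi Tstar n m d μ σξ σ0 η τp τm δ) (hc : 0 < c₁)
    (h4 : (4 : ℝ) ≤ n) (hC : 100 ≤ C) {ν cΛ : ℝ} (hcΛ : 1 ≤ cΛ)
    (hL : 1 ≤ Real.log Tstar) (hC₂ : 8 * c₂ * cΛ ^ 2 ≤ C * ν ^ 2) {b : ℝ}
    (hb : b = ν * (σξ ^ 2 * d) / (n * (cΛ * Real.log Tstar))) :
    4 * Real.log (n * m / δ) ≤ b ^ 2 / (2 * (σξ ^ 2 * ‖μ‖ ^ 2)) := by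
  have hσ := H.σξ_pos
  have hσ0 := H.σ0_pos
  have hd : (0 : ℝ) < d := by exact_mod_cast H.d_pos hc
  have hμ : 0 < ‖μ‖ := norm_pos_iff.2 (H.μ_ne hc)
  have hn := H.n_ge h4 hC
  have hω := H.log_nm_ge h4 hC
  have hdge := H.d_ge hC
  have hn0 : (0 : ℝ) < n := by linarith
  have hC0 : 0 < C := by linarith
  set ω := Real.log (n * m / δ) with hωdef
  set L := Real.log Tstar with hLdef
  have hL2 : 1 ≤ L ^ 2 := one_le_pow₀ hL
  have hω0 : 0 < ω := by linarith
  have hsq : b ^ 2 = ν ^ 2 * (σξ ^ 2 * d) ^ 2 / (n ^ 2 * (cΛ ^ 2 * L ^ 2)) := by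
    rw [hb]; ring
  have hcΛ0 : 0 < cΛ := by linarith
  have hL0 : 0 < L := by linarith
  rw [le_div_iff₀ (by positivity)]
  have h1 : ‖μ‖ ^ 2 ≤ c₂ * (σξ ^ 2 * d) / n := by
    rw [le_div_iff₀ hn0]; linarith [(H.signal_bounds hc).2]
  have hc₂ : 0 < c₂ := by
    by_contra h
    have := (H.signal_bounds hc).2
    have h2 : 0 < n * ‖μ‖ ^ 2 := by positivity
    have h3 : 0 < σξ ^ 2 * d := by positivity
    nlinarith
  calc 4 * ω * (2 * (σξ ^ 2 * ‖μ‖ ^ 2)) ≤ 4 * ω * (2 * (σξ ^ 2 * (c₂ * (σξ ^ 2 * d) / n))) := by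
        gcongr
    _ = (8 * c₂ * cΛ ^ 2) * ((n : ℝ) ^ 2 * ω * L ^ 2) *
        (σξ ^ 2 * (σξ ^ 2 * d) / (n ^ 3 * cΛ ^ 2 * L ^ 2)) := by field_simp; norm_num
    _ ≤ (C * ν ^ 2) * ((n : ℝ) ^ 2 * ω * L ^ 2) *
        (σξ ^ 2 * (σξ ^ 2 * d) / (n ^ 3 * cΛ ^ 2 * L ^ 2)) := by gcongr
    _ = ν ^ 2 * (C * ((n : ℝ) ^ 2 * ω * L ^ 2)) *
        (σξ ^ 2 * (σξ ^ 2 * d) / (n ^ 3 * cΛ ^ 2 * L ^ 2)) := by ring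
    _ ≤ ν ^ 2 * d * (σξ ^ 2 * (σξ ^ 2 * d) / (n ^ 3 * cΛ ^ 2 * L ^ 2)) := by gcongr
    _ = b ^ 2 / n := by rw [hsq]; field_simp
    _ ≤ b ^ 2 := div_le_self (by positivity) (by linarith)

/-- The variance scale `σ0²σξ²d` is at most `n / (C²d)`, and `d ≥ C n log(nm/δ)` turns this into
`C⁻³ / log(nm/δ)`. -/
lemma init_noise_exponent (H : Condition C c₁ c₂ τlo τhi Tstar n m d μ σξ σ0 η τp τm δ) (hc : 0 < c₁)
    (h4 : (4 : ℝ) ≤ n) (hC : 100 ≤ C) {ν : ℝ} (hL : 1 ≤ Real.log Tstar)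
    (hC₃ : 16 ≤ C * ν ^ 2) :
    4 * Real.log (n * m / δ) ≤ ν ^ 2 / (2 * (σ0 ^ 2 * (2 * (σξ ^ 2 * d)))) := by
  have hσ := H.σξ_pos
  have hσ0 := H.σ0_pos
  have hd : (0 : ℝ) < d := by exact_mod_cast H.d_pos hc
  have hμ : 0 < ‖μ‖ := norm_pos_iff.2 (H.μ_ne hc)
  have hn := H.n_ge h4 hC
  have hω := H.log_nm_ge h4 hC
  have hdge := H.d_ge hC
  have hn0 : (0 : ℝ) < n := by linarith
  have hC0 : 0 < C := by linarith
  set ω := Real.log (n * m / δ) with hωdef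
  set L := Real.log Tstar with hLdef
  have hL2 : 1 ≤ L ^ 2 := one_le_pow₀ hL
  have hω0 : 0 < ω := by linarith
  rw [le_div_iff₀ (by positivity)]
  have h1 := H.init_noise_small hc hC
  have h2 : C * (n * ω) ≤ d := by
    refine le_trans ?_ hdge
    have h3 : (n : ℝ) * ω ≤ (n : ℝ) ^ 2 * ω := by
      have : (n : ℝ) ≤ (n : ℝ) ^ 2 := by nlinarith
      gcongr
    have h5 : 0 ≤ (n : ℝ) ^ 2 * ω := by positivity
    have h6 : (n : ℝ) ^ 2 * ω ≤ (n : ℝ) ^ 2 * ω * L ^ 2 := by nlinarith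
    exact mul_le_mul_of_nonneg_left (h3.trans h6) hC0.le
  set s := σ0 ^ 2 * (σξ ^ 2 * d) with hs
  have hs0 : 0 < s := by positivity
  have h3 : C ^ 2 * s * (C * (n * ω)) ≤ n := (by gcongr : _ ≤ C ^ 2 * s * d).trans h1
  have h5 : C ^ 3 * s * ω ≤ 1 := by
    have : n * (C ^ 3 * s * ω) ≤ n * 1 := by linarith
    exact le_of_mul_le_mul_left this hn0
  have h6 : C ≤ C ^ 3 := by nlinarith [sq_nonneg C, mul_pos hC0 hC0]
  have h7 : C * (s * ω) ≤ 1 := by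
    have : C * (s * ω) ≤ C ^ 3 * (s * ω) := by gcongr
    linarith
  have h8 : 16 * (s * ω) ≤ C * ν ^ 2 * (s * ω) := by gcongr
  calc 4 * ω * (2 * (σ0 ^ 2 * (2 * (σξ ^ 2 * d)))) = 16 * (s * ω) := by rw [hs]; ring
    _ ≤ ν ^ 2 * (C * (s * ω)) := by linarith
    _ ≤ ν ^ 2 * 1 := by gcongr
    _ = _ := mul_one _

lemma init_signal_exponent (H : Condition C c₁ c₂ τlo τhi Tstar n m d μ σξ σ0 η τp τm δ) (hc : 0 < c₁)
    (h4 : (4 : ℝ) ≤ n) (hC : 100 ≤ C) {ν : ℝ} (hC₃ : 16 ≤ C * ν ^ 2) :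
    2 * Real.log (m / δ) ≤ ν ^ 2 / (2 * (σ0 ^ 2 * ‖μ‖ ^ 2)) := by
  have hσ0 := H.σ0_pos
  have hμ : 0 < ‖μ‖ := norm_pos_iff.2 (H.μ_ne hc)
  have hC0 : 0 < C := by linarith
  rw [le_div_iff₀ (by positivity)]
  have h1 := H.init_signal_small hc h4 hC
  have hl := H.log_m_ge h4 hC
  set s := σ0 ^ 2 * ‖μ‖ ^ 2 with hs
  set l := Real.log (m / δ) with hl
  have hs0 : 0 < s := by positivity
  have h2 : C * (s * l) ≤ C ^ 2 * (s * l) := by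
    have : C ≤ C ^ 2 := by nlinarith
    gcongr
  have h3 : 16 * (s * l) ≤ C * ν ^ 2 * (s * l) := by gcongr
  calc 2 * l * (2 * s) ≤ ν ^ 2 * (C * (s * l)) := by nlinarith [mul_pos hs0 (by linarith : 0 < l)]
    _ ≤ ν ^ 2 * 1 := by gcongr; linarith
    _ = _ := mul_one _

/-- The failure probability of the good event, with `b = ν σξ² d / (n cΛ log T*)`. -/
lemma failure_le (H : Condition C c₁ c₂ τlo τhi Tstar n m d μ σξ σ0 η τp τm δ) (hc : 0 < c₁)
    (h4 : (4 : ℝ) ≤ n) (hC : 100 ≤ C) {ν cΛ : ℝ} (hcΛ : 1 ≤ cΛ)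
    (hL : 1 ≤ Real.log Tstar) (hC₁ : 16 * cΛ ^ 2 ≤ C * ν ^ 2) (hC₂ : 8 * c₂ * cΛ ^ 2 ≤ C * ν ^ 2)
    (hC₃ : 16 ≤ C * ν ^ 2) {b : ℝ}
    (hb : b = ν * (σξ ^ 2 * d) / (n * (cΛ * Real.log Tstar))) :
    n * (2 * Real.exp (-(d / 16 : ℝ))) + 2 * m * (2 * Real.exp (-(d / 16 : ℝ))) +
        n * n * (2 * Real.exp (-(b ^ 2 / (2 * (σξ ^ 2 * (2 * (σξ ^ 2 * d))))))) +
        n * (2 * Real.exp (-(b ^ 2 / (2 * (σξ ^ 2 * ‖μ‖ ^ 2))))) +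
        2 * m * n * (2 * Real.exp (-(ν ^ 2 / (2 * (σ0 ^ 2 * (2 * (σξ ^ 2 * d))))))) +
        2 * m * (2 * Real.exp (-(ν ^ 2 / (2 * (σ0 ^ 2 * ‖μ‖ ^ 2))))) +
        n * Real.exp (-(m / 16 : ℝ)) ≤ δ := by
  have hδ := H.δ_pos
  have hδ1 := H.δ_lt
  have hd : (0 : ℝ) < d := by exact_mod_cast H.d_pos hc
  have hm := H.m_ge h4 (by linarith)
  have hn := H.n_ge h4 hC
  have hω := H.log_nm_ge h4 hC
  have hdge := H.d_ge hC
  have hm0 : (0 : ℝ) < m := by linarith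
  have hn0 : (0 : ℝ) < n := by linarith
  have hC0 : 0 < C := by linarith
  set ω := Real.log (n * m / δ) with hωdef
  set L := Real.log Tstar with hLdef
  have hL2 : 1 ≤ L ^ 2 := one_le_pow₀ hL
  have hn2 : 1 ≤ (n : ℝ) ^ 2 := one_le_pow₀ (by linarith)
  have hω0 : 0 < ω := by linarith
  have hnω : ω ≤ (n : ℝ) ^ 2 * ω * L ^ 2 := by
    have h1 : ω ≤ (n : ℝ) ^ 2 * ω := by nlinarith
    have h2 : 0 ≤ (n : ℝ) ^ 2 * ω := by positivity
    nlinarith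
  have x₁ : 4 * ω ≤ d / 16 := by nlinarith
  have x₂ := H.noise_noise_exponent hc h4 hC hcΛ hL hC₁ hb
  have x₃ := H.signal_noise_exponent hc h4 hC hcΛ hL hC₂ hb
  have x₄ := H.init_noise_exponent hc h4 hC hL hC₃
  have x₅ := H.init_signal_exponent hc h4 hC hC₃
  rw [← hωdef] at x₂ x₃ x₄
  have x₆ : 2 * Real.log (n / δ) ≤ m / 16 := by
    have h1 := H.log_n_ge h4
    have := H.width_large
    nlinarith
  set X := Real.exp (-ω) with hX
  have hXeq : X = δ / (n * m) := by
    rw [hX, Real.exp_neg, hωdef, Real.exp_log (by positivity), inv_div]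
  have hX4 : Real.exp (-(4 * ω)) = X ^ 4 := by
    rw [hX, ← Real.exp_nat_mul]; congr 1; push_cast; ring
  have hX0 : 0 < X := Real.exp_pos _
  have y₁ : Real.exp (-(d / 16 : ℝ)) ≤ X ^ 4 := by
    rw [← hX4]; exact Real.exp_le_exp.2 (by linarith)
  have y₂ : Real.exp (-(b ^ 2 / (2 * (σξ ^ 2 * (2 * (σξ ^ 2 * d)))))) ≤ X ^ 4 := by
    rw [← hX4]; exact Real.exp_le_exp.2 (by linarith)
  have y₃ : Real.exp (-(b ^ 2 / (2 * (σξ ^ 2 * ‖μ‖ ^ 2)))) ≤ X ^ 4 := by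
    rw [← hX4]; exact Real.exp_le_exp.2 (by linarith)
  have y₄ : Real.exp (-(ν ^ 2 / (2 * (σ0 ^ 2 * (2 * (σξ ^ 2 * d)))))) ≤ X ^ 4 := by
    rw [← hX4]; exact Real.exp_le_exp.2 (by linarith)
  have y₅ : Real.exp (-(ν ^ 2 / (2 * (σ0 ^ 2 * ‖μ‖ ^ 2)))) ≤ (δ / m) ^ 2 := by
    have : (δ / m) ^ 2 = Real.exp (-(2 * Real.log (m / δ))) := by
      rw [Real.exp_neg, two_mul, Real.exp_add, Real.exp_log (by positivity)]
      field_simp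
    rw [this]; exact Real.exp_le_exp.2 (by linarith)
  have y₆ : Real.exp (-(m / 16 : ℝ)) ≤ (δ / n) ^ 2 := by
    have : (δ / n) ^ 2 = Real.exp (-(2 * Real.log (n / δ))) := by
      rw [Real.exp_neg, two_mul, Real.exp_add, Real.exp_log (by positivity)]
      field_simp
    rw [this]; exact Real.exp_le_exp.2 (by linarith)
  rw [hXeq] at y₁ y₂ y₃ y₄
  exact union_bound_le (by linarith) (by linarith) hδ hδ1 y₁ y₂ y₃ y₄ y₅ y₆

end Condition

/-! ### Time scales -/

lemma stageOneScale_eq (n m d : ℕ) (σξ η : ℝ) :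
    stageOneScale n m d σξ η = (η * (σξ ^ 2 * d) / (n * m))⁻¹ := by
  unfold stageOneScale
  rw [inv_div, div_eq_mul_inv, mul_inv, mul_inv]
  ring

/-- The factor `1/4` bounds the squared logarithm from below, as `2 / min ε 1 ≥ 2`. -/
lemma le_maxIter {κ ε : ℝ} (hκ : 0 ≤ κ) (hε : 0 < ε) (n m d : ℕ) {σξ η : ℝ}
    (hS : 0 ≤ stageOneScale n m d σξ η) :
    κ / 4 * ((min ε 1)⁻¹ * stageOneScale n m d σξ η) ≤ maxIter κ ε n m d σξ η := by
  have h1 : 0 < min ε 1 := lt_min hε one_pos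
  have h2 : (2 : ℝ) ≤ 2 / min ε 1 := by
    rw [le_div_iff₀ h1]
    have := min_le_right ε 1
    linarith
  have h3 : 1 / 2 ≤ Real.log (2 / min ε 1) := by
    have := Real.log_le_log (by norm_num) h2
    linarith [Real.log_two_gt_d9]
  have h4 : 1 / 4 ≤ Real.log (2 / min ε 1) ^ 2 := by nlinarith
  unfold maxIter
  calc _ = κ * ((min ε 1)⁻¹ * stageOneScale n m d σξ η) * (1 / 4) := by ring
    _ ≤ _ := by gcongr

/-! ### Constants -/

/-- The constant in front of `log T*` in the bound on the coefficients, for a spread `B` of the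
margins. -/
def coeffConst (c₂ B : ℝ) : ℝ :=
  (16 + 8 * c₂ * Real.exp (B + 1)) * (2 * (1 + Real.log (1 + 4 * Real.exp (B + 1 / 2))) + 2 * B)

lemma log_one_add_exp_nonneg (B : ℝ) : 0 ≤ Real.log (1 + 4 * Real.exp B) :=
  Real.log_nonneg (by linarith [Real.exp_pos B])

lemma one_le_coeffConst {c₂ B : ℝ} (hc₂ : 0 ≤ c₂) (hB : 0 ≤ B) : 1 ≤ coeffConst c₂ B := by
  have h1 : 0 ≤ 8 * c₂ * Real.exp (B + 1) := by positivity
  exact one_le_mul_of_one_le_of_one_le (by linarith)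
    (by linarith [log_one_add_exp_nonneg (B + 1 / 2)])

lemma mul_log_le_coeffConst_mul {c₂ B s T : ℝ} (hc₂ : 0 ≤ c₂) (hB : 0 ≤ B) (hs : 0 ≤ s)
    (hsT : s ≤ T) (hT : 1 ≤ T) (hlog : 1 ≤ Real.log T) :
    (16 + 8 * c₂ * Real.exp (B + 1)) *
      (2 * Real.log (1 + 2 * 2 * Real.exp (B + 1 / 2) * s) + 2 * B) ≤
        coeffConst c₂ B * Real.log T := by
  have h0 := log_one_add_exp_nonneg (B + 1 / 2)
  have h1 : Real.log (1 + 2 * 2 * Real.exp (B + 1 / 2) * s) ≤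
      Real.log (1 + 4 * Real.exp (B + 1 / 2)) + Real.log T := by
    rw [← Real.log_mul (by positivity) (by positivity)]
    refine Real.log_le_log (by positivity) ?_
    have h3 : 4 * Real.exp (B + 1 / 2) * s ≤ 4 * Real.exp (B + 1 / 2) * T := by gcongr
    linarith
  have h2 : (2 * Real.log (1 + 4 * Real.exp (B + 1 / 2)) + 2 * B) * 1 ≤
      (2 * Real.log (1 + 4 * Real.exp (B + 1 / 2)) + 2 * B) * Real.log T := by gcongr
  rw [coeffConst, mul_assoc (16 + 8 * c₂ * Real.exp (B + 1))]
  exact mul_le_mul_of_nonneg_left (by linarith) (by positivity)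

/-- The requirements on the large constant of the standing condition. -/
lemma exists_condition_const {c₁ c₂ ν a : ℝ} (hc₁ : 0 < c₁) (hc₂ : 0 < c₂) (hν : 0 < ν) :
    ∃ C : ℝ, 100 ≤ C ∧ c₂ ≤ C * (ν * (3 + 1 / c₁)) ∧ 4 * (2 + 4 * c₂) ≤ C ∧
      16 * a ^ 2 ≤ C * ν ^ 2 ∧ 8 * c₂ * a ^ 2 ≤ C * ν ^ 2 ∧ 16 ≤ C * ν ^ 2 ∧
      16 * (4 + (4 / c₁ + 8) * a ^ 2) ≤ C := by
  have q₁ : 0 ≤ c₂ / (ν * (3 + 1 / c₁)) := by positivity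
  have q₂ : 0 ≤ 4 * (2 + 4 * c₂) := by positivity
  have q₃ : 0 ≤ 16 * a ^ 2 / ν ^ 2 := by positivity
  have q₄ : 0 ≤ 8 * c₂ * a ^ 2 / ν ^ 2 := by positivity
  have q₅ : 0 ≤ 16 / ν ^ 2 := by positivity
  have q₆ : 0 ≤ 16 * (4 + (4 / c₁ + 8) * a ^ 2) := by positivity
  refine ⟨100 + c₂ / (ν * (3 + 1 / c₁)) + 4 * (2 + 4 * c₂) + 16 * a ^ 2 / ν ^ 2 +
    8 * c₂ * a ^ 2 / ν ^ 2 + 16 / ν ^ 2 + 16 * (4 + (4 / c₁ + 8) * a ^ 2), by linarith, ?_,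
    by linarith, ?_, ?_, ?_, by linarith⟩
  all_goals
    rw [← div_le_iff₀ (by positivity)]
    linarith

/-- The initialization contributes `σ0²σξ²d` and training contributes `n log² T / d`. Both are
`O(1/(Cn))`, since `d` is at least `C n² log² T`. -/
lemma Condition.sq_mul_weight_le {C c₁ c₂ τlo τhi T σξ σ0 η τp τm δ a v : ℝ} {n m d : ℕ}
    {μ : Patch d} (H : Condition C c₁ c₂ τlo τhi T n m d μ σξ σ0 η τp τm δ) (hc₁ : 0 < c₁)
    (h4 : (4 : ℝ) ≤ n) (hC : 100 ≤ C) (hlog : 1 ≤ Real.log T)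
    (ha : 16 * (4 + (4 / c₁ + 8) * a ^ 2) ≤ C)
    (hv : v ≤ 2 * (2 * (σ0 ^ 2 * d)) + (4 / c₁ + 8) * (n * (a * Real.log T) ^ 2 / (σξ ^ 2 * d))) :
    σξ ^ 2 * v ≤ 1 / (16 * n) := by
  have hσ := H.σξ_pos
  have hd : (0 : ℝ) < d := by exact_mod_cast H.d_pos hc₁
  have hn0 : (0 : ℝ) < n := by linarith
  have hC0 : 0 < C := by linarith
  have hω := H.log_nm_ge h4 hC
  have h3 : C * (n ^ 2 * Real.log T ^ 2) ≤ d := by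
    refine le_trans (mul_le_mul_of_nonneg_left ?_ hC0.le) (H.d_ge hC)
    have : (n : ℝ) ^ 2 * Real.log T ^ 2 * 1 ≤
        (n : ℝ) ^ 2 * Real.log T ^ 2 * Real.log (n * m / δ) := by gcongr
    linarith
  have h5 : n * (a * Real.log T) ^ 2 / d ≤ a ^ 2 / (C * n) := by
    rw [div_le_div_iff₀ hd (by positivity)]
    calc n * (a * Real.log T) ^ 2 * (C * n) = a ^ 2 * (C * (n ^ 2 * Real.log T ^ 2)) := by ring
      _ ≤ a ^ 2 * d := by gcongr
  have h6 : σ0 ^ 2 * (σξ ^ 2 * d) ≤ 1 / (C * n) := by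
    rw [le_div_iff₀ (by positivity)]
    have h7 := H.init_noise_small hc₁ hC
    have h8 : C * (n : ℝ) ^ 2 ≤ d := by
      refine le_trans ?_ h3
      gcongr
      exact le_mul_of_one_le_right (by positivity) (one_le_pow₀ hlog)
    have h9 : C ^ 2 * (σ0 ^ 2 * (σξ ^ 2 * d)) * (C * (n : ℝ) ^ 2) ≤ n :=
      (by gcongr : _ ≤ C ^ 2 * (σ0 ^ 2 * (σξ ^ 2 * d)) * d).trans h7
    have h10 : n * (C ^ 2 * (σ0 ^ 2 * (σξ ^ 2 * d) * (C * n))) ≤ n * 1 := by linarith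
    have h11 := le_of_mul_le_mul_left h10 hn0
    have h12 : 1 * (σ0 ^ 2 * (σξ ^ 2 * d) * (C * n)) ≤
        C ^ 2 * (σ0 ^ 2 * (σξ ^ 2 * d) * (C * n)) := by
      gcongr
      exact one_le_pow₀ (by linarith)
    linarith
  calc σξ ^ 2 * v ≤ σξ ^ 2 *
        (2 * (2 * (σ0 ^ 2 * d)) + (4 / c₁ + 8) * (n * (a * Real.log T) ^ 2 / (σξ ^ 2 * d))) := by
        gcongr
    _ = 4 * (σ0 ^ 2 * (σξ ^ 2 * d)) + (4 / c₁ + 8) * (n * (a * Real.log T) ^ 2 / d) := by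
        field_simp
        ring
    _ ≤ 4 * (1 / (C * n)) + (4 / c₁ + 8) * (a ^ 2 / (C * n)) := by gcongr
    _ = (4 + (4 / c₁ + 8) * a ^ 2) / (C * n) := by ring
    _ ≤ 1 / (16 * n) := by
        rw [div_le_div_iff₀ (by positivity) (by positivity), one_mul]
        have := mul_le_mul_of_nonneg_right ha hn0.le
        linarith

/-- Waiting `e²` times longer than the loss requires gains the factor `e^{-2}`, which pushes the
margins above `1`. -/
lemma le_exp_mul_of_mul_le {B ε s x : ℝ} (hε : 0 < ε) (hx : 0 ≤ x)
    (hs : 16 * Real.exp (2 * B + 3) * ε⁻¹ ≤ s) (h : s * x ≤ 16 * Real.exp (2 * B + 1)) :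
    x ≤ Real.exp (-2) * ε := by
  have h2 : 16 * Real.exp (2 * B + 3) * ε⁻¹ * x ≤ 16 * Real.exp (2 * B + 1) :=
    (by gcongr : _ ≤ s * x).trans h
  have h3 : Real.exp (2 * B + 1) = Real.exp (2 * B + 3) * Real.exp (-2) := by
    rw [← Real.exp_add]
    ring_nf
  rw [h3] at h2
  have h5 : 16 * Real.exp (2 * B + 3) * (ε⁻¹ * x) ≤ 16 * Real.exp (2 * B + 3) * Real.exp (-2) := by
    linarith
  have h6 := le_of_mul_le_mul_left h5 (by positivity)
  rwa [inv_mul_le_iff₀ hε, mul_comm] at h6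

/-! ### Conclusion for a regular run -/

namespace Run

variable {n m d : ℕ}

lemma net_x (R : Run n m d) (W : Weights m d) (i : Fin n) :
    net W (R.x i) = net W (lab (R.y i) • R.μ, R.ξ i) := by
  unfold x trainInput
  split_ifs
  · rfl
  · unfold net branch
    simp only [add_comm]

namespace Regular

variable {R : Run n m d} {D ν Λ c₁ c₂ τp τm : ℝ}

/-- A constant fraction of the samples is memorized. -/
theorem exists_memorized (H : R.Regular D ν Λ c₁ c₂) (hν : 16 * (ν * (3 + 1 / c₁)) ≤ 1)
    {t : ℕ} (hC : R.Controlled Λ t) (hM : ∀ i, 1 ≤ R.margin t i)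
    (hL : LabelCounts R.y R.yt τp τm) {τ : ℝ} (hp : τ ≤ τp) (hm : τ ≤ τm) :
    ∃ τ' : ℝ, τ / 2 ≤ τ' ∧ τ' ≤ (τp + τm) / 2 ∧
      ((memorized R.x R.y R.yt (R.W t) (R.γ t) (R.ρ t)).ncard : ℝ) = τ' * n := by
  have hn : (0 : ℝ) < n := by exact_mod_cast H.n_pos
  set S := memorized R.x R.y R.yt (R.W t) (R.γ t) (R.ρ t) with hS
  have hle : ∀ A : Finset (Fin n), (∀ i ∈ A, i ∈ S) → (A.card : ℝ) ≤ S.ncard := by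
    intro A hA
    have h := Set.ncard_le_ncard (s := (A : Set (Fin n))) (t := S)
      (fun i hi => hA i (Finset.mem_coe.1 hi)) (Set.toFinite S)
    rw [Set.ncard_coe_finset] at h
    exact_mod_cast h
  have hnonneg : ∀ i, 0 ≤ lab (R.yt i) * net (R.W t) (R.x i) := fun i => by
    have := hM i
    unfold margin at this
    linarith
  refine ⟨S.ncard / n, ?_, ?_, by field_simp⟩
  · rw [le_div_iff₀ hn]
    -- If one noisy sample of class `+1` is not memorized, pairing it with each noisy sample of
    -- class `-1` shows that all of the latter are. Either way a whole class of noisy samples is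
    -- memorized.
    by_cases h : ∀ i, R.y i = 1 → R.yt i ≠ R.y i → i ∈ S
    · have h1 := hle ({i | R.y i = 1 ∧ R.yt i ≠ R.y i} : Finset (Fin n)) fun i hi => by
        simp only [Finset.mem_filter, Finset.mem_univ, true_and] at hi
        exact h i hi.1 hi.2
      rw [hL.pos_noisy] at h1
      nlinarith
    · push Not at h
      obtain ⟨i, hi, hi', hiS⟩ := h
      have h1 := hle ({i | R.y i = -1 ∧ R.yt i ≠ R.y i} : Finset (Fin n)) fun k hk => by
        simp only [Finset.mem_filter, Finset.mem_univ, true_and] at hk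
        rcases H.noise_dominates_or hν hC hi' hk.2 (by rw [hk.1, hi]) (hM i) (hM k) with h | h
        · exact absurd ⟨hi', h, hnonneg i⟩ hiS
        · exact ⟨hk.2, h, hnonneg k⟩
      rw [hL.neg_noisy] at h1
      nlinarith
  · rw [div_le_iff₀ hn]
    have h1 : (S.ncard : ℝ) ≤ ({i | R.yt i ≠ R.y i} : Finset (Fin n)).card := by
      have h := Set.ncard_le_ncard (s := S)
        (t := (({i | R.yt i ≠ R.y i} : Finset (Fin n)) : Set (Fin n)))
        (fun i hi => by simpa using (show _ ∧ _ from hi).1) (Set.toFinite _)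
      rw [Set.ncard_coe_finset] at h
      exact_mod_cast h
    rw [hL.card_noisy] at h1
    linarith

/-- All noisy samples contribute to the test error. -/
theorem le_testError (H : R.Regular D ν Λ c₁ c₂) {t : ℕ} (hM : ∀ i, 1 ≤ R.margin t i)
    (hL : LabelCounts R.y R.yt τp τm) {σ : ℝ}
    (hW : ∀ j r, σ ^ 2 * ‖R.W t j r‖ ^ 2 ≤ 1 / (16 * n)) :
    (τp + τm) / 4 * (1 - Real.exp (-(n : ℝ))) ≤ testError R.μ σ R.ξ (R.W t) := by
  have hn : (0 : ℝ) < n := by exact_mod_cast H.n_pos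
  have h1 := card_le_testError H.n_pos (μ := R.μ) (ξ := R.ξ) (response_tail H.n_pos H.m_pos hW) R.y
    ({i | R.yt i ≠ R.y i} : Finset (Fin n)) fun i hi => by
      simp only [Finset.mem_filter, Finset.mem_univ, true_and] at hi
      have h2 := hM i
      rw [margin, net_x, Int.units_ne_iff_eq_neg.1 hi, lab_neg] at h2
      linarith
  rw [hL.card_noisy] at h1
  refine le_trans (le_of_eq ?_) h1
  field_simp
  ring

end Regular
end Run

/-- When the fractions differ, the surplus `2 / n` of the noisy samples outweighs the loss `e^{-n}`,
because `(n + 1) e^{-n} ≤ 1`. -/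
lemma testError_bounds {n : ℕ} {y yt : Fin n → ℤˣ} {τp τm e : ℝ} (hL : LabelCounts y yt τp τm)
    (hn : 0 < n) (hp : 0 ≤ τp) (hm : 0 ≤ τm) (hp' : τp ≤ 1 / 2)
    (he : (τp + τm) / 4 * (1 - Real.exp (-(n : ℝ))) ≤ e) :
    (1 / 2) * (1 - Real.exp (-(n : ℝ))) * min τp τm ≤ e ∧
      (τp ≠ τm → (1 / 2) * min τp τm ≤ e) := by
  have hn' : (0 : ℝ) < n := by exact_mod_cast hn
  set q := Real.exp (-(n : ℝ)) with hq
  have hq1 : q ≤ 1 := Real.exp_le_one_iff.2 (by linarith)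
  have hq0 : 0 < q := Real.exp_pos _
  set μ := min τp τm with hμ
  have h0 : 0 ≤ μ := le_min hp hm
  have h1 : μ ≤ τp := min_le_left _ _
  have h2 : μ ≤ τm := min_le_right _ _
  constructor
  · refine le_trans ?_ he
    nlinarith
  · intro hne
    refine le_trans ?_ he
    have h3 := hL.two_min_add_le hn hne
    have h4 : q * (n + 1) ≤ 1 := by
      rw [hq, Real.exp_neg, inv_mul_le_iff₀ (Real.exp_pos _), mul_one]
      exact Real.add_one_le_exp _
    have h5 : q * n * μ ≤ 1 - q := by
      have : q * n * μ ≤ q * n * 1 := by gcongr; linarith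
      linarith
    have h6 : q * μ ≤ 1 / n * (1 - q) := by
      rw [one_div, ← div_eq_inv_mul, le_div_iff₀ hn']
      linarith
    have h7 : (2 * μ + 2 / n) / 4 * (1 - q) ≤ (τp + τm) / 4 * (1 - q) := by
      gcongr
    refine le_trans ?_ h7
    have h8 : (2 * μ + 2 / n) / 4 * (1 - q) = 1 / 2 * (μ - q * μ + 1 / n * (1 - q)) := by ring
    rw [h8]
    linarith

end LabelNoise

end

/-! ### The main theorem: choice of constants and of the stopping time. -/

open LabelNoise in
theorem theorem4p2 (c₁ c₂ τlo τhi κ₁ : ℝ) (hc₁ : 0 < c₁) (hc : c₁ ≤ c₂)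
    (hτlo : 0 < τlo) (hτ : τlo ≤ τhi) (hτhi : τhi < 1 / 2) (hκ₁ : 0 < κ₁) :
    ∃ C κ τ₀ : ℝ, 0 < C ∧ 0 < κ ∧ 0 < τ₀ ∧
      ∀ (ε : ℝ), 0 < ε →
      ∀ (n m d : ℕ) (μ : Patch d) (σξ σ0 η τp τm δ : ℝ),
        Condition C c₁ c₂ τlo τhi (maxIter κ ε n m d σξ η) n m d μ σξ σ0 η τp τm δ →
      ∀ (y yt : Fin n → ℤˣ) (pos : Fin n → Bool), LabelCounts y yt τp τm →
      ∃ E : Set (Weights m d × (Fin n → Patch d)), MeasurableSet E ∧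
        1 - δ ≤ (trainLaw n m d σ0 σξ).real E ∧
        ∀ W₀ ξ, (W₀, ξ) ∈ E →
        ∀ T₁ : ℕ, (T₁ : ℝ) ≤ κ₁ * stageOneScale n m d σξ η →
        ∃ t : ℕ, T₁ ≤ t ∧ (t : ℝ) ≤ maxIter κ ε n m d σξ η ∧
          let x := trainInput μ y pos ξ
          let W := gd η x yt W₀ t
          trainLoss x yt W ≤ ε ∧
          (∀ i, yt i = y i → 0 ≤ lab (yt i) * net W (x i)) ∧
          (∃ γ ρ, IsUniqueDecomposition μ ξ W₀ W γ ρ ∧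
            ∃ τ' : ℝ, τ₀ ≤ τ' ∧ τ' ≤ (τp + τm) / 2 ∧
              ((memorized x y yt W γ ρ).ncard : ℝ) = τ' * n) ∧
          (1 / 2) * (1 - Real.exp (-(n : ℝ))) * min τp τm ≤ testError μ σξ ξ W ∧
          (τp ≠ τm → (1 / 2) * min τp τm ≤ testError μ σξ ξ W) := by
  have hc₂ : 0 < c₂ := by linarith
  have hp : 0 < τlo / 2 := by linarith
  have hp1 : τlo / 2 ≤ 1 := by linarith
  set B := marginGap (1 / 8) 2 c₂ (τlo / 2) with hB
  have hB0 : 0 ≤ B := MarginFlow.marginGap_nonneg hp (by norm_num) (by norm_num) hp1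
  -- The two terms serve the margin approximation and the persistence of active neurons. The gap
  -- `B`, and hence `ν`, depends on the given constants only.
  set ν := 1 / (16 * (3 + 1 / c₁) + 4 * Real.exp (B + 1)) with hν
  have hν0 : 0 < ν := by positivity
  have hν1 : 16 * (ν * (3 + 1 / c₁)) ≤ 1 := by
    rw [hν, one_div_mul_eq_div, mul_div_assoc', div_le_one (by positivity)]
    linarith [Real.exp_pos (B + 1)]
  have hν2 : 4 * Real.exp (B + 1) * ν ≤ 1 := by
    rw [hν, mul_one_div, div_le_one (by positivity)]
    have : 0 < 16 * (3 + 1 / c₁) := by positivity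
    linarith
  set cΛ := coeffConst c₂ B with hcΛ
  have hcΛ1 : 1 ≤ cΛ := one_le_coeffConst hc₂.le hB0
  -- The `4` offsets the lower bound `1/4` on the squared logarithm in `T*`. The summands make the
  -- margins large, put `t` beyond `T₁`, and pay for rounding `T*` down.
  set κ := 4 * (16 * Real.exp (2 * B + 3) + κ₁ + 1) with hκ
  have hκ0 : 0 < κ := by positivity
  obtain ⟨C, hC100, k₁, k₂, k₃, k₄, k₅, k₆⟩ := exists_condition_const (a := cΛ) hc₁ hc₂ hν0
  have hC0 : 0 < C := by linarith
  clear_value ν cΛ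
  refine ⟨C, κ, τlo / 2, hC0, hκ0, hp, ?_⟩
  intro ε hε n m d μ σξ σ0 η τp τm δ H y yt pos hL
  have hσ := H.σξ_pos
  have hη := H.η_pos
  have hnpos := H.n_pos hc₁
  have hdpos := H.d_pos hc₁
  have hd : (0 : ℝ) < d := by exact_mod_cast hdpos
  have hτp := H.τp_mem
  have hτm := H.τm_mem
  have h4 := hL.four_le hnpos (by linarith [hτp.1]) (by linarith [hτp.2])
  have hmC := H.m_ge h4 hC0.le
  have hnC := H.n_ge h4 hC100
  have hn0 : (0 : ℝ) < n := by linarith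
  have hm0 : (0 : ℝ) < m := by linarith
  have hmpos : 0 < m := by exact_mod_cast hm0
  set D := σξ ^ 2 * d with hD
  have hD0 : 0 < D := by positivity
  set h := η * D / (n * m) with hh
  have hh0 : 0 < h := by positivity
  have hhC : C * h ≤ 1 := H.rate_le hc₁ h4 hC100
  have hh1 : h ≤ 1 := by
    have : 1 * h ≤ C * h := by gcongr; linarith
    linarith
  have hS : stageOneScale n m d σξ η = h⁻¹ := stageOneScale_eq n m d σξ η
  set Ts := maxIter κ ε n m d σξ η with hTs
  set ε₁ := min ε 1 with hε₁
  have hε₁0 : 0 < ε₁ := lt_min hε one_pos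
  have hε₁1 : 1 ≤ ε₁⁻¹ := (one_le_inv₀ hε₁0).2 (min_le_right _ _)
  have hTlow : κ / 4 * (ε₁⁻¹ * h⁻¹) ≤ Ts := by
    have := le_maxIter hκ0.le hε n m d (σξ := σξ) (η := η) (by rw [hS]; positivity)
    rwa [hS] at this
  have hhinv : C ≤ h⁻¹ := by
    rw [le_inv_comm₀ hC0 hh0, ← one_div, le_div_iff₀ hC0]; linarith
  have hκ4 : κ / 4 = 16 * Real.exp (2 * B + 3) + κ₁ + 1 := by rw [hκ]; ring
  have hexp0 : 0 < 16 * Real.exp (2 * B + 3) := by positivity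
  have hmul : h⁻¹ ≤ ε₁⁻¹ * h⁻¹ := le_mul_of_one_le_left (by positivity) hε₁1
  have hTs100 : 100 ≤ Ts := by
    rw [hκ4] at hTlow
    have : 1 * (ε₁⁻¹ * h⁻¹) ≤ (16 * Real.exp (2 * B + 3) + κ₁ + 1) * (ε₁⁻¹ * h⁻¹) := by
      gcongr; linarith
    linarith
  have hLog : 1 ≤ Real.log Ts := by
    rw [Real.le_log_iff_exp_le (by linarith)]
    linarith [Real.exp_one_lt_d9]
  set L := Real.log Ts with hLdef
  set Λ := cΛ * L with hΛ
  have hΛ1 : 1 ≤ Λ := one_le_mul_of_one_le_of_one_le hcΛ1 hLog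
  set b := ν * D / (n * Λ) with hb
  obtain ⟨E, hEm, hEp, hE⟩ := exists_good_event (n := n) (m := m) yt (H.μ_ne hc₁) H.σ0_pos hσ hdpos
    (b := b) (ν := ν) (by positivity) hν0.le
  have hfail := H.failure_le hc₁ h4 hC100 hcΛ1 hLog k₃ k₄ k₅ hb
  refine ⟨E, hEm, by linarith, fun W₀ ξ hmem T₁ hT₁ => ?_⟩
  obtain ⟨g₁, g₂, g₃, g₄, g₅, g₆, g₇⟩ := hE W₀ ξ hmem
  obtain ⟨s₁, s₂⟩ := H.signal_bounds hc₁
  let R : Run n m d := ⟨μ, y, yt, pos, ξ, η, W₀⟩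
  have hR : R.Regular D ν Λ c₁ c₂ :=
    { n_pos := hnpos
      m_pos := hmpos
      η_pos := hη
      D_pos := hD0
      ν_nonneg := hν0.le
      Λ_ge := hΛ1
      c₁_pos := hc₁
      signal_lower := s₁
      signal_upper := s₂
      noise_lower := fun i => (g₁ i).1
      noise_upper := fun i => (g₁ i).2
      noise_noise := g₃
      signal_noise := g₄
      init_noise := g₅
      init_signal := g₆
      active := g₇ }
  have hrate : R.rate D = h := rfl
  have hpop : Populated R.y R.clean (τlo / 2) :=
    hL.populated hτp.1 hτm.1 (by linarith [hτp.2]) (by linarith [hτm.2])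
  -- One stopping time, the last step allowed by `T*`, serves every `T₁`.
  set t := ⌊Ts⌋₊ with ht
  have htle : (t : ℝ) ≤ Ts := Nat.floor_le (by linarith)
  have htge : Ts ≤ t + 1 := (Nat.lt_floor_add_one Ts).le
  have hstep : R.rate D * c₂ ≤ ν * (3 + 1 / c₁) := by
    rw [hrate]
    calc h * c₂ ≤ h * (C * (ν * (3 + 1 / c₁))) := by gcongr
      _ = (C * h) * (ν * (3 + 1 / c₁)) := by ring
      _ ≤ 1 * (ν * (3 + 1 / c₁)) := by gcongr
      _ = _ := one_mul _
  have hsmall : R.rate D * (2 + 4 * c₂) ≤ 1 / 4 := by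
    rw [hrate]
    have : h * (4 * (2 + 4 * c₂)) ≤ h * C := by gcongr
    linarith
  have hΛle : (16 + 8 * c₂ * Real.exp (B + 1)) *
      (2 * Real.log (1 + 2 * 2 * Real.exp (B + 1 / 2) * (R.rate D * t)) + 2 * B) ≤ Λ := by
    rw [hΛ, hcΛ]
    refine mul_log_le_coeffConst_mul hc₂.le hB0 (by rw [hrate]; positivity) ?_ (by linarith) hLog
    rw [hrate]
    calc h * t ≤ 1 * Ts := by gcongr
      _ = Ts := one_mul _
  have hCtrl := hR.controlled hp hp1 hpop hstep hν1 hsmall hν2 hΛle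
  -- Rounding loses at most one step, hence at most `h ≤ 1`, which the summand `κ₁ + 1` of `κ / 4`
  -- covers.
  have hht : 16 * Real.exp (2 * B + 3) * ε₁⁻¹ ≤ h * t := by
    have h1 : h * (κ / 4 * (ε₁⁻¹ * h⁻¹)) ≤ h * (t + 1) := by
      gcongr
      linarith
    have h2 : h * (κ / 4 * (ε₁⁻¹ * h⁻¹)) = κ / 4 * ε₁⁻¹ := by field_simp
    rw [h2, hκ4] at h1
    have h3 : 1 ≤ (κ₁ + 1) * ε₁⁻¹ :=
      one_le_mul_of_one_le_of_one_le (by linarith) hε₁1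
    linarith
  have hmarg : ∀ i, Real.exp (-R.margin t i) ≤ Real.exp (-2) * ε₁ := by
    intro i
    have h1 := hR.exp_neg_margin_le hp hp1 hpop hstep hν1 hsmall (t := t) hCtrl i
    rw [hrate] at h1
    exact le_exp_mul_of_mul_le hε₁0 (Real.exp_pos _).le hht h1
  have hM : ∀ i, 1 ≤ R.margin t i := by
    intro i
    have h1 : Real.exp (-R.margin t i) ≤ Real.exp (-2) :=
      (hmarg i).trans (mul_le_of_le_one_right (Real.exp_pos _).le (min_le_right _ _))
    linarith [Real.exp_le_exp.1 h1]
  have hloss : ∀ i, Real.exp (-R.margin t i) ≤ ε := by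
    intro i
    have h1 : Real.exp (-2) ≤ 1 := Real.exp_le_one_iff.2 (by norm_num)
    have h2 : Real.exp (-2) * ε₁ ≤ ε₁ := mul_le_of_le_one_left hε₁0.le h1
    exact (hmarg i).trans (h2.trans (min_le_left _ _))
  have hW : ∀ j r, σξ ^ 2 * ‖R.W t j r‖ ^ 2 ≤ 1 / (16 * n) := by
    intro j r
    have h1 := hR.sq_norm_W_le hν1 (hCtrl t le_rfl) j r
    have h2 : ‖R.W₀ j r‖ ^ 2 ≤ 2 * (σ0 ^ 2 * d) := g₂ j r
    exact H.sq_mul_weight_le hc₁ h4 hC100 hLog k₆ (h1.trans (by gcongr))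
  have hT₁t : T₁ ≤ t := by
    refine Nat.le_floor (hT₁.trans ?_)
    rw [hS]
    refine le_trans ?_ hTlow
    rw [hκ4]
    calc κ₁ * h⁻¹ ≤ κ₁ * (ε₁⁻¹ * h⁻¹) := by gcongr
      _ ≤ _ := by gcongr; linarith
  have htest := testError_bounds hL hnpos (by linarith [hτp.1]) (by linarith [hτm.1])
    (by linarith [hτp.2]) (hR.le_testError hM hL hW)
  exact ⟨t, hT₁t, htle, R.trainLoss_le hnpos hloss, fun i _ => zero_le_one.trans (hM i),
    ⟨R.γ t, R.ρ t, hR.isUniqueDecomposition hν1 t,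
      hR.exists_memorized hν1 (hCtrl t le_rfl) hM hL hτp.1 hτm.1⟩, htest.1, htest.2⟩
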